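/- Let $M$ be a smooth manifold, $(A,\rho,[\![\cdot,\cdot]\!])$ a (real) Lie algebroid over $M$, and $E\to M$ a smooth real vector bundle, both of finite rank. *Conventions.* A covariant differential operator on $E$ with symbol $X\in\mathfrak X(M)$ is an $\mathbb R$-linear map $\ell:\Gamma(E)\to\Gamma(E)$ with $\ell(f\zeta)=f\,\ell(\zeta)+X(f)\,\zeta$ for all $f\in C^\infty(M)$, $\zeta\in\Gamma(E)$. An $\mathbb R$-linear connection of $A$ on $E$ is an $\mathbb R$-linear map $\nabla$, $a\mapsto\nabla_a$, from $\Gamma(A)$ to covariant differential operators on $E$ such that $\nabla_a$ has symbol $\rho\circ a$; neither $C^\infty(M)$-linearity nor locality in $a$ is required. Its curvature is $R^\nabla_{a,b}=[\nabla_a,\nabla_b]-\nabla_{[\![a,b]\!]}\in\Gamma(\operatorname{End}E)$. For $p\ge 1$ the Chern character form is the $\mathbb R$-multilinear alternating $2p$-form on $\Gamma(A)$ with values in $C^\infty(M)$ $$\operatorname{ch}_p(\nabla)(a_1,\dots,a_{2p})=\frac1{2^p}\sum_{\tau\in S_{2p}}\operatorname{sgn}(\tau)\,\operatorname{Tr}\bigl(R^\nabla_{a_{\tau(1)},a_{\tau(2)}}\circ\cdots\circ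 R^\nabla_{a_{\tau(2p-1)},a_{\tau(2p)}}\bigr).$$ For an $\mathbb R$-multilinear alternating $n$-form $\eta$ on $\Gamma(A)$ with values in $C^\infty(M)$, $$(d_{A,\mathbb R}\eta)(a_1,\dots,a_{n+1})=\sum_{i=1}^{n+1}(-1)^{i+1}(\rho\circ a_i)\bigl(\eta(a_1,\dots\hat\imath\dots,a_{n+1})\bigr)+\sum_{i<j}(-1)^{i+j}\eta([\![a_i,a_j]\!],a_1,\dots\hat\imath\dots\hat\jmath\dots,a_{n+1}).$$ Let $\nabla^0,\dots,\nabla^k$ be $\mathbb R$-linear connections of $A$ on $E$, $k\ge1$. For $u\in\mathbb R^k$ and $a\in\Gamma(A)$ let $(u,a)$ denote the section $(t,x)\mapsto(u,a(x))$ of the product Lie algebroid $T\mathbb R^k\times A$ over $\mathbb R^k\times M$; these sections form the Lie algebra $\mathbb R^k\times\Gamma(A)$ with bracket $[(u,a),(v,b)]=(0,[\![a,b]\!])$, acting on $C^\infty(\mathbb R^k\times M)$ through the anchor. The affine combination $\nabla^{\mathrm{aff}}$ of $\nabla^0,\dots,\nabla^k$ is the $\mathbb R$-linear connection of this Lie algebra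 on $\operatorname{pr}_2^*E\to\mathbb R^k\times M$ which, for a section $S$ of $\operatorname{pr}_2^*E$ with restrictions $S_t=S(t,\cdot)\in\Gamma(E)$, is given by $$(\nabla^{\mathrm{aff}}_{(u,a)}S)(t,\cdot)=\sum_{j=1}^k u_j\,\frac{\partial S}{\partial t_j}(t,\cdot)+\Bigl(1-\sum_{i=1}^kt_i\Bigr)\nabla^0_aS_t+\sum_{i=1}^kt_i\,\nabla^i_aS_t .$$ (Its curvature and $\operatorname{ch}_p(\nabla^{\mathrm{aff}})$, with values in $C^\infty(\mathbb R^k\times M)$, are given by the formulas above.) With $\Delta^k=\{t\in\mathbb R^k: t_i\ge0,\ \sum_i t_i\le1\}$ put, for $0<k\le2p$, $$\operatorname{cs}_p(\nabla^0,\dots,\nabla^k)(a_1,\dots,a_{2p-k})=\int_{\Delta^k}\operatorname{ch}_p(\nabla^{\mathrm{aff}})\Bigl(\tfrac{\partial}{\partial t_1},\dots,\tfrac{\partial}{\partial t_k},a_1,\dots,a_{2p-k}\Bigr)\Big|_{(t,\cdot)}\,dt_1\cdots dt_k ,$$ where $\partial/\partial t_j=(e_j,0)$ and $a_i$ stands for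 $(0,a_i)$, and put $\operatorname{cs}_p(\nabla^0)=\operatorname{ch}_p(\nabla^0)$. **Theorem (Chern–Simons formula for Lie algebroids and $\mathbb R$-linear connections).** For all integers $k,p$ with $0<k\le2p$ and all $\mathbb R$-linear connections $\nabla^0,\dots,\nabla^k$ of $A$ on $E$, $$(-1)^{k+1}\,d_{A,\mathbb R}\bigl(\operatorname{cs}_p(\nabla^0,\dots,\nabla^k)\bigr)=\sum_{j=0}^k(-1)^j\operatorname{cs}_p(\nabla^0,\dots,\widehat{\nabla^j},\dots,\nabla^k).$$ Moreover $d_{A,\mathbb R}\bigl(\operatorname{ch}_p(\nabla^0)\bigr)=0$ for every $p\ge1$ and every $\mathbb R$-linear connection $\nabla^0$ of $A$ on $E$. -/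

import Mathlib

open Bundle
open scoped Manifold ContDiff Topology

noncomputable section

namespace LieAlgebroidCS

section Sections

variable {V : Type*} [NormedAddCommGroup V] [NormedSpace ℝ V] {H : Type*} [TopologicalSpace H]
  {I : ModelWithCorners ℝ V H} {M : Type*} [TopologicalSpace M] [ChartedSpace H M]
  {F : Type*} [NormedAddCommGroup F] [NormedSpace ℝ F] {E : M → Type*}
  [TopologicalSpace (TotalSpace F E)] [∀ x, AddCommGroup (E x)] [∀ x, Module ℝ (E x)]
  [∀ x, TopologicalSpace (E x)] [FiberBundle F E] [VectorBundle ℝ F E]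

instance sectionSMul : SMul C^∞⟮I, M; ℝ⟯ Cₛ^∞⟮I; F, E⟯ :=
  ⟨fun f s => ⟨(f : M → ℝ) • (s : ∀ x, E x), f.contMDiff.smul_section s.contMDiff⟩⟩

@[simp] theorem section_smul_apply (f : C^∞⟮I, M; ℝ⟯) (s : Cₛ^∞⟮I; F, E⟯) (x : M) :
    (f • s) x = f x • s x := rfl

/-- Pointwise multiplication makes `Γ(E)` a module over `C^∞(M)`. -/
instance sectionModule : Module C^∞⟮I, M; ℝ⟯ Cₛ^∞⟮I; F, E⟯ where
  one_smul s := by ext x; exact one_smul ℝ (s x)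
  mul_smul f g s := by ext x; exact mul_smul (f x) (g x) (s x)
  smul_zero f := by ext x; exact smul_zero (f x)
  smul_add f s t := by ext x; exact smul_add (f x) (s x) (t x)
  add_smul f g s := by ext x; exact add_smul (f x) (g x) (s x)
  zero_smul s := by ext x; exact zero_smul ℝ (s x)

instance sectionTower : IsScalarTower ℝ C^∞⟮I, M; ℝ⟯ Cₛ^∞⟮I; F, E⟯ :=
  ⟨fun c f s => by ext x; exact mul_smul c (f x) (s x)⟩

instance sectionComm : SMulCommClass C^∞⟮I, M; ℝ⟯ ℝ Cₛ^∞⟮I; F, E⟯ :=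
  ⟨fun f c s => by ext x; exact smul_comm (f x) c (s x)⟩

instance sectionComm' : SMulCommClass ℝ C^∞⟮I, M; ℝ⟯ Cₛ^∞⟮I; F, E⟯ :=
  ⟨fun c f s => by ext x; exact smul_comm c (f x) (s x)⟩

end Sections

section VectorFields

variable {V : Type*} [NormedAddCommGroup V] [NormedSpace ℝ V] {H : Type*} [TopologicalSpace H]
  (I : ModelWithCorners ℝ V H) (M : Type*) [TopologicalSpace M] [ChartedSpace H M]
  [IsManifold I ∞ M]

instance : IsManifold I 1 M := IsManifold.of_le (n := ∞) (by simp)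

/-- Smooth vector fields on `M`. -/
abbrev VectorFields : Type _ := Cₛ^∞⟮I; V, (TangentSpace I : M → Type _)⟯

variable {I M}

theorem contMDiff_vectorField_apply (X : VectorFields I M) (f : C^∞⟮I, M; ℝ⟯) :
    ContMDiff I 𝓘(ℝ, ℝ) ∞ (fun x => (mfderiv I 𝓘(ℝ, ℝ) f x (X x) : ℝ)) := by
  have h1 : ContMDiff I.tangent 𝓘(ℝ, ℝ).tangent ∞ (tangentMap I 𝓘(ℝ, ℝ) f) :=
    f.contMDiff.contMDiff_tangentMap (by simp)
  have h2 := h1.comp X.contMDiff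
  intro x
  have h3 := (contMDiffAt_totalSpace.1 (h2 x)).2
  simpa [tangentMap, Function.comp_def] using! h3

/-- The derivation `f ↦ X(f)` of `C^∞(M)` given by a smooth vector field `X`. -/
def vectorFieldDerivation (X : VectorFields I M) : Derivation ℝ C^∞⟮I, M; ℝ⟯ C^∞⟮I, M; ℝ⟯ :=
  Derivation.mk'
    { toFun := fun f => ⟨fun x => mfderiv I 𝓘(ℝ, ℝ) f x (X x), contMDiff_vectorField_apply X f⟩
      map_add' := fun f g => by
        ext x
        change (mfderiv I 𝓘(ℝ, ℝ) ((f : M → ℝ) + (g : M → ℝ)) x (X x) : ℝ) = _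
        rw [mfderiv_add f.mdifferentiableAt g.mdifferentiableAt]
        rfl
      map_smul' := fun c f => by
        ext x
        change (mfderiv I 𝓘(ℝ, ℝ) (c • (f : M → ℝ)) x (X x) : ℝ) = _
        rw [const_smul_mfderiv f.mdifferentiableAt]
        rfl }
    (fun f g => by
      ext x
      change (mfderiv I 𝓘(ℝ, ℝ) ((f : M → ℝ) * (g : M → ℝ)) x (X x) : ℝ) = _
      rw [(f.mdifferentiableAt.hasMFDerivAt.mul g.mdifferentiableAt.hasMFDerivAt).mfderiv]
      rfl)

theorem vectorFieldDerivation_apply (X : VectorFields I M) (f : C^∞⟮I, M; ℝ⟯) (x : M) :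
    vectorFieldDerivation X f x = mfderiv I 𝓘(ℝ, ℝ) f x (X x) := rfl

/-- `X ↦ (f ↦ X(f))` as a linear map. -/
def vectorFieldDerivationₗ :
    VectorFields I M →ₗ[ℝ] Derivation ℝ C^∞⟮I, M; ℝ⟯ C^∞⟮I, M; ℝ⟯ where
  toFun := vectorFieldDerivation
  map_add' X Y := by
    ext f x
    exact map_add (mfderiv I 𝓘(ℝ, ℝ) f x) (X x) (Y x)
  map_smul' c X := by
    ext f x
    exact map_smul (mfderiv I 𝓘(ℝ, ℝ) f x) c (X x)

end VectorFields

section LocalFrames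

variable {V : Type*} [NormedAddCommGroup V] [NormedSpace ℝ V] [FiniteDimensional ℝ V]
  {H : Type*} [TopologicalSpace H]
  (I : ModelWithCorners ℝ V H) {M : Type*} [TopologicalSpace M] [ChartedSpace H M]
  [IsManifold I ∞ M] [T2Space M]
  (F : Type*) [NormedAddCommGroup F] [NormedSpace ℝ F] [FiniteDimensional ℝ F] (E : M → Type*)
  [TopologicalSpace (TotalSpace F E)] [∀ x, AddCommGroup (E x)] [∀ x, Module ℝ (E x)]
  [∀ x, TopologicalSpace (E x)] [FiberBundle F E] [VectorBundle ℝ F E]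
  [ContMDiffVectorBundle ∞ F E I]

/-- Near any point there are finitely many global sections `e i` and smooth fibrewise linear
functionals `c i` such that `∑ c i(v) e i = v`. -/
theorem exists_local_frame (x₀ : M) : ∃ (n : ℕ) (ψ : C^∞⟮I, M; ℝ⟯)
    (e : Fin n → Cₛ^∞⟮I; F, E⟯) (c : Fin n → ∀ x, E x →ₗ[ℝ] ℝ),
    (∀ i, ContMDiff (I.prod 𝓘(ℝ, F)) 𝓘(ℝ, ℝ) ∞ (fun v : TotalSpace F E => c i v.1 v.2)) ∧
    (∀ x v, ψ x • v = ∑ i, c i x v • e i x) ∧ (∀ᶠ x in 𝓝 x₀, ψ x = 1) := by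
  set t := trivializationAt F E x₀
  have ht : t.baseSet ∈ 𝓝 x₀ :=
    t.open_baseSet.mem_nhds (FiberBundle.mem_baseSet_trivializationAt F E x₀)
  obtain ⟨χ, hχ⟩ : ∃ χ : SmoothBumpFunction I x₀, tsupport χ ⊆ t.baseSet := by
    obtain ⟨χ, -, h⟩ := (SmoothBumpFunction.nhds_basis_tsupport (I := I) x₀).mem_iff.1 ht
    exact ⟨χ, h⟩
  set b := Module.finBasis ℝ F
  refine ⟨Module.finrank ℝ F, ⟨fun x => χ x * χ x, χ.contMDiff.mul χ.contMDiff⟩,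
    fun i => ⟨(χ : M → ℝ) • t.localFrame b i,
      ContMDiffOn.smul_section_of_tsupport (χ.contMDiff.contMDiffOn) t.open_baseSet hχ
        (t.contMDiffOn_localFrame_baseSet (n := ∞) b i)⟩,
    fun i x => χ x • (b.coord i ∘ₗ t.linearMapAt ℝ x), fun i => ?_, fun x v => ?_, ?_⟩
  · have hproj : ContMDiff (I.prod 𝓘(ℝ, F)) I ∞ (Bundle.TotalSpace.proj : TotalSpace F E → M) :=
      Bundle.contMDiff_proj E
    refine contMDiff_of_contMDiffOn_union_of_isOpen (s := t.source)
      (t := Bundle.TotalSpace.proj ⁻¹' (tsupport χ)ᶜ) ?_ ?_ ?_ t.open_source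
      ((isClosed_tsupport χ).isOpen_compl.preimage hproj.continuous)
    · have h1 : ContMDiffOn (I.prod 𝓘(ℝ, F)) 𝓘(ℝ, F) ∞ (fun v : TotalSpace F E => (t v).2)
          t.source := contMDiff_snd.comp_contMDiffOn (t.contMDiffOn (IB := I) (n := ∞))
      have h2 : ContMDiffOn (I.prod 𝓘(ℝ, F)) 𝓘(ℝ, ℝ) ∞
          (fun v : TotalSpace F E => χ v.1 * b.coord i (t v).2) t.source := by
        refine ((χ.contMDiff.comp hproj).contMDiffOn).mul ?_
        exact ((b.coord i).toContinuousLinearMap.contMDiff).comp_contMDiffOn h1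
      refine h2.congr fun v hv => ?_
      have hv' : v.1 ∈ t.baseSet := t.mem_source.1 hv
      simp [t.linearMapAt_def_of_mem hv']
    · refine (contMDiffOn_const (c := (0 : ℝ))).congr fun v hv => ?_
      have : χ v.1 = 0 := image_eq_zero_of_notMem_tsupport hv
      simp [this]
    · ext v
      simp only [Set.mem_union, Set.mem_univ, iff_true, t.mem_source, Set.mem_preimage,
        Set.mem_compl_iff]
      by_cases h : v.1 ∈ tsupport χ
      · exact Or.inl (hχ h)
      · exact Or.inr h
  · by_cases hx : x ∈ t.baseSet
    · have key : v = ∑ i, (b.coord i (t.linearMapAt ℝ x v)) • t.localFrame b i x := by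
        apply (t.linearEquivAt ℝ x hx).injective
        rw [map_sum]
        simp only [map_smul, t.localFrame_apply_of_mem_baseSet b hx]
        have h1 : t.linearEquivAt ℝ x hx v = t.linearMapAt ℝ x v := by
          simp [t.linearMapAt_def_of_mem hx]
        simp only [Bundle.Trivialization.basisAt, Module.Basis.map_apply,
          LinearEquiv.apply_symm_apply]
        rw [h1]
        exact (b.sum_repr _).symm
      change (χ x * χ x) • v = ∑ i, (χ x * b.coord i (t.linearMapAt ℝ x v)) •
        (χ x • t.localFrame b i x)
      conv_lhs => rw [key]
      rw [Finset.smul_sum]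
      refine Finset.sum_congr rfl fun i _ => ?_
      simp only [smul_smul]
      congr 1
      ring
    · have : χ x = 0 := image_eq_zero_of_notMem_tsupport fun h => hx (hχ h)
      change (χ x * χ x) • v = ∑ i, (χ x * b.coord i (t.linearMapAt ℝ x v)) •
        (χ x • t.localFrame b i x)
      simp [this]
  · filter_upwards [χ.eventuallyEq_one] with x hx
    change χ x * χ x = 1
    rw [hx]; simp

variable {I F E}

theorem exists_section_eq (x : M) (v : E x) : ∃ s : Cₛ^∞⟮I; F, E⟯, s x = v := by
  obtain ⟨n, ψ, e, c, hc, hψ, h1⟩ := exists_local_frame I F E x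
  have hx : ψ x = 1 := h1.self_of_nhds
  refine ⟨∑ i, c i x v • e i, ?_⟩
  have h3 : (∑ i, c i x v • e i) x = ∑ i, (c i x v • e i) x :=
    (congrFun (map_sum (ContMDiffSection.coeAddHom I F ∞ E) (fun i => c i x v • e i)
      Finset.univ) x).trans (Finset.sum_apply _ _ _)
  rw [h3]
  have := hψ x v
  rw [hx, one_smul] at this
  exact this.symm

/-- A `C^∞(M)`-linear operator on `Γ(E)` is given by a linear endomorphism of each fibre. -/
theorem exists_fiberMap (φ : Module.End C^∞⟮I, M; ℝ⟯ Cₛ^∞⟮I; F, E⟯) (x : M) :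
    ∃! T : Module.End ℝ (E x), ∀ s : Cₛ^∞⟮I; F, E⟯, T (s x) = (φ s) x := by
  obtain ⟨n, ψ, e, c, hc, hψ, h1⟩ := exists_local_frame I F E x
  have hx : ψ x = 1 := h1.self_of_nhds
  refine ⟨∑ i, (c i x).smulRight (φ (e i) x), fun s => ?_, fun T hT => ?_⟩
  · let a : Fin n → C^∞⟮I, M; ℝ⟯ := fun i => ⟨fun y => c i y (s y), (hc i).comp s.contMDiff⟩
    have h : ψ • s = ∑ i, a i • e i := by
      ext y
      have : (∑ i, a i • e i) y = ∑ i, (a i • e i) y := by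
        exact (congrFun (map_sum (ContMDiffSection.coeAddHom I F ∞ E) (fun i => a i • e i)
          Finset.univ) y).trans (Finset.sum_apply _ _ _)
      rw [this]
      exact hψ y (s y)
    have h2 := congrArg (fun u => (φ u) x) h
    simp only [map_smul, map_sum] at h2
    have h3 : (∑ i, a i • φ (e i)) x = ∑ i, (a i • φ (e i)) x :=
      (congrFun (map_sum (ContMDiffSection.coeAddHom I F ∞ E) (fun i => a i • φ (e i))
          Finset.univ) x).trans (Finset.sum_apply _ _ _)
    rw [h3, section_smul_apply, hx, one_smul] at h2
    rw [h2, LinearMap.sum_apply]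
    exact Finset.sum_congr rfl fun i _ => rfl
  · ext v
    have hv := hψ x v
    rw [hx, one_smul] at hv
    conv_lhs => rw [hv]
    simp [map_sum, hT]

/-- The endomorphism of the fibre `E x` given by a `C^∞(M)`-linear operator on `Γ(E)`, i.e. by a
section of `End E`. -/
def fiberMap (φ : Module.End C^∞⟮I, M; ℝ⟯ Cₛ^∞⟮I; F, E⟯) (x : M) : Module.End ℝ (E x) :=
  (exists_fiberMap φ x).choose

theorem fiberMap_apply (φ : Module.End C^∞⟮I, M; ℝ⟯ Cₛ^∞⟮I; F, E⟯) (x : M)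
    (s : Cₛ^∞⟮I; F, E⟯) : fiberMap φ x (s x) = (φ s) x :=
  (exists_fiberMap φ x).choose_spec.1 s

theorem fiberMap_unique {φ : Module.End C^∞⟮I, M; ℝ⟯ Cₛ^∞⟮I; F, E⟯} {x : M}
    {T : Module.End ℝ (E x)} (hT : ∀ s : Cₛ^∞⟮I; F, E⟯, T (s x) = (φ s) x) :
    fiberMap φ x = T :=
  ((exists_fiberMap φ x).choose_spec.2 T hT).symm

theorem contMDiff_fiberTrace (φ : Module.End C^∞⟮I, M; ℝ⟯ Cₛ^∞⟮I; F, E⟯) :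
    ContMDiff I 𝓘(ℝ, ℝ) ∞ (fun x => LinearMap.trace ℝ (E x) (fiberMap φ x)) := by
  intro x₀
  obtain ⟨n, ψ, e, c, hc, hψ, h1⟩ := exists_local_frame I F E x₀
  have hs : ContMDiff I 𝓘(ℝ, ℝ) ∞ (fun x => ∑ i, c i x (φ (e i) x)) :=
    contMDiff_finsetSum fun i _ => (hc i).comp (φ (e i)).contMDiff
  refine (hs x₀).congr_of_eventuallyEq ?_
  filter_upwards [h1] with x hx
  have hfd : FiniteDimensional ℝ (E x) := VectorBundle.finiteDimensional ℝ F E x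
  have : fiberMap φ x = ∑ i, (c i x).smulRight (φ (e i) x) := by
    ext v
    have hv := hψ x v
    rw [hx, one_smul] at hv
    conv_lhs => rw [hv]
    simp [map_sum, fiberMap_apply]
  rw [this, map_sum]
  simp

/-- The fibrewise trace `Γ(End E) → C^∞(M)`. -/
def fiberTrace : Module.End C^∞⟮I, M; ℝ⟯ Cₛ^∞⟮I; F, E⟯ →ₗ[ℝ] C^∞⟮I, M; ℝ⟯ where
  toFun φ := ⟨fun x => LinearMap.trace ℝ (E x) (fiberMap φ x), contMDiff_fiberTrace φ⟩
  map_add' φ θ := by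
    ext x
    have : fiberMap (φ + θ) x = fiberMap φ x + fiberMap θ x :=
      fiberMap_unique fun s => by simp [fiberMap_apply]
    change LinearMap.trace ℝ (E x) (fiberMap (φ + θ) x) = _
    rw [this, map_add]
    rfl
  map_smul' c φ := by
    ext x
    have : fiberMap (c • φ) x = c • fiberMap φ x :=
      fiberMap_unique fun s => by simp [fiberMap_apply]
    change LinearMap.trace ℝ (E x) (fiberMap (c • φ) x) = _
    rw [this, map_smul]
    rfl

end LocalFrames

section Algebroids

variable {V : Type*} [NormedAddCommGroup V] [NormedSpace ℝ V] {H : Type*} [TopologicalSpace H]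
  (I : ModelWithCorners ℝ V H) {M : Type*} [TopologicalSpace M] [ChartedSpace H M]
  [IsManifold I ∞ M]
  (F : Type*) [NormedAddCommGroup F] [NormedSpace ℝ F] (A : M → Type*)
  [TopologicalSpace (TotalSpace F A)] [∀ x, AddCommGroup (A x)] [∀ x, Module ℝ (A x)]
  [∀ x, TopologicalSpace (A x)] [FiberBundle F A] [VectorBundle ℝ F A]

/-- A smooth vector bundle morphism `A → TM` over the identity of `M`. -/
structure AnchorMap where
  toFun : ∀ x, A x →ₗ[ℝ] TangentSpace I x
  contMDiff_toFun : ContMDiff (I.prod 𝓘(ℝ, F)) I.tangent ∞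
    (fun v : TotalSpace F A => (⟨v.1, toFun v.1 v.2⟩ : TangentBundle I M))

variable {I F A} in
/-- The map `a ↦ ρ ∘ a` from sections of `A` to vector fields. -/
def AnchorMap.onSections (ρ : AnchorMap I F A) : Cₛ^∞⟮I; F, A⟯ →ₗ[ℝ] VectorFields I M where
  toFun a := ⟨fun x => ρ.toFun x (a x), ρ.contMDiff_toFun.comp a.contMDiff⟩
  map_add' a b := by ext x; exact map_add (ρ.toFun x) (a x) (b x)
  map_smul' c a := by ext x; exact map_smul (ρ.toFun x) c (a x)

/-- A Lie algebroid structure on the vector bundle `A` over `M`: an anchor `A → TM` and a real Lie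
bracket on `Γ(A)` with `[a, f b] = f [a, b] + (ρ ∘ a)(f) b`. -/
class LieAlgebroid where
  anchor : AnchorMap I F A
  bracket : Cₛ^∞⟮I; F, A⟯ →ₗ[ℝ] Cₛ^∞⟮I; F, A⟯ →ₗ[ℝ] Cₛ^∞⟮I; F, A⟯
  bracket_self : ∀ a, bracket a a = 0
  jacobi : ∀ a b c, bracket a (bracket b c) = bracket (bracket a b) c + bracket b (bracket a c)
  leibniz : ∀ (a b : Cₛ^∞⟮I; F, A⟯) (f : C^∞⟮I, M; ℝ⟯),
    bracket a (f • b) = f • bracket a b + vectorFieldDerivation (anchor.onSections a) f • b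

variable {I F A} [LieAlgebroid I F A]

instance : LieRing Cₛ^∞⟮I; F, A⟯ where
  bracket a b := LieAlgebroid.bracket a b
  add_lie a b c := by
    change LieAlgebroid.bracket (a + b) c = _
    rw [map_add]
    rfl
  lie_add a b c := by
    change LieAlgebroid.bracket a (b + c) = _
    exact map_add _ _ _
  lie_self a := LieAlgebroid.bracket_self a
  leibniz_lie a b c := LieAlgebroid.jacobi a b c

instance : LieAlgebra ℝ Cₛ^∞⟮I; F, A⟯ where
  lie_smul c a b := by
    change LieAlgebroid.bracket a (c • b) = _
    exact map_smul _ _ _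

variable (I F A) in
/-- The map `a ↦ (f ↦ (ρ ∘ a)(f))`. -/
def anchorDerivation : Cₛ^∞⟮I; F, A⟯ →ₗ[ℝ] Derivation ℝ C^∞⟮I, M; ℝ⟯ C^∞⟮I, M; ℝ⟯ :=
  vectorFieldDerivationₗ ∘ₗ (LieAlgebroid.anchor (I := I) (F := F) (A := A)).onSections

theorem lie_smul_section (a b : Cₛ^∞⟮I; F, A⟯) (f : C^∞⟮I, M; ℝ⟯) :
    ⁅a, f • b⁆ = f • ⁅a, b⁆ + anchorDerivation I F A a f • b :=
  LieAlgebroid.leibniz a b f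

variable [FiniteDimensional ℝ V] [T2Space M] [FiniteDimensional ℝ F] [ContMDiffVectorBundle ∞ F A I]

theorem anchorDerivation_lie (a b : Cₛ^∞⟮I; F, A⟯) :
    anchorDerivation I F A ⁅a, b⁆ = ⁅anchorDerivation I F A a, anchorDerivation I F A b⁆ := by
  set r := anchorDerivation I F A
  have key : ∀ (f : C^∞⟮I, M; ℝ⟯) (c : Cₛ^∞⟮I; F, A⟯), (r ⁅a, b⁆ f - ⁅r a, r b⁆ f) • c = 0 := by
    intro f c
    have h := lie_lie a b (f • c)
    rw [lie_smul_section, lie_smul_section, lie_smul_section, lie_add, lie_add, lie_smul_section,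
      lie_smul_section, lie_smul_section, lie_smul_section, lie_lie, smul_sub] at h
    rw [Derivation.commutator_apply, sub_smul, sub_smul]
    have h' : r ⁅a, b⁆ f • c = (r a) ((r b) f) • c - (r b) ((r a) f) • c := by
      have := sub_eq_zero.2 h
      rw [← sub_eq_zero, ← this]
      abel
    rw [h', sub_self]
  ext f x
  by_cases hx : ∃ c : Cₛ^∞⟮I; F, A⟯, c x ≠ 0
  · obtain ⟨c, hc⟩ := hx
    have h := congrArg (fun s : Cₛ^∞⟮I; F, A⟯ => s x) (key f c)
    have h2 : ((r ⁅a, b⁆ f) x - (⁅r a, r b⁆ f) x) • c x = 0 := h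
    exact sub_eq_zero.1 ((smul_eq_zero.1 h2).resolve_right hc)
  · push Not at hx
    have hF : Subsingleton F := by
      have : Subsingleton (A x) := ⟨fun v w => by
        obtain ⟨s, rfl⟩ := exists_section_eq (I := I) (F := F) x v
        obtain ⟨t, rfl⟩ := exists_section_eq (I := I) (F := F) x w
        rw [hx, hx]⟩
      exact (VectorBundle.continuousLinearEquivAt ℝ F A x).symm.injective.subsingleton
    have hs : ∀ s : Cₛ^∞⟮I; F, A⟯, s = 0 := fun s => by
      ext y
      exact (VectorBundle.continuousLinearEquivAt ℝ F A y).injective (Subsingleton.elim _ _)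
    rw [hs ⁅a, b⁆, hs a, map_zero, zero_lie (r b)]

variable (I F A) in
/-- The homomorphism of Lie algebras `Γ(A) → 𝔛(M)`, `a ↦ ρ ∘ a`, with vector fields acting as
derivations of `C^∞(M)`. -/
def anchorHom : Cₛ^∞⟮I; F, A⟯ →ₗ⁅ℝ⁆ Derivation ℝ C^∞⟮I, M; ℝ⟯ C^∞⟮I, M; ℝ⟯ where
  toLinearMap := anchorDerivation I F A
  map_lie' := anchorDerivation_lie _ _

end Algebroids

section Connections

variable {C L : Type*} [CommRing C] [Algebra ℝ C] [LieRing L] [LieAlgebra ℝ L]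
  (ρ : L →ₗ⁅ℝ⁆ Derivation ℝ C C)

/-- The formula for the differential `d` on `ℝ`-multilinear alternating forms on `L` with values in
`C`, for a Lie algebra `L` acting on `C` by derivations through `ρ`. With indices starting at `0`,
it is `∑ i, (-1)^i ρ(a i)(η(.., î, ..)) + ∑ i < j, (-1)^(i+j) η([a i, a j], .., î, .., ĵ, ..)`;
the pairs `i < j` are written as `(i.castSucc, j.succ)` with `i ≤ j`. -/
def differentialFun : {n : ℕ} → (L [⋀^Fin n]→ₗ[ℝ] C) → (Fin (n + 1) → L) → C
  | 0, η, a => ρ (a 0) (η ![])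
  | n + 1, η, a =>
    (∑ i : Fin (n + 2), (-1 : ℤ) ^ (i : ℕ) • ρ (a i) (η (i.removeNth a))) +
    ∑ i : Fin (n + 1), ∑ j ≥ i, (-1 : ℤ) ^ ((i.castSucc : ℕ) + (j.succ : ℕ)) •
      η (Matrix.vecCons ⁅a i.castSucc, a j.succ⁆ (j.removeNth (i.castSucc.removeNth a)))

theorem differentialFun_eq {n : ℕ} (η : L [⋀^Fin n]→ₗ[ℝ] C) :
    ∃ θ : L [⋀^Fin (n + 1)]→ₗ[ℝ] C, ∀ a, differentialFun ρ η a = θ a := by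
  have key : ∀ {n : ℕ} (η : L [⋀^Fin n]→ₗ[ℝ] C), ∃ D : L →ₗ[ℝ] L [⋀^Fin n]→ₗ[ℝ] C,
      ∀ a v, D a v = ρ a (η v) := fun η =>
    ⟨{ toFun := fun a => ((ρ a : Derivation ℝ C C) : C →ₗ[ℝ] C).compAlternatingMap η
       map_add' := fun a b => by ext v; simp
       map_smul' := fun c a => by ext v; simp }, fun _ _ => rfl⟩
  obtain ⟨D, hD⟩ := key η
  cases n with
  | zero =>
    refine ⟨AlternatingMap.alternatizeUncurryFin D, ?_⟩
    intro a
    simp only [differentialFun, AlternatingMap.alternatizeUncurryFin_apply, hD]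
    simp [Subsingleton.elim (![] : Fin 0 → L) (Fin.tail a)]
  | succ n =>
    let B : L →ₗ[ℝ] L →ₗ[ℝ] L [⋀^Fin n]→ₗ[ℝ] C :=
      LinearMap.mk₂ ℝ (fun a b => η.curryLeft ⁅a, b⁆) (by simp) (by simp) (by simp) (by simp)
    have hB : ∀ a b v, B a b v = η (Matrix.vecCons ⁅a, b⁆ v) := fun _ _ _ => rfl
    refine ⟨AlternatingMap.alternatizeUncurryFin D - (1 / 2 : ℝ) •
      AlternatingMap.alternatizeUncurryFin (AlternatingMap.alternatizeUncurryFinLM ∘ₗ B), ?_⟩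
    intro a
    rw [AlternatingMap.sub_apply, AlternatingMap.smul_apply,
      AlternatingMap.alternatizeUncurryFin_alternatizeUncurryFinLM_comp_apply,
      AlternatingMap.alternatizeUncurryFin_apply]
    simp only [differentialFun, hD, sub_eq_add_neg, Finset.smul_sum, ← Finset.sum_neg_distrib]
    refine congrArg₂ _ rfl (Finset.sum_congr rfl fun i _ => Finset.sum_congr rfl fun j _ => ?_)
    have h : B (a j.succ) (a i.castSucc) (j.removeNth (i.castSucc.removeNth a)) =
        -B (a i.castSucc) (a j.succ) (j.removeNth (i.castSucc.removeNth a)) := by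
      change η.curryLeft ⁅a j.succ, a i.castSucc⁆ _ = -η.curryLeft ⁅a i.castSucc, a j.succ⁆ _
      rw [← lie_skew, map_neg, AlternatingMap.neg_apply]
    rw [h, neg_neg, ← hB, ← two_smul ℝ, smul_comm (1 / 2 : ℝ), smul_smul]
    norm_num [pow_succ, ← add_assoc]

/-- The differential `d` on `ℝ`-multilinear alternating forms on `L` with values in `C`. -/
def differential {n : ℕ} (η : L [⋀^Fin n]→ₗ[ℝ] C) : L [⋀^Fin (n + 1)]→ₗ[ℝ] C where
  toFun := differentialFun ρ η
  map_update_add' v i a b := by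
    obtain ⟨θ, h⟩ := differentialFun_eq ρ η
    simp only [h]
    convert θ.map_update_add v i a b
  map_update_smul' v i c a := by
    obtain ⟨θ, h⟩ := differentialFun_eq ρ η
    simp only [h]
    convert θ.map_update_smul v i c a
  map_eq_zero_of_eq' v i j hv hij := by
    obtain ⟨θ, h⟩ := differentialFun_eq ρ η
    rw [h]
    exact θ.map_eq_zero_of_eq v hv hij

variable {G : Type*} [AddCommGroup G] [Module ℝ G] [Module C G]

/-- `ℓ` is a derivative operator on the `C`-module `G` with symbol `X`:
`ℓ(f s) = f ℓ(s) + X(f) s`. For `C = C^∞(M)` and `G = Γ(E)` these are the covariant differential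
operators in `E`. -/
def IsCDO (ℓ : Module.End ℝ G) (X : Derivation ℝ C C) : Prop :=
  ∀ (f : C) (s : G), ℓ (f • s) = f • ℓ s + X f • s

variable (G) in
/-- An `ℝ`-linear connection of `L` on the `C`-module `G`: an `ℝ`-linear map `∇` from `L` to the
covariant differential operators on `G` such that `∇ a` has symbol `ρ a`. No linearity over `C` and
no locality in `a` is required. -/
structure RConnection where
  toFun : L →ₗ[ℝ] Module.End ℝ G
  isCDO : ∀ a, IsCDO (toFun a) (ρ a)

variable {ρ}

/-- The curvature `R a b = [∇ a, ∇ b] - ∇ [a, b]`, a `C`-linear operator on `G`. -/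
def RConnection.curvature (D : RConnection ρ G) (a b : L) : Module.End C G where
  toFun s := D.toFun a (D.toFun b s) - D.toFun b (D.toFun a s) - D.toFun ⁅a, b⁆ s
  map_add' s t := by simp only [map_add]; abel
  map_smul' f s := by
    simp only [D.isCDO _ _ _, map_add, LieHom.map_lie, Derivation.commutator_apply, sub_smul,
      smul_sub, RingHom.id_apply]
    abel

variable [SMulCommClass C ℝ G] [SMulCommClass ℝ C G] [IsScalarTower ℝ C G]

theorem RConnection.curvature_add_left (D : RConnection ρ G) (a a' b : L) :
    D.curvature (a + a') b = D.curvature a b + D.curvature a' b := by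
  ext s
  simp only [curvature, LinearMap.coe_mk, AddHom.coe_mk, LinearMap.add_apply, map_add, add_lie]
  abel

theorem RConnection.curvature_add_right (D : RConnection ρ G) (a b b' : L) :
    D.curvature a (b + b') = D.curvature a b + D.curvature a b' := by
  ext s
  simp only [curvature, LinearMap.coe_mk, AddHom.coe_mk, LinearMap.add_apply, map_add, lie_add]
  abel

theorem RConnection.curvature_smul_left (D : RConnection ρ G) (c : ℝ) (a b : L) :
    D.curvature (c • a) b = c • D.curvature a b := by
  ext s
  simp only [curvature, LinearMap.coe_mk, AddHom.coe_mk, LinearMap.smul_apply, map_smul, smul_lie,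
    smul_sub]

theorem RConnection.curvature_smul_right (D : RConnection ρ G) (c : ℝ) (a b : L) :
    D.curvature a (c • b) = c • D.curvature a b := by
  ext s
  simp only [curvature, LinearMap.coe_mk, AddHom.coe_mk, LinearMap.smul_apply, map_smul, lie_smul,
    smul_sub]

theorem RConnection.curvature_update (D : RConnection ρ G) (p : ℕ) (m : Fin (2 * p))
    (a : Fin (2 * p) → L) :
    ∃ (j : Fin p) (K : L →ₗ[ℝ] Module.End C G), ∀ x,
      (fun i : Fin p => D.curvature (Function.update a m x ⟨2 * i, by omega⟩)
        (Function.update a m x ⟨2 * i + 1, by omega⟩)) =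
      Function.update (fun i : Fin p => D.curvature (a ⟨2 * i, by omega⟩)
        (a ⟨2 * i + 1, by omega⟩)) j (K x) := by
  have hj : (m : ℕ) / 2 < p := by omega
  have hne : ∀ i : Fin p, i ≠ ⟨(m : ℕ) / 2, hj⟩ → (i : ℕ) ≠ (m : ℕ) / 2 := fun i h h' =>
    h (Fin.ext h')
  rcases Nat.even_or_odd' (m : ℕ) with ⟨c, hc | hc⟩
  · refine ⟨⟨(m : ℕ) / 2, hj⟩,
      { toFun := fun x => D.curvature x (a ⟨2 * ((m : ℕ) / 2) + 1, by omega⟩)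
        map_add' := fun _ _ => D.curvature_add_left _ _ _
        map_smul' := fun _ _ => D.curvature_smul_left _ _ _ }, fun x => ?_⟩
    ext1 i
    by_cases hi : i = ⟨(m : ℕ) / 2, hj⟩
    · subst hi
      have h1 : (⟨2 * ((m : ℕ) / 2), by omega⟩ : Fin (2 * p)) = m := Fin.ext (by simp; omega)
      have h2 : (⟨2 * ((m : ℕ) / 2) + 1, by omega⟩ : Fin (2 * p)) ≠ m := fun h => by
        have := congrArg Fin.val h
        simp at this
        omega
      simp only [Function.update_self, LinearMap.coe_mk, AddHom.coe_mk]
      rw [Function.update_of_ne h2, h1, Function.update_self]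
    · have := hne i hi
      rw [Function.update_of_ne hi, Function.update_of_ne, Function.update_of_ne]
      all_goals
        intro h
        have := congrArg Fin.val h
        simp at this
        omega
  · refine ⟨⟨(m : ℕ) / 2, hj⟩,
      { toFun := fun x => D.curvature (a ⟨2 * ((m : ℕ) / 2), by omega⟩) x
        map_add' := fun _ _ => D.curvature_add_right _ _ _
        map_smul' := fun _ _ => D.curvature_smul_right _ _ _ }, fun x => ?_⟩
    ext1 i
    by_cases hi : i = ⟨(m : ℕ) / 2, hj⟩
    · subst hi
      have h1 : (⟨2 * ((m : ℕ) / 2) + 1, by omega⟩ : Fin (2 * p)) = m := Fin.ext (by simp; omega)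
      have h2 : (⟨2 * ((m : ℕ) / 2), by omega⟩ : Fin (2 * p)) ≠ m := fun h => by
        have := congrArg Fin.val h
        simp at this
        omega
      simp only [Function.update_self, LinearMap.coe_mk, AddHom.coe_mk]
      rw [Function.update_of_ne h2, h1, Function.update_self]
    · have := hne i hi
      rw [Function.update_of_ne hi, Function.update_of_ne, Function.update_of_ne]
      all_goals
        intro h
        have := congrArg Fin.val h
        simp at this
        omega

/-- The map `(a_1, ..., a_2p) ↦ R(a_1, a_2) ∘ ... ∘ R(a_{2p-1}, a_2p)`. -/
def RConnection.curvatureProd (D : RConnection ρ G) (p : ℕ) :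
    MultilinearMap ℝ (fun _ : Fin (2 * p) => L) (Module.End C G) where
  toFun a := (List.ofFn fun i : Fin p =>
    D.curvature (a ⟨2 * i, by omega⟩) (a ⟨2 * i + 1, by omega⟩)).prod
  map_update_add' {inst} a m x y := by
    obtain rfl : inst = instDecidableEqFin _ := Subsingleton.elim _ _
    obtain ⟨j, K, h⟩ := D.curvature_update p m a
    simp only [← MultilinearMap.mkPiAlgebraFin_apply (R := ℝ), h, map_add,
      MultilinearMap.map_update_add]
  map_update_smul' {inst} a m c x := by
    obtain rfl : inst = instDecidableEqFin _ := Subsingleton.elim _ _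
    obtain ⟨j, K, h⟩ := D.curvature_update p m a
    simp only [← MultilinearMap.mkPiAlgebraFin_apply (R := ℝ), h, map_smul,
      MultilinearMap.map_update_smul]

/-- The power `R^p`, an alternating `2p`-form on `L` with values in the `C`-linear operators:
`R^p(a_1, ..., a_2p) = 2^(-p) ∑ τ, sgn τ • R(a_τ1, a_τ2) ∘ ... ∘ R(a_τ(2p-1), a_τ(2p))`. -/
def RConnection.curvaturePow (D : RConnection ρ G) (p : ℕ) :
    L [⋀^Fin (2 * p)]→ₗ[ℝ] Module.End C G :=
  (1 / 2 ^ p : ℝ) • MultilinearMap.alternatization (D.curvatureProd p)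

/-- The Chern character form `Tr(R^p)` with respect to a trace `Tr` on the `C`-linear operators. -/
def RConnection.chernForm (Tr : Module.End C G →ₗ[ℝ] C) (D : RConnection ρ G) (p : ℕ) :
    L [⋀^Fin (2 * p)]→ₗ[ℝ] C :=
  Tr.compAlternatingMap (D.curvaturePow p)

end Connections

section Cylinder

variable (k : ℕ) {V : Type*} [NormedAddCommGroup V] [NormedSpace ℝ V]
  {M : Type*} [TopologicalSpace M] [ChartedSpace V M]

variable (V M) in
/-- The projection `ℝ^k × M → M`. -/
abbrev pr₂ : C^∞⟮𝓘(ℝ, Fin k → ℝ).prod 𝓘(ℝ, V), (Fin k → ℝ) × M; 𝓘(ℝ, V), M⟯ :=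
  ContMDiffMap.snd

variable {k}

/-- The value at time `t` of a smooth function on `ℝ^k × M`. -/
def slice (f : C^∞⟮𝓘(ℝ, Fin k → ℝ).prod 𝓘(ℝ, V), (Fin k → ℝ) × M; ℝ⟯) (t : Fin k → ℝ) :
    C^∞⟮𝓘(ℝ, V), M; ℝ⟯ :=
  ⟨fun x => f (t, x), f.contMDiff.comp (contMDiff_const.prodMk contMDiff_id)⟩

/-- The pullback of a smooth function on `M` to `ℝ^k × M`. -/
def pullFun (f : C^∞⟮𝓘(ℝ, V), M; ℝ⟯) :
    C^∞⟮𝓘(ℝ, Fin k → ℝ).prod 𝓘(ℝ, V), (Fin k → ℝ) × M; ℝ⟯ :=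
  ⟨fun p => f p.2, f.contMDiff.comp contMDiff_snd⟩

variable [IsManifold 𝓘(ℝ, V) ∞ M]

/-- The vector field `(t, x) ↦ (u, X x)` on `ℝ^k × M`. -/
def prodVectorField (u : Fin k → ℝ) (X : VectorFields 𝓘(ℝ, V) M) :
    VectorFields (𝓘(ℝ, Fin k → ℝ).prod 𝓘(ℝ, V)) ((Fin k → ℝ) × M) :=
  ⟨fun p => (u, X p.2), by
    have h1 : ContMDiff (𝓘(ℝ, Fin k → ℝ).prod 𝓘(ℝ, V)) 𝓘(ℝ, Fin k → ℝ).tangent ∞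
        (fun p : (Fin k → ℝ) × M => (⟨p.1, u⟩ : TangentBundle 𝓘(ℝ, Fin k → ℝ) (Fin k → ℝ))) := by
      intro p
      rw [contMDiffAt_totalSpace]
      refine ⟨contMDiffAt_fst, ?_⟩
      simpa using! contMDiffAt_const
    have h2 := X.contMDiff.comp
      (contMDiff_snd (I := 𝓘(ℝ, Fin k → ℝ)) (J := 𝓘(ℝ, V)) (M := Fin k → ℝ) (N := M) (n := ∞))
    exact (contMDiff_equivTangentBundleProd_symm (n := ∞) (I := 𝓘(ℝ, Fin k → ℝ))
      (I' := 𝓘(ℝ, V)) (M := Fin k → ℝ) (M' := M)).comp (h1.prodMk h2)⟩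

theorem prodVectorField_apply (u : Fin k → ℝ) (X : VectorFields 𝓘(ℝ, V) M)
    (f : C^∞⟮𝓘(ℝ, Fin k → ℝ).prod 𝓘(ℝ, V), (Fin k → ℝ) × M; ℝ⟯) (t : Fin k → ℝ) (x : M) :
    vectorFieldDerivation (prodVectorField u X) f (t, x) =
      fderiv ℝ (fun τ => f (τ, x)) t u + vectorFieldDerivation X (slice f t) x := by
  rw [vectorFieldDerivation_apply, vectorFieldDerivation_apply]
  rw [← mfderiv_eq_fderiv]
  exact mfderiv_prod_eq_add_apply (f.mdifferentiableAt)

theorem mfderiv_eq_fderiv_chart {f : M → ℝ} {x : M} (hf : MDifferentiableAt 𝓘(ℝ, V) 𝓘(ℝ, ℝ) f x)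
    (v : V) : mfderiv 𝓘(ℝ, V) 𝓘(ℝ, ℝ) f x v =
      fderiv ℝ (fun y => f ((extChartAt 𝓘(ℝ, V) x).symm y)) (extChartAt 𝓘(ℝ, V) x x) v := by
  have h := hf.mfderiv
  simp only [writtenInExtChartAt, extChartAt_model_space_eq_id, PartialEquiv.refl_coe,
    Function.id_comp, modelWithCornersSelf_coe, Set.range_id, fderivWithin_univ] at h
  exact congrArg (fun T : V →L[ℝ] ℝ => T v) h

theorem contDiffAt_chart (f : C^∞⟮𝓘(ℝ, Fin k → ℝ).prod 𝓘(ℝ, V), (Fin k → ℝ) × M; ℝ⟯)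
    (t : Fin k → ℝ) (x : M) {y : V} (hy : y ∈ (extChartAt 𝓘(ℝ, V) x).target) :
    ContDiffAt ℝ ∞ (fun q : (Fin k → ℝ) × V => f (q.1, (extChartAt 𝓘(ℝ, V) x).symm q.2))
      (t, y) := by
  have h0 : ContMDiffAt 𝓘(ℝ, V) 𝓘(ℝ, V) ∞ (extChartAt 𝓘(ℝ, V) x).symm y :=
    (contMDiffOn_extChartAt_symm x).contMDiffAt ((isOpen_extChartAt_target x).mem_nhds hy)
  have h : ContMDiffAt (𝓘(ℝ, Fin k → ℝ).prod 𝓘(ℝ, V)) 𝓘(ℝ, ℝ) ∞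
      (fun q : (Fin k → ℝ) × V => f (q.1, (extChartAt 𝓘(ℝ, V) x).symm q.2)) (t, y) :=
    f.contMDiff.contMDiffAt.comp (t, y) (contMDiffAt_fst.prodMk (h0.comp (t, y) contMDiffAt_snd))
  generalize (fun q : (Fin k → ℝ) × V => f (q.1, (extChartAt 𝓘(ℝ, V) x).symm q.2)) = g at h ⊢
  rw [← modelWithCornersSelf_prod, chartedSpaceSelf_prod] at h
  exact contMDiffAt_iff_contDiffAt.1 h

theorem two_le_infty : (2 : WithTop ℕ∞) ≤ ∞ := WithTop.coe_le_coe.2 (le_top : (2 : ℕ∞) ≤ ⊤)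

theorem fderiv_time_comm (f : C^∞⟮𝓘(ℝ, Fin k → ℝ).prod 𝓘(ℝ, V), (Fin k → ℝ) × M; ℝ⟯)
    (u v : Fin k → ℝ) (t : Fin k → ℝ) (x : M) :
    fderiv ℝ (fun τ => fderiv ℝ (fun σ => f (σ, x)) τ v) t u =
      fderiv ℝ (fun τ => fderiv ℝ (fun σ => f (σ, x)) τ u) t v := by
  have hf : ContDiff ℝ ∞ (fun σ : Fin k → ℝ => f (σ, x)) := by
    rw [← contMDiff_iff_contDiff]
    exact f.contMDiff.comp (contMDiff_id.prodMk contMDiff_const)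
  have hs : IsSymmSndFDerivAt ℝ (fun σ : Fin k → ℝ => f (σ, x)) t :=
    hf.contDiffAt.isSymmSndFDerivAt (by simpa using two_le_infty)
  have hd : DifferentiableAt ℝ (fderiv ℝ (fun σ : Fin k → ℝ => f (σ, x))) t :=
    ((hf.fderiv_right (m := 1) (by rw [one_add_one_eq_two]; exact two_le_infty)).differentiable (by simp)) t
  have h1 : ∀ w, fderiv ℝ (fun τ => fderiv ℝ (fun σ => f (σ, x)) τ w) t =
      (fderiv ℝ (fderiv ℝ (fun σ : Fin k → ℝ => f (σ, x))) t).flip w := fun w => by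
    rw [fderiv_clm_apply hd (differentiableAt_const w)]
    simp
  rw [h1, h1]
  exact hs u v

theorem fderiv_time_vectorField_comm
    (f : C^∞⟮𝓘(ℝ, Fin k → ℝ).prod 𝓘(ℝ, V), (Fin k → ℝ) × M; ℝ⟯)
    (u : Fin k → ℝ) (X : VectorFields 𝓘(ℝ, V) M) (t : Fin k → ℝ) (x : M) :
    fderiv ℝ (fun τ => vectorFieldDerivation X (slice f τ) x) t u =
      vectorFieldDerivation X (slice (vectorFieldDerivation (prodVectorField u 0) f) t) x := by
  set φ := extChartAt 𝓘(ℝ, V) x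
  set w : V := X x
  set g : (Fin k → ℝ) × V → ℝ := fun q => f (q.1, φ.symm q.2)
  set y₀ := φ x
  have hg : ∀ τ, ∀ y ∈ φ.target, ContDiffAt ℝ ∞ g (τ, y) := fun τ y hy => contDiffAt_chart f τ x hy
  have hy₀ : y₀ ∈ φ.target := mem_extChartAt_target x
  have ht : φ.target ∈ 𝓝 y₀ := (isOpen_extChartAt_target x).mem_nhds hy₀
  have hgd : ∀ τ, ∀ y ∈ φ.target, HasFDerivAt g (fderiv ℝ g (τ, y)) (τ, y) := fun τ y hy =>
    ((hg τ y hy).differentiableAt (by simp)).hasFDerivAt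
  have hd : HasFDerivAt (fderiv ℝ g) (fderiv ℝ (fderiv ℝ g) (t, y₀)) (t, y₀) :=
    (((hg t y₀ hy₀).fderiv_right (m := 1) (by rw [one_add_one_eq_two]; exact two_le_infty)).differentiableAt (by simp)).hasFDerivAt
  have hs : IsSymmSndFDerivAt ℝ g (t, y₀) := (hg t y₀ hy₀).isSymmSndFDerivAt (by simpa using two_le_infty)
  have h1 : ∀ τ, vectorFieldDerivation X (slice f τ) x = fderiv ℝ g (τ, y₀) (0, w) := by
    intro τ
    refine (mfderiv_eq_fderiv_chart (V := V) (slice f τ).mdifferentiableAt w).trans ?_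
    have : HasFDerivAt (fun y => g (τ, y)) ((fderiv ℝ g (τ, y₀)).comp
        (ContinuousLinearMap.inr ℝ (Fin k → ℝ) V)) y₀ :=
      (hgd τ y₀ hy₀).comp y₀ (hasFDerivAt_prodMk_right τ y₀)
    exact congrArg (fun T : V →L[ℝ] ℝ => T w) this.fderiv
  have h2 : ∀ y ∈ φ.target, vectorFieldDerivation (prodVectorField u 0) f (t, φ.symm y) =
      fderiv ℝ g (t, y) (u, 0) := by
    intro y hy
    rw [prodVectorField_apply, vectorFieldDerivation_apply]
    have : HasFDerivAt (fun τ => g (τ, y)) ((fderiv ℝ g (t, y)).comp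
        (ContinuousLinearMap.inl ℝ (Fin k → ℝ) V)) t :=
      HasFDerivAt.comp (g := g) (f := fun e => (e, y)) t (hgd t y hy) (hasFDerivAt_prodMk_left t y)
    have h3 := congrArg (fun T : (Fin k → ℝ) →L[ℝ] ℝ => T u) this.fderiv
    refine (congrArg₂ (· + ·) h3 (map_zero _)).trans ?_
    simp
  have h3 : fderiv ℝ (fun τ => vectorFieldDerivation X (slice f τ) x) t u =
      fderiv ℝ (fderiv ℝ g) (t, y₀) (u, 0) (0, w) := by
    have h1' : (fun τ => vectorFieldDerivation X (slice f τ) x) =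
        fun τ => fderiv ℝ g (τ, y₀) (0, w) := funext h1
    rw [h1']
    have h : HasFDerivAt (fun τ => fderiv ℝ g (τ, y₀)) ((fderiv ℝ (fderiv ℝ g) (t, y₀)).comp
        (ContinuousLinearMap.inl ℝ (Fin k → ℝ) V)) t :=
      HasFDerivAt.comp t hd (hasFDerivAt_prodMk_left t y₀)
    rw [fderiv_clm_apply h.differentiableAt (differentiableAt_const _), h.fderiv]
    simp
  have h4 : vectorFieldDerivation X (slice (vectorFieldDerivation (prodVectorField u 0) f) t) x =
      fderiv ℝ (fderiv ℝ g) (t, y₀) (0, w) (u, 0) := by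
    refine (mfderiv_eq_fderiv_chart (V := V)
      (slice (vectorFieldDerivation (prodVectorField u 0) f) t).mdifferentiableAt w).trans ?_
    have h5 : (fun y => slice (vectorFieldDerivation (prodVectorField u 0) f) t (φ.symm y))
        =ᶠ[𝓝 y₀] fun y => fderiv ℝ g (t, y) (u, 0) := by
      filter_upwards [ht] with y hy using h2 y hy
    have h : HasFDerivAt (fun y => fderiv ℝ g (t, y)) ((fderiv ℝ (fderiv ℝ g) (t, y₀)).comp
        (ContinuousLinearMap.inr ℝ (Fin k → ℝ) V)) y₀ :=
      HasFDerivAt.comp y₀ hd (hasFDerivAt_prodMk_right t y₀)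
    have h6 := h5.fderiv_eq (𝕜 := ℝ)
    rw [fderiv_clm_apply h.differentiableAt (differentiableAt_const _), h.fderiv] at h6
    refine (congrArg (fun T : V →L[ℝ] ℝ => T w) h6).trans ?_
    simp
  rw [h3, h4]
  exact hs _ _

end Cylinder

section ProductAlgebra

variable (k : ℕ) {V : Type*} [NormedAddCommGroup V] [NormedSpace ℝ V] [FiniteDimensional ℝ V]
  {M : Type*} [TopologicalSpace M] [ChartedSpace V M] [IsManifold 𝓘(ℝ, V) ∞ M] [T2Space M]
  (F : Type*) [NormedAddCommGroup F] [NormedSpace ℝ F] [FiniteDimensional ℝ F] (A : M → Type*)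
  [TopologicalSpace (TotalSpace F A)] [∀ x, AddCommGroup (A x)] [∀ x, Module ℝ (A x)]
  [∀ x, TopologicalSpace (A x)] [FiberBundle F A] [VectorBundle ℝ F A]
  [ContMDiffVectorBundle ∞ F A 𝓘(ℝ, V)] [LieAlgebroid 𝓘(ℝ, V) F A]

/-- The constant vector fields on `ℝ^k` form a Lie algebra `ℝ^k` with trivial bracket. -/
instance constVectorFieldsLieRing : LieRing (Fin k → ℝ) where
  bracket _ _ := 0
  add_lie _ _ _ := (add_zero 0).symm
  lie_add _ _ _ := (add_zero 0).symm
  lie_self _ := rfl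
  leibniz_lie _ _ _ := (add_zero 0).symm

instance constVectorFieldsLieAlgebra : LieAlgebra ℝ (Fin k → ℝ) where
  lie_smul c _ _ := (smul_zero c).symm

/-- The anchor of the product Lie algebroid `Tℝ^k × A → ℝ^k × M` on the Lie algebra
`ℝ^k × Γ(A)` of the sections `(t, x) ↦ (u, a x)` with `u ∈ ℝ^k` and `a ∈ Γ(A)`. The bracket of two
of these sections is `[(u, a), (v, b)] = (0, [a, b])`. -/
def prodAnchorHom : (Fin k → ℝ) × Cₛ^∞⟮𝓘(ℝ, V); F, A⟯ →ₗ⁅ℝ⁆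
    Derivation ℝ C^∞⟮𝓘(ℝ, Fin k → ℝ).prod 𝓘(ℝ, V), (Fin k → ℝ) × M; ℝ⟯
      C^∞⟮𝓘(ℝ, Fin k → ℝ).prod 𝓘(ℝ, V), (Fin k → ℝ) × M; ℝ⟯ where
  toFun a := vectorFieldDerivation (prodVectorField a.1
    ((LieAlgebroid.anchor (I := 𝓘(ℝ, V)) (F := F) (A := A)).onSections a.2))
  map_add' a b := by
    ext f ⟨t, x⟩
    simp only [Derivation.add_apply, ContMDiffMap.coe_add, Pi.add_apply, prodVectorField_apply,
      Prod.fst_add, Prod.snd_add, map_add]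
    have : ∀ X Y : VectorFields 𝓘(ℝ, V) M, vectorFieldDerivation (X + Y) =
      vectorFieldDerivation X + vectorFieldDerivation Y := map_add vectorFieldDerivationₗ
    rw [this, Derivation.add_apply, ContMDiffMap.coe_add, Pi.add_apply]
    ring
  map_smul' c a := by
    ext f ⟨t, x⟩
    simp only [Derivation.smul_apply, ContMDiffMap.coe_smul, Pi.smul_apply, prodVectorField_apply,
      Prod.smul_fst, Prod.smul_snd, map_smul, RingHom.id_apply]
    have : ∀ X : VectorFields 𝓘(ℝ, V) M, vectorFieldDerivation (c • X) =
      c • vectorFieldDerivation X := map_smul vectorFieldDerivationₗ c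
    rw [this, Derivation.smul_apply, ContMDiffMap.coe_smul, Pi.smul_apply]
    simp [mul_add]
  map_lie' {a b} := by
    set r := anchorDerivation 𝓘(ℝ, V) F A
    set θ : Cₛ^∞⟮𝓘(ℝ, V); F, A⟯ →ₗ[ℝ] VectorFields 𝓘(ℝ, V) M :=
      (LieAlgebroid.anchor (I := 𝓘(ℝ, V)) (F := F) (A := A)).onSections
    have hr : ∀ c g, vectorFieldDerivation (θ c) g = r c g := fun _ _ => rfl
    have hsplit : ∀ (u : Fin k → ℝ) (X : VectorFields 𝓘(ℝ, V) M)
      (g : C^∞⟮𝓘(ℝ, Fin k → ℝ).prod 𝓘(ℝ, V), (Fin k → ℝ) × M; ℝ⟯) (t : Fin k → ℝ),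
      slice (vectorFieldDerivation (prodVectorField u X) g) t =
        slice (vectorFieldDerivation (prodVectorField u 0) g) t +
          vectorFieldDerivation X (slice g t) := by
      intro u X g t
      ext x
      change vectorFieldDerivation _ _ _ = vectorFieldDerivation _ _ _ + _
      rw [prodVectorField_apply, prodVectorField_apply]
      have : vectorFieldDerivation (0 : VectorFields 𝓘(ℝ, V) M) (slice g t) x = 0 :=
        map_zero (mfderiv 𝓘(ℝ, V) 𝓘(ℝ, ℝ) (slice g t) x)
      rw [this, add_zero]
    have hadd : ∀ (X : VectorFields 𝓘(ℝ, V) M) (g h : C^∞⟮𝓘(ℝ, V), M; ℝ⟯) (x : M),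
        vectorFieldDerivation X (g + h) x =
          vectorFieldDerivation X g x + vectorFieldDerivation X h x := fun X g h x => by
      rw [map_add]; rfl
    have hz : ∀ (u : Fin k → ℝ)
        (g : C^∞⟮𝓘(ℝ, Fin k → ℝ).prod 𝓘(ℝ, V), (Fin k → ℝ) × M; ℝ⟯) (t : Fin k → ℝ) (x : M),
        vectorFieldDerivation (prodVectorField u 0) g (t, x) =
          fderiv ℝ (fun τ => g (τ, x)) t u := fun u g t x => by
      rw [prodVectorField_apply]
      exact (congrArg _ (map_zero (mfderiv 𝓘(ℝ, V) 𝓘(ℝ, ℝ) (slice g t) x))).trans (add_zero _)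
    have key : ∀ (u v : Fin k → ℝ) (X Y : VectorFields 𝓘(ℝ, V) M)
        (g : C^∞⟮𝓘(ℝ, Fin k → ℝ).prod 𝓘(ℝ, V), (Fin k → ℝ) × M; ℝ⟯) (t : Fin k → ℝ) (x : M),
        vectorFieldDerivation (prodVectorField u X)
          (vectorFieldDerivation (prodVectorField v Y) g) (t, x) =
        fderiv ℝ (fun τ => fderiv ℝ (fun σ => g (σ, x)) τ v) t u +
        vectorFieldDerivation Y (slice (vectorFieldDerivation (prodVectorField u 0) g) t) x +
        vectorFieldDerivation X (slice (vectorFieldDerivation (prodVectorField v 0) g) t) x +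
        vectorFieldDerivation X (vectorFieldDerivation Y (slice g t)) x := by
      intro u v X Y g t x
      have hc : ∀ Z : VectorFields (𝓘(ℝ, Fin k → ℝ).prod 𝓘(ℝ, V)) ((Fin k → ℝ) × M),
          DifferentiableAt ℝ (fun τ => vectorFieldDerivation Z g (τ, x)) t := fun Z => by
        have : ContDiff ℝ ∞ (fun σ : Fin k → ℝ => vectorFieldDerivation Z g (σ, x)) := by
          rw [← contMDiff_iff_contDiff]
          exact (vectorFieldDerivation Z g).contMDiff.comp (contMDiff_id.prodMk contMDiff_const)
        exact this.differentiable (by simp) t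
      have h1 := hc (prodVectorField v 0)
      have h2 := hc (prodVectorField v Y)
      simp only [prodVectorField_apply v Y] at h2
      simp only [hz] at h1
      have h3 : DifferentiableAt ℝ (fun τ => vectorFieldDerivation Y (slice g τ) x) t := by
        exact (h2.sub h1).congr_of_eventuallyEq (.of_forall fun τ => (add_sub_cancel_left _ _).symm)
      rw [prodVectorField_apply, hsplit v Y, hadd, ← fderiv_time_vectorField_comm g u Y,
        ← fderiv_time_vectorField_comm g v X]
      simp only [prodVectorField_apply v Y]
      rw [fderiv_fun_add h1 h3]
      simp only [add_apply]
      ring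
    ext f ⟨t, x⟩
    have e := congrArg (fun D => D (slice f t) x) (anchorDerivation_lie (I := 𝓘(ℝ, V)) a.2 b.2)
    simp only [Derivation.commutator_apply] at e ⊢
    change vectorFieldDerivation (prodVectorField 0 (θ ⁅a.2, b.2⁆)) f (t, x) =
      vectorFieldDerivation _ _ (t, x) - vectorFieldDerivation _ _ (t, x)
    rw [key, key, prodVectorField_apply, hr, e, fderiv_time_comm f a.1 b.1]
    simp only [map_zero, zero_add]
    change r a.2 (r b.2 (slice f t)) x - r b.2 (r a.2 (slice f t)) x = _ + r a.2 (r b.2 _) x -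
      (_ + r b.2 (r a.2 _) x)
    ring

end ProductAlgebra

section PullbackSections

variable {k : ℕ} {V : Type*} [NormedAddCommGroup V] [NormedSpace ℝ V]
  {M : Type*} [TopologicalSpace M] [ChartedSpace V M] [IsManifold 𝓘(ℝ, V) ∞ M]
  {F : Type*} [NormedAddCommGroup F] [NormedSpace ℝ F] {E : M → Type*}
  [TopologicalSpace (TotalSpace F E)] [∀ x, AddCommGroup (E x)] [∀ x, Module ℝ (E x)]
  [∀ x, TopologicalSpace (E x)] [FiberBundle F E] [VectorBundle ℝ F E]

instance pullbackAddCommGroup {B B' : Type*} (f : B' → B) (E : B → Type*)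
    [i : ∀ x, AddCommGroup (E x)] (x : B') : AddCommGroup ((f *ᵖ E) x) :=
  inferInstanceAs <| AddCommGroup (E (f x))

variable (k V F E) in
/-- The sections of the pullback of `E` to `ℝ^k × M`. -/
abbrev PullbackSections : Type _ :=
  Cₛ^∞⟮𝓘(ℝ, Fin k → ℝ).prod 𝓘(ℝ, V); F, (pr₂ k V M : (Fin k → ℝ) × M → M) *ᵖ E⟯

theorem contMDiff_pullback_iff (S : ∀ p : (Fin k → ℝ) × M, E p.2) :
    ContMDiff (𝓘(ℝ, Fin k → ℝ).prod 𝓘(ℝ, V)) ((𝓘(ℝ, Fin k → ℝ).prod 𝓘(ℝ, V)).prod 𝓘(ℝ, F)) ∞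
      (fun p => (TotalSpace.mk p (S p) :
        TotalSpace F ((pr₂ k V M : (Fin k → ℝ) × M → M) *ᵖ E))) ↔
    ContMDiff (𝓘(ℝ, Fin k → ℝ).prod 𝓘(ℝ, V)) (𝓘(ℝ, V).prod 𝓘(ℝ, F)) ∞
      (fun p => (⟨p.2, S p⟩ : TotalSpace F E)) := by
  refine forall_congr' fun p => ?_
  rw [contMDiffAt_totalSpace, contMDiffAt_totalSpace]
  exact ⟨fun h => ⟨contMDiffAt_snd, h.2⟩, fun h => ⟨contMDiffAt_id, h.2⟩⟩

/-- The section `S_t` of `E` given by a section `S` of the pullback bundle and `t ∈ ℝ^k`. -/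
def sliceSection (S : PullbackSections k V F E) (t : Fin k → ℝ) : Cₛ^∞⟮𝓘(ℝ, V); F, E⟯ :=
  ⟨fun x => S (t, x),
    ((contMDiff_pullback_iff (E := E) S).1 S.contMDiff).comp (contMDiff_const.prodMk contMDiff_id)⟩

/-- The pullback of a section of `E`. -/
def pullSection (s : Cₛ^∞⟮𝓘(ℝ, V); F, E⟯) : PullbackSections k V F E :=
  ⟨fun p => s p.2, (contMDiff_pullback_iff (E := E) fun p => s p.2).2
    (s.contMDiff.comp contMDiff_snd)⟩

theorem sum_section_apply {V' H' M' : Type*} [NormedAddCommGroup V'] [NormedSpace ℝ V']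
    [TopologicalSpace H'] {I : ModelWithCorners ℝ V' H'} [TopologicalSpace M'] [ChartedSpace H' M']
    {E' : M' → Type*} [TopologicalSpace (TotalSpace F E')] [∀ x, AddCommGroup (E' x)]
    [∀ x, Module ℝ (E' x)] [∀ x, TopologicalSpace (E' x)] [FiberBundle F E'] [VectorBundle ℝ F E']
    {n : ℕ} (s : Fin n → Cₛ^∞⟮I; F, E'⟯) (x : M') : (∑ i, s i) x = ∑ i, s i x :=
  (congrFun (map_sum (ContMDiffSection.coeAddHom I F ∞ E') s Finset.univ) x).trans
    (Finset.sum_apply _ _ _)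

theorem contMDiff_of_local {W : ∀ p : (Fin k → ℝ) × M, E p.2}
    (h : ∀ x₀, ∃ T : PullbackSections k V F E, ∀ᶠ x in 𝓝 x₀, ∀ t, W (t, x) = T (t, x)) :
    ContMDiff (𝓘(ℝ, Fin k → ℝ).prod 𝓘(ℝ, V)) ((𝓘(ℝ, Fin k → ℝ).prod 𝓘(ℝ, V)).prod 𝓘(ℝ, F)) ∞
      (fun p => (TotalSpace.mk p (W p) :
        TotalSpace F ((pr₂ k V M : (Fin k → ℝ) × M → M) *ᵖ E))) := by
  rintro ⟨t₀, x₀⟩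
  obtain ⟨T, hT⟩ := h x₀
  refine (T.contMDiff (t₀, x₀)).congr_of_eventuallyEq ?_
  filter_upwards [(continuous_snd.tendsto (t₀, x₀)).eventually hT] with p hp
  exact congrArg (TotalSpace.mk p) (hp p.1)

variable [FiniteDimensional ℝ V] [T2Space M] [FiniteDimensional ℝ F]
  [ContMDiffVectorBundle ∞ F E 𝓘(ℝ, V)]

theorem exists_coefficients (S : PullbackSections k V F E) (x₀ : M) : ∃ (n : ℕ)
    (ψ : C^∞⟮𝓘(ℝ, V), M; ℝ⟯) (e : Fin n → Cₛ^∞⟮𝓘(ℝ, V); F, E⟯)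
    (c : Fin n → C^∞⟮𝓘(ℝ, Fin k → ℝ).prod 𝓘(ℝ, V), (Fin k → ℝ) × M; ℝ⟯),
    (∀ t, ψ • sliceSection S t = ∑ i, slice (c i) t • e i) ∧ (∀ᶠ x in 𝓝 x₀, ψ x = 1) := by
  obtain ⟨n, ψ, e, c, hc, hψ, h1⟩ := exists_local_frame 𝓘(ℝ, V) F E x₀
  refine ⟨n, ψ, e, fun i => ⟨fun p => c i p.2 (S p),
    (hc i).comp ((contMDiff_pullback_iff (E := E) S).1 S.contMDiff)⟩, fun t => ?_, h1⟩
  ext x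
  rw [sum_section_apply]
  exact hψ x _

theorem smooth_time (f : C^∞⟮𝓘(ℝ, Fin k → ℝ).prod 𝓘(ℝ, V), (Fin k → ℝ) × M; ℝ⟯) (x : M) :
    ContDiff ℝ ∞ (fun t : Fin k → ℝ => f (t, x)) := by
  rw [← contMDiff_iff_contDiff]
  exact f.contMDiff.comp (contMDiff_id.prodMk contMDiff_const)

theorem prodVectorField_zero_right (u : Fin k → ℝ)
    (f : C^∞⟮𝓘(ℝ, Fin k → ℝ).prod 𝓘(ℝ, V), (Fin k → ℝ) × M; ℝ⟯) (t : Fin k → ℝ) (x : M) :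
    vectorFieldDerivation (prodVectorField u 0) f (t, x) = fderiv ℝ (fun τ => f (τ, x)) t u := by
  rw [prodVectorField_apply]
  exact (congrArg _ (map_zero (mfderiv 𝓘(ℝ, V) 𝓘(ℝ, ℝ) (slice f t) x))).trans (add_zero _)

theorem prodVectorField_zero_left (X : VectorFields 𝓘(ℝ, V) M)
    (f : C^∞⟮𝓘(ℝ, Fin k → ℝ).prod 𝓘(ℝ, V), (Fin k → ℝ) × M; ℝ⟯) (t : Fin k → ℝ) (x : M) :
    vectorFieldDerivation (prodVectorField 0 X) f (t, x) =
      vectorFieldDerivation X (slice f t) x := by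
  rw [prodVectorField_apply, map_zero, zero_add]

/-- The derivative at time `t`, in the direction `u`, of a curve `t ↦ s t` in the fibre `E x`. -/
def fiberDeriv (F : Type*) [NormedAddCommGroup F] [NormedSpace ℝ F] {E : M → Type*}
    [TopologicalSpace (TotalSpace F E)] [∀ x, AddCommGroup (E x)] [∀ x, Module ℝ (E x)]
    [∀ x, TopologicalSpace (E x)] [FiberBundle F E] [VectorBundle ℝ F E]
    {x : M} (s : (Fin k → ℝ) → E x) (t u : Fin k → ℝ) : E x :=
  (VectorBundle.continuousLinearEquivAt ℝ F E x).symm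
    (fderiv ℝ (fun τ => VectorBundle.continuousLinearEquivAt ℝ F E x (s τ)) t u)

theorem fiberDeriv_sum {x : M} {n : ℕ} (C : Fin n → (Fin k → ℝ) → ℝ) (e : Fin n → E x)
    (t u : Fin k → ℝ) (hC : ∀ i, DifferentiableAt ℝ (C i) t) :
    fiberDeriv F (fun τ => ∑ i, C i τ • e i) t u = ∑ i, fderiv ℝ (C i) t u • e i := by
  have h : HasFDerivAt (fun τ => ∑ i, C i τ • VectorBundle.continuousLinearEquivAt ℝ F E x (e i))
      (∑ i, (fderiv ℝ (C i) t).smulRight (VectorBundle.continuousLinearEquivAt ℝ F E x (e i))) t :=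
    HasFDerivAt.fun_sum fun i _ => (hC i).hasFDerivAt.smul_const _
  simp only [fiberDeriv, map_sum, map_smul]
  rw [h.fderiv]
  simp only [sum_apply, ContinuousLinearMap.smulRight_apply, map_sum, map_smul,
    ContinuousLinearEquiv.symm_apply_apply]

theorem exists_timeDeriv (S : PullbackSections k V F E) (u : Fin k → ℝ) (x₀ : M) :
    ∃ T : PullbackSections k V F E, ∀ᶠ x in 𝓝 x₀, ∀ t,
      fiberDeriv F (fun τ => S (τ, x)) t u = T (t, x) := by
  obtain ⟨n, ψ, e, c, hc, h1⟩ := exists_coefficients S x₀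
  refine ⟨∑ i, vectorFieldDerivation (prodVectorField u 0) (c i) • pullSection (e i), ?_⟩
  filter_upwards [h1] with x hx t
  have h2 : ∀ τ, S (τ, x) = ∑ i, c i (τ, x) • e i x := fun τ => by
    have h := congrArg (fun s : Cₛ^∞⟮𝓘(ℝ, V); F, E⟯ => s x) (hc τ)
    simp only [sum_section_apply, section_smul_apply, hx, one_smul] at h
    exact h
  rw [sum_section_apply]
  simp only [section_smul_apply, prodVectorField_zero_right]
  rw [funext h2]
  exact fiberDeriv_sum (F := F) (fun i τ => c i (τ, x)) (fun i => e i x) t u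
    fun i => (smooth_time (c i) x).differentiable (by simp) t

theorem differentiable_time (S : PullbackSections k V F E) (x : M) : Differentiable ℝ
    (fun τ : Fin k → ℝ => VectorBundle.continuousLinearEquivAt ℝ F E x (S (τ, x))) := by
  obtain ⟨n, ψ, e, c, hc, h1⟩ := exists_coefficients S x
  have h2 : ∀ τ, S (τ, x) = ∑ i, c i (τ, x) • e i x := fun τ => by
    have h := congrArg (fun s : Cₛ^∞⟮𝓘(ℝ, V); F, E⟯ => s x) (hc τ)
    simp only [sum_section_apply, section_smul_apply, h1.self_of_nhds, one_smul] at h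
    exact h
  have h3 : (fun τ : Fin k → ℝ => VectorBundle.continuousLinearEquivAt ℝ F E x (S (τ, x))) =
      fun τ => ∑ i, c i (τ, x) • VectorBundle.continuousLinearEquivAt ℝ F E x (e i x) := by
    funext τ
    rw [h2 τ, map_sum]
    simp only [map_smul]
  rw [h3]
  exact Differentiable.fun_sum fun i _ =>
    ((smooth_time (c i) x).differentiable (by simp)).smul_const _

theorem fiberDeriv_add {x : M} (s r : (Fin k → ℝ) → E x) (t u : Fin k → ℝ)
    (hs : DifferentiableAt ℝ (fun τ => VectorBundle.continuousLinearEquivAt ℝ F E x (s τ)) t)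
    (hr : DifferentiableAt ℝ (fun τ => VectorBundle.continuousLinearEquivAt ℝ F E x (r τ)) t) :
    fiberDeriv F (fun τ => s τ + r τ) t u = fiberDeriv F s t u + fiberDeriv F r t u := by
  simp only [fiberDeriv, map_add]
  rw [fderiv_fun_add hs hr, add_apply, map_add]

theorem fiberDeriv_smul {x : M} (f : (Fin k → ℝ) → ℝ) (s : (Fin k → ℝ) → E x) (t u : Fin k → ℝ)
    (hf : DifferentiableAt ℝ f t)
    (hs : DifferentiableAt ℝ (fun τ => VectorBundle.continuousLinearEquivAt ℝ F E x (s τ)) t) :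
    fiberDeriv F (fun τ => f τ • s τ) t u =
      f t • fiberDeriv F s t u + fderiv ℝ f t u • s t := by
  simp only [fiberDeriv, map_smul]
  rw [fderiv_fun_smul hf hs]
  simp only [add_apply, smul_apply, ContinuousLinearMap.smulRight_apply, map_add, map_smul,
    ContinuousLinearEquiv.symm_apply_apply]

theorem fiberDeriv_const_smul {x : M} (c : ℝ) (s : (Fin k → ℝ) → E x) (t u : Fin k → ℝ)
    (hs : DifferentiableAt ℝ (fun τ => VectorBundle.continuousLinearEquivAt ℝ F E x (s τ)) t) :
    fiberDeriv F (fun τ => c • s τ) t u = c • fiberDeriv F s t u := by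
  rw [fiberDeriv_smul (fun _ => c) s t u (differentiableAt_const c) hs]
  simp

/-- The derivative `∂_u S` of a section `S` of the pullback bundle in the direction `u ∈ ℝ^k`, i.e.
`∑ j, u j ∂S/∂t_j`. -/
def timeDeriv (u : Fin k → ℝ) : Module.End ℝ (PullbackSections k V F E) where
  toFun S := ⟨fun p => fiberDeriv F (E := E) (fun τ => S (τ, p.2)) p.1 u,
    contMDiff_of_local fun x₀ => exists_timeDeriv S u x₀⟩
  map_add' S T := by
    ext ⟨t, x⟩
    exact fiberDeriv_add (E := E) (x := x) (fun τ => S (τ, x)) (fun τ => T (τ, x)) t u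
      (differentiable_time S x t) (differentiable_time T x t)
  map_smul' c S := by
    ext ⟨t, x⟩
    exact fiberDeriv_const_smul (E := E) (x := x) c (fun τ => S (τ, x)) t u
      (differentiable_time S x t)

theorem timeDeriv_add (u v : Fin k → ℝ) (S : PullbackSections k V F E) :
    timeDeriv (u + v) S = timeDeriv u S + timeDeriv v S := by
  ext ⟨t, x⟩
  change fiberDeriv F (E := E) (x := x) _ t (u + v) = fiberDeriv F (E := E) (x := x) _ t u +
    fiberDeriv F (E := E) (x := x) _ t v
  simp only [fiberDeriv, map_add]

theorem timeDeriv_smul (c : ℝ) (u : Fin k → ℝ) (S : PullbackSections k V F E) :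
    timeDeriv (c • u) S = c • timeDeriv u S := by
  ext ⟨t, x⟩
  change fiberDeriv F (E := E) (x := x) _ t (c • u) = c • fiberDeriv F (E := E) (x := x) _ t u
  simp only [fiberDeriv, map_smul]

theorem timeDeriv_isCDO (u : Fin k → ℝ) :
    IsCDO (timeDeriv (V := V) (F := F) (E := E) u)
      (vectorFieldDerivation (prodVectorField u (0 : VectorFields 𝓘(ℝ, V) M))) := by
  intro f S
  ext ⟨t, x⟩
  refine (fiberDeriv_smul (E := E) (x := x) (fun τ => f (τ, x)) (fun τ => S (τ, x)) t u
    ((smooth_time f x).differentiable (by simp) t) (differentiable_time S x t)).trans ?_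
  rw [← prodVectorField_zero_right]
  rfl

theorem exists_liftOp {D : Module.End ℝ Cₛ^∞⟮𝓘(ℝ, V); F, E⟯} {X : VectorFields 𝓘(ℝ, V) M}
    (hD : IsCDO D (vectorFieldDerivation X)) (S : PullbackSections k V F E) (x₀ : M) :
    ∃ T : PullbackSections k V F E, ∀ᶠ x in 𝓝 x₀, ∀ t, D (sliceSection S t) x = T (t, x) := by
  obtain ⟨n, ψ, e, c, hc, h1⟩ := exists_coefficients S x₀
  refine ⟨∑ i, (c i • pullSection (D (e i)) +
    vectorFieldDerivation (prodVectorField 0 X) (c i) • pullSection (e i)), ?_⟩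
  filter_upwards [h1.eventually_nhds] with x hx t
  have h2 := congrArg (fun s : Cₛ^∞⟮𝓘(ℝ, V); F, E⟯ => D s x) (hc t)
  have h3 : vectorFieldDerivation X ψ x = 0 := by
    have hx' : (ψ : M → ℝ) =ᶠ[𝓝 x] fun _ => 1 := hx
    rw [vectorFieldDerivation_apply, hx'.mfderiv_eq, mfderiv_const]
    rfl
  simp only [map_sum, sum_section_apply] at h2 ⊢
  rw [hD ψ] at h2
  simp only [hD _ (e _)] at h2
  simp only [ContMDiffSection.coe_add, Pi.add_apply, section_smul_apply, h3, hx.self_of_nhds,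
    one_smul, zero_smul, add_zero] at h2
  rw [h2]
  refine Finset.sum_congr rfl fun i _ => ?_
  simp only [ContMDiffSection.coe_add, Pi.add_apply, section_smul_apply, prodVectorField_zero_left]
  rfl

/-- The operator `S ↦ ((t, x) ↦ D(S_t)(x))` on sections of the pullback bundle, for a covariant
differential operator `D` on `E`. -/
def liftOp (D : Module.End ℝ Cₛ^∞⟮𝓘(ℝ, V); F, E⟯) {X : VectorFields 𝓘(ℝ, V) M}
    (hD : IsCDO D (vectorFieldDerivation X)) : Module.End ℝ (PullbackSections k V F E) where
  toFun S := ⟨fun p => D (sliceSection S p.1) p.2, contMDiff_of_local fun x₀ => exists_liftOp hD S x₀⟩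
  map_add' S T := by
    ext ⟨t, x⟩
    exact congrArg (fun s : Cₛ^∞⟮𝓘(ℝ, V); F, E⟯ => s x)
      (map_add D (sliceSection S t) (sliceSection T t))
  map_smul' c S := by
    ext ⟨t, x⟩
    exact congrArg (fun s : Cₛ^∞⟮𝓘(ℝ, V); F, E⟯ => s x) (map_smul D c (sliceSection S t))

theorem liftOp_isCDO {D : Module.End ℝ Cₛ^∞⟮𝓘(ℝ, V); F, E⟯} {X : VectorFields 𝓘(ℝ, V) M}
    (hD : IsCDO D (vectorFieldDerivation X)) :
    IsCDO (liftOp D hD : Module.End ℝ (PullbackSections k V F E))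
      (vectorFieldDerivation (prodVectorField (0 : Fin k → ℝ) X)) := by
  intro f S
  ext ⟨t, x⟩
  change (D (slice f t • sliceSection S t) x : E x) = f (t, x) • D (sliceSection S t) x +
    vectorFieldDerivation (prodVectorField (0 : Fin k → ℝ) X) f (t, x) • sliceSection S t x
  rw [hD, prodVectorField_zero_left]
  rfl

end PullbackSections

section AffineConnection

variable {k : ℕ} {V : Type*} [NormedAddCommGroup V] [NormedSpace ℝ V] [FiniteDimensional ℝ V]
  {M : Type*} [TopologicalSpace M] [ChartedSpace V M] [IsManifold 𝓘(ℝ, V) ∞ M] [T2Space M]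
  {FA : Type*} [NormedAddCommGroup FA] [NormedSpace ℝ FA] [FiniteDimensional ℝ FA] {A : M → Type*}
  [TopologicalSpace (TotalSpace FA A)] [∀ x, AddCommGroup (A x)] [∀ x, Module ℝ (A x)]
  [∀ x, TopologicalSpace (A x)] [FiberBundle FA A] [VectorBundle ℝ FA A]
  [ContMDiffVectorBundle ∞ FA A 𝓘(ℝ, V)] [LieAlgebroid 𝓘(ℝ, V) FA A]
  {FE : Type*} [NormedAddCommGroup FE] [NormedSpace ℝ FE] [FiniteDimensional ℝ FE] {E : M → Type*}
  [TopologicalSpace (TotalSpace FE E)] [∀ x, AddCommGroup (E x)] [∀ x, Module ℝ (E x)]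
  [∀ x, TopologicalSpace (E x)] [FiberBundle FE E] [VectorBundle ℝ FE E]
  [ContMDiffVectorBundle ∞ FE E 𝓘(ℝ, V)]

/-- The barycentric coordinates `(1 - t_1 - ... - t_k, t_1, ..., t_k)` as smooth functions on
`ℝ^k × M`. -/
def weight (V : Type*) [NormedAddCommGroup V] [NormedSpace ℝ V] (M : Type*) [TopologicalSpace M]
    [ChartedSpace V M] (i : Fin (k + 1)) :
    C^∞⟮𝓘(ℝ, Fin k → ℝ).prod 𝓘(ℝ, V), (Fin k → ℝ) × M; ℝ⟯ :=
  ⟨fun p => (Fin.cons (1 - ∑ j, p.1 j) p.1 : Fin (k + 1) → ℝ) i, by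
    have h : ContDiff ℝ ∞ (fun t : Fin k → ℝ => (Fin.cons (1 - ∑ j, t j) t : Fin (k + 1) → ℝ) i) := by
      refine Fin.cases ?_ (fun j => ?_) i
      · simp only [Fin.cons_zero]
        fun_prop
      · simp only [Fin.cons_succ]
        fun_prop
    exact h.contMDiff.comp contMDiff_fst⟩

theorem sum_weight (t : Fin k → ℝ) (x : M) : ∑ i, weight V M i (t, x) = 1 := by
  change ∑ i, (Fin.cons (1 - ∑ j, t j) t : Fin (k + 1) → ℝ) i = 1
  rw [Fin.sum_univ_succ]
  simp

/-- The operator `S ↦ ∂_u S + (1 - ∑ t_i) ∇⁰_a S + ∑ t_i ∇ⁱ_a S` on sections of the pullback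
of `E` to `ℝ^k × M`. -/
def affineOp (D : Fin (k + 1) → RConnection (anchorHom 𝓘(ℝ, V) FA A) Cₛ^∞⟮𝓘(ℝ, V); FE, E⟯)
    (u : Fin k → ℝ) (a : Cₛ^∞⟮𝓘(ℝ, V); FA, A⟯) : Module.End ℝ (PullbackSections k V FE E) :=
  timeDeriv u + ∑ i, weight V M i •
    liftOp ((D i).toFun a) (X := LieAlgebroid.anchor.onSections a) ((D i).isCDO a)

theorem affineOp_apply
    (D : Fin (k + 1) → RConnection (anchorHom 𝓘(ℝ, V) FA A) Cₛ^∞⟮𝓘(ℝ, V); FE, E⟯)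
    (u : Fin k → ℝ) (a : Cₛ^∞⟮𝓘(ℝ, V); FA, A⟯) (S : PullbackSections k V FE E)
    (t : Fin k → ℝ) (x : M) : (affineOp D u a S (t, x) : E x) =
      (sliceSection (timeDeriv (u) S) t x : E x) +
        ∑ i, weight V M i (t, x) • ((D i).toFun a (sliceSection S t) x : E x) := by
  simp only [affineOp, LinearMap.add_apply, LinearMap.sum_apply, LinearMap.smul_apply,
    ContMDiffSection.coe_add, Pi.add_apply]
  refine congrArg₂ (fun v w : E x => v + w) rfl ?_
  exact sum_section_apply _ _

/-- The affine combination of the connections `∇⁰, …, ∇ᵏ`: the `ℝ`-linear connection on the pullback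
of `E` to `ℝ^k × M` given by
`(∇^aff_{(u, a)} S)(t, x) = (∂_u S)(t, x) + (1 - ∑ t_i) (∇⁰_a S_t)(x) + ∑ t_i (∇ⁱ_a S_t)(x)`. -/
def affineConnection
    (D : Fin (k + 1) → RConnection (anchorHom 𝓘(ℝ, V) FA A) Cₛ^∞⟮𝓘(ℝ, V); FE, E⟯) :
    RConnection (prodAnchorHom (V := V) k FA A) (PullbackSections k V FE E) where
  toFun :=
    { toFun := fun a => affineOp D a.1 a.2
      map_add' := fun a b => by
        ext S ⟨t, x⟩
        have h : (sliceSection (timeDeriv (a.1 + b.1) S) t x : E x) =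
          (sliceSection (timeDeriv (a.1) S) t x : E x) + (sliceSection (timeDeriv (b.1) S) t x : E x) := by rw [timeDeriv_add]; rfl
        refine (affineOp_apply D (a.1 + b.1) (a.2 + b.2) S t x).trans ((?_ : _ = _).trans
          (congrArg₂ (fun v w : E x => v + w) (affineOp_apply D a.1 a.2 S t x)
            (affineOp_apply D b.1 b.2 S t x)).symm)
        simp only [h, map_add, LinearMap.add_apply, ContMDiffSection.coe_add, Pi.add_apply,
          smul_add, Finset.sum_add_distrib]
        abel
      map_smul' := fun c a => by
        ext S ⟨t, x⟩
        have h : (sliceSection (timeDeriv (c • a.1) S) t x : E x) = c • (sliceSection (timeDeriv (a.1) S) t x : E x) := by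
          rw [timeDeriv_smul]; rfl
        refine (affineOp_apply D (c • a.1) (c • a.2) S t x).trans ((?_ : _ = _).trans
          (congrArg (fun v : E x => c • v) (affineOp_apply D a.1 a.2 S t x)).symm)
        simp only [h, map_smul, LinearMap.smul_apply, ContMDiffSection.coe_smul, Pi.smul_apply,
          smul_add, Finset.smul_sum, smul_comm c]
        rfl }
  isCDO := fun a f S => by
    ext ⟨t, x⟩
    have h1 : (sliceSection (timeDeriv (a.1) (f • S)) t x : E x) = f (t, x) • (sliceSection (timeDeriv (a.1) S) t x : E x) +
        fderiv ℝ (fun τ => f (τ, x)) t a.1 • sliceSection S t x := by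
      rw [timeDeriv_isCDO a.1 f S, ← prodVectorField_zero_right]
      rfl
    have h2 : ∀ i, ((D i).toFun a.2 (sliceSection (f • S) t) x : E x) =
        f (t, x) • (D i).toFun a.2 (sliceSection S t) x +
          vectorFieldDerivation (LieAlgebroid.anchor.onSections a.2) (slice f t) x •
            sliceSection S t x := fun i =>
      congrArg (fun s : Cₛ^∞⟮𝓘(ℝ, V); FE, E⟯ => s x) ((D i).isCDO a.2 (slice f t) (sliceSection S t))
    have h3 : prodAnchorHom (V := V) k FA A a f (t, x) = fderiv ℝ (fun τ => f (τ, x)) t a.1 +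
        vectorFieldDerivation (LieAlgebroid.anchor.onSections a.2) (slice f t) x :=
      prodVectorField_apply _ _ _ _ _
    refine (affineOp_apply D a.1 a.2 (f • S) t x).trans ((?_ : _ = _).trans
      (congrArg (fun v : E x => f (t, x) • v +
        prodAnchorHom (V := V) k FA A a f (t, x) • sliceSection S t x)
          (affineOp_apply D a.1 a.2 S t x)).symm)
    simp only [h1, h2, h3, smul_add, Finset.sum_add_distrib, add_smul, Finset.smul_sum,
      smul_comm _ (f (t, x)), ← Finset.sum_smul, sum_weight]
    change @Eq (E x) _ _
    rw [one_smul]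
    abel

end AffineConnection

section Integration

variable (k : ℕ)

/-- The standard simplex `{t ∈ ℝ^k | t_i ≥ 0, t_1 + ... + t_k ≤ 1}`. -/
def simplex : Set (Fin k → ℝ) := {t | (∀ i, 0 ≤ t i) ∧ ∑ i, t i ≤ 1}

theorem simplex_subset : simplex k ⊆ Set.Icc 0 1 := fun _ ht =>
  ⟨ht.1, fun i => (Finset.single_le_sum (fun j _ => ht.1 j) (Finset.mem_univ i)).trans ht.2⟩

theorem isCompact_simplex : IsCompact (simplex k) := by
  refine isCompact_Icc.of_isClosed_subset ?_ (simplex_subset k)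
  refine IsClosed.inter (s₁ := {t : Fin k → ℝ | ∀ i, 0 ≤ t i})
    (s₂ := {t : Fin k → ℝ | ∑ i, t i ≤ 1}) ?_ ?_
  · rw [Set.ofPred_forall]
    exact isClosed_iInter fun i => isClosed_le continuous_const (continuous_apply i)
  · exact isClosed_le (by fun_prop) continuous_const

variable {k}
variable {V : Type*} [NormedAddCommGroup V] [NormedSpace ℝ V]
  {M : Type*} [TopologicalSpace M] [ChartedSpace V M] [IsManifold 𝓘(ℝ, V) ∞ M]

theorem contDiffOn_integral_simplex {U : Set V} (hU : IsOpen U) (g : (Fin k → ℝ) × V → ℝ)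
    (hg : ∀ t, ∀ y ∈ U, ContDiffAt ℝ ∞ g (t, y)) :
    ContDiffOn ℝ ∞ (fun y => ∫ t in simplex k, g (t, y)) U := by
  let b : ContDiffBump (0 : Fin k → ℝ) := ⟨1, 2, by norm_num, by norm_num⟩
  have hb : ∀ t ∈ simplex k, b t = 1 := fun t ht => by
    refine b.one_of_mem_closedBall ?_
    rw [mem_closedBall_zero_iff, pi_norm_le_iff_of_nonneg zero_le_one]
    intro i
    have := simplex_subset k ht
    rw [Real.norm_eq_abs, abs_of_nonneg (this.1 i)]
    exact this.2 i
  let G : V → (Fin k → ℝ) → ℝ := fun y τ => b (-τ) * g (-τ, y)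
  have h := MeasureTheory.contDiffOn_convolution_right_with_param_comp (n := ⊤) (𝕜 := ℝ)
    (μ := (MeasureTheory.volume : MeasureTheory.Measure (Fin k → ℝ)))
    (ContinuousLinearMap.mul ℝ ℝ) (s := U) (v := fun _ : V => (0 : Fin k → ℝ))
    (f := (simplex k).indicator fun _ => (1 : ℝ)) (g := G) (k := Metric.closedBall 0 2)
    contDiffOn_const hU (isCompact_closedBall _ _) ?_ ?_ ?_
  · refine h.congr fun y hy => ?_
    simp only [MeasureTheory.convolution, G, zero_sub, neg_neg, ContinuousLinearMap.mul_apply']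
    rw [← MeasureTheory.integral_indicator (isCompact_simplex k).measurableSet]
    refine MeasureTheory.integral_congr_ae (Filter.Eventually.of_forall fun t => ?_)
    by_cases ht : t ∈ simplex k
    · simp [ht, hb t ht]
    · simp [ht]
  · intro y τ _ hτ
    have : b (-τ) = 0 := by
      refine b.zero_of_le_dist ?_
      rw [dist_zero_right, norm_neg]
      rw [mem_closedBall_zero_iff, not_le] at hτ
      exact hτ.le
    simp [G, this]
  · refine MeasureTheory.Integrable.locallyIntegrable ?_
    rw [MeasureTheory.integrable_indicator_iff (isCompact_simplex k).measurableSet]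
    exact MeasureTheory.integrableOn_const (isCompact_simplex k).measure_lt_top.ne
  · rintro ⟨y, τ⟩ ⟨hy, -⟩
    refine ContDiffAt.contDiffWithinAt ?_
    refine ContDiffAt.mul ?_ ?_
    · exact (b.contDiff.comp contDiff_snd.neg).contDiffAt
    · exact (hg (-τ) y hy).comp (y, τ) (contDiff_snd.neg.prodMk contDiff_fst).contDiffAt

theorem contMDiff_integral_simplex
    (f : C^∞⟮𝓘(ℝ, Fin k → ℝ).prod 𝓘(ℝ, V), (Fin k → ℝ) × M; ℝ⟯) :
    ContMDiff 𝓘(ℝ, V) 𝓘(ℝ, ℝ) ∞ (fun x => ∫ t in simplex k, f (t, x)) := by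
  intro x₀
  have h := contDiffOn_integral_simplex (isOpen_extChartAt_target (I := 𝓘(ℝ, V)) x₀) _
    (fun t y hy => contDiffAt_chart f t x₀ hy)
  have h1 := (h.contDiffAt ((isOpen_extChartAt_target x₀).mem_nhds (mem_extChartAt_target x₀))).contMDiffAt
  refine (h1.comp x₀ contMDiffAt_extChartAt).congr_of_eventuallyEq ?_
  filter_upwards [extChartAt_source_mem_nhds (I := 𝓘(ℝ, V)) x₀] with x hx
  simp only [Function.comp_apply, (extChartAt 𝓘(ℝ, V) x₀).left_inv hx]

theorem integrableOn_simplex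
    (f : C^∞⟮𝓘(ℝ, Fin k → ℝ).prod 𝓘(ℝ, V), (Fin k → ℝ) × M; ℝ⟯) (x : M) :
    MeasureTheory.IntegrableOn (fun t => f (t, x)) (simplex k) :=
  (f.contMDiff.continuous.comp (by fun_prop : Continuous fun t : Fin k → ℝ => (t, x))).continuousOn
    |>.integrableOn_compact (isCompact_simplex k)

/-- Integration over the standard simplex: `f ↦ (x ↦ ∫_{Δᵏ} f(t, x) dt)`. -/
def integrateSimplex : C^∞⟮𝓘(ℝ, Fin k → ℝ).prod 𝓘(ℝ, V), (Fin k → ℝ) × M; ℝ⟯ →ₗ[ℝ]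
    C^∞⟮𝓘(ℝ, V), M; ℝ⟯ where
  toFun f := ⟨fun x => ∫ t in simplex k, f (t, x), contMDiff_integral_simplex f⟩
  map_add' f g := by
    ext x
    exact MeasureTheory.integral_add (integrableOn_simplex f x) (integrableOn_simplex g x)
  map_smul' c f := by
    ext x
    exact MeasureTheory.integral_const_mul c _

theorem append_update {L : Type*} [AddCommGroup L] {m : ℕ} [DecidableEq (Fin m)]
    (u : Fin k → (Fin k → ℝ) × L) (a : Fin m → L) (i : Fin m) (x : L) :
    Fin.append u (fun i' => (0, Function.update a i x i')) =
      Function.update (Fin.append u (fun i' => (0, a i'))) (Fin.natAdd k i) (0, x) := by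
  funext j
  refine Fin.addCases (fun j => ?_) (fun j => ?_) j
  · rw [Fin.append_left, Function.update_of_ne, Fin.append_left]
    intro h
    have := congrArg Fin.val h
    simp at this
    omega
  · rw [Fin.append_right]
    by_cases h : j = i
    · subst h
      simp
    · rw [Function.update_of_ne h, Function.update_of_ne, Fin.append_right]
      exact fun hj => h ((Fin.natAdd_inj k).1 hj)

/-- The integral over the standard simplex of an `ℝ`-multilinear form `η` on `ℝ^k × L`: the form
`a ↦ ∫_{Δᵏ} η(∂/∂t_1, ..., ∂/∂t_k, a_1, ..., a_m)(t, ·) dt`. -/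
def fiberIntegral {L : Type*} [AddCommGroup L] [Module ℝ L] {m : ℕ}
    (η : ((Fin k → ℝ) × L) [⋀^Fin (k + m)]→ₗ[ℝ]
      C^∞⟮𝓘(ℝ, Fin k → ℝ).prod 𝓘(ℝ, V), (Fin k → ℝ) × M; ℝ⟯) :
    L [⋀^Fin m]→ₗ[ℝ] C^∞⟮𝓘(ℝ, V), M; ℝ⟯ where
  toFun a := integrateSimplex
    (η (Fin.append (fun j => (Pi.single j 1, 0)) (fun i => (0, a i))))
  map_update_add' a i x y := by
    have h : ((0, x + y) : (Fin k → ℝ) × L) = (0, x) + (0, y) := by simp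
    simp only [append_update, h, AlternatingMap.map_update_add, map_add]
  map_update_smul' a i c x := by
    have h : ((0, c • x) : (Fin k → ℝ) × L) = c • (0, x) := by simp
    simp only [append_update, h, AlternatingMap.map_update_smul, map_smul]
  map_eq_zero_of_eq' a i j hij hne := by
    rw [η.map_eq_zero_of_eq _ (i := Fin.natAdd k i) (j := Fin.natAdd k j), map_zero]
    · simp [hij]
    · exact fun h => hne ((Fin.natAdd_inj k).1 h)

end Integration

section ChernSimons

variable {V : Type*} [NormedAddCommGroup V] [NormedSpace ℝ V] [FiniteDimensional ℝ V]
  {M : Type*} [TopologicalSpace M] [ChartedSpace V M] [IsManifold 𝓘(ℝ, V) ∞ M] [T2Space M]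
  {FA : Type*} [NormedAddCommGroup FA] [NormedSpace ℝ FA] [FiniteDimensional ℝ FA] {A : M → Type*}
  [TopologicalSpace (TotalSpace FA A)] [∀ x, AddCommGroup (A x)] [∀ x, Module ℝ (A x)]
  [∀ x, TopologicalSpace (A x)] [FiberBundle FA A] [VectorBundle ℝ FA A]
  [ContMDiffVectorBundle ∞ FA A 𝓘(ℝ, V)] [LieAlgebroid 𝓘(ℝ, V) FA A]
  {FE : Type*} [NormedAddCommGroup FE] [NormedSpace ℝ FE] [FiniteDimensional ℝ FE] {E : M → Type*}
  [TopologicalSpace (TotalSpace FE E)] [∀ x, AddCommGroup (E x)] [∀ x, Module ℝ (E x)]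
  [∀ x, TopologicalSpace (E x)] [FiberBundle FE E] [VectorBundle ℝ FE E]
  [ContMDiffVectorBundle ∞ FE E 𝓘(ℝ, V)]

/-- The Chern-Simons form `cs_p(∇⁰, ..., ∇ᵏ)`, an alternating form of degree `m = 2 p - k` on `Γ(A)`.
For `k = 0` it is `ch_p(∇⁰) = Tr((R^{∇⁰})^p)`. For `k > 0` it is
`a ↦ ∫_{Δᵏ} ch_p(∇^aff)(∂/∂t_1, ..., ∂/∂t_k, a_1, ..., a_m)(t, ·) dt`, where `∇^aff` is the affine
combination of the connections. -/
def chernSimons (p : ℕ) : (k m : ℕ) → k + m = 2 * p →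
    (Fin (k + 1) → RConnection (anchorHom 𝓘(ℝ, V) FA A) Cₛ^∞⟮𝓘(ℝ, V); FE, E⟯) →
    Cₛ^∞⟮𝓘(ℝ, V); FA, A⟯ [⋀^Fin m]→ₗ[ℝ] C^∞⟮𝓘(ℝ, V), M; ℝ⟯
  | 0, m, h, D =>
    AlternatingMap.domDomCongr (finCongr (show 2 * p = m by omega)) ((D 0).chernForm fiberTrace p)
  | k + 1, m, h, D =>
    fiberIntegral (k := k + 1) (AlternatingMap.domDomCongr (finCongr h.symm)
      ((affineConnection D).chernForm fiberTrace p))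

end ChernSimons

end LieAlgebroidCS

end

open LieAlgebroidCS

/-!
The Chern character form is closed: by the second Bianchi identity `R` is `∇`-parallel, and
`Tr [∇_a, φ] = ρ(a) (Tr φ)`. Apply this to the affine combination `∇^aff` over `ℝ^k × M`.
Contracting `d ch_p(∇^aff) = 0` with the commuting elements `∂/∂t_1, …, ∂/∂t_k` leaves, up to sign,
the differential in the directions of `A` and the `t`-derivatives of the other contractions of
`ch_p(∇^aff)`. On integrating over `Δ^k` the first becomes `d cs_p`, and Stokes' theorem turns the
second into integrals over the faces. The face opposite the `j`-th vertex contributes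
`cs_p(∇^0, …, ∇^{j-1}, ∇^{j+1}, …, ∇^k)`, because there `∇^aff` restricts to the affine combination
of the connections other than `∇^j`.
-/

noncomputable section

namespace LieAlgebroidCS

section AlternatingSums

variable {ι L N : Type*} [Fintype ι] [DecidableEq ι] [AddCommGroup N] {n : ℕ}

/-- The alternating sum over all permutations of the arguments of an arbitrary function `h`; unlike
`MultilinearMap.alternatization` it does not ask `h` to be multilinear. -/
def altSum (h : (ι → L) → N) (a : ι → L) : N :=
  ∑ σ : Equiv.Perm ι, Equiv.Perm.sign σ • h (a ∘ σ)

theorem altSum_comp_perm (h : (ι → L) → N) (τ : Equiv.Perm ι) (a : ι → L) :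
    altSum (fun b => h (b ∘ τ)) a = Equiv.Perm.sign τ • altSum h a := by
  simp only [altSum, Finset.smul_sum, smul_smul]
  refine Fintype.sum_equiv (Equiv.mulRight τ) _ _ fun σ => ?_
  rw [Equiv.coe_mulRight, Equiv.Perm.sign_mul, mul_left_comm, Int.units_mul_self, mul_one]
  rfl

theorem altSum_add (h h' : (ι → L) → N) (a : ι → L) :
    altSum (fun b => h b + h' b) a = altSum h a + altSum h' a := by
  simp only [altSum, smul_add, Finset.sum_add_distrib]

theorem altSum_sum {κ : Type*} (s : Finset κ) (h : κ → (ι → L) → N) (a : ι → L) :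
    altSum (fun b => ∑ i ∈ s, h i b) a = ∑ i ∈ s, altSum (h i) a := by
  simp only [altSum, Finset.smul_sum]
  exact Finset.sum_comm

theorem map_altSum {N' F : Type*} [AddCommGroup N'] [FunLike F N N'] [AddMonoidHomClass F N N']
    (T : F) (h : (ι → L) → N) (a : ι → L) :
    T (altSum h a) = altSum (fun b => T (h b)) a := by
  simp only [altSum, map_sum, Units.smul_def, map_zsmul]

theorem sum_altSum_update (h : (ι → L) → N) (g : L → L) (a : ι → L) :
    ∑ j, altSum h (Function.update a j (g (a j))) =
      altSum (fun b => ∑ j, h (Function.update b j (g (b j)))) a := by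
  simp only [altSum]
  rw [Finset.sum_comm]
  refine Finset.sum_congr rfl fun σ _ => ?_
  rw [← Finset.smul_sum, ← Equiv.sum_comp σ]
  simp [Function.update_comp_equiv]

theorem altSum_eq_zero_of_cyclic [IsAddTorsionFree N] {h : (ι → L) → N} {τ : Equiv.Perm ι}
    (hτ : Equiv.Perm.sign τ = 1) (H : ∀ b, h b + h (b ∘ τ) + h (b ∘ τ ∘ τ) = 0) (a : ι → L) :
    altSum h a = 0 := by
  have h_one : altSum (fun b => h (b ∘ τ)) a = altSum h a := by
    rw [altSum_comp_perm, hτ, one_smul]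
  have h_two : altSum (fun b => h (b ∘ τ ∘ τ)) a = altSum h a := by
    rw [← Equiv.Perm.coe_mul, altSum_comp_perm, Equiv.Perm.sign_mul, hτ, one_mul, one_smul]
  have h_three : 3 • altSum h a = altSum (fun b => h b + h (b ∘ τ) + h (b ∘ τ ∘ τ)) a := by
    rw [altSum_add, altSum_add, h_one, h_two]
    module
  simpa [H, altSum] using h_three

/-- The permutation of `Fin (n + 1)` which maps `0` to `x.1` and otherwise acts as `x.2` does on the
remaining elements. -/
def permOfImageZero (x : Fin (n + 1) × Equiv.Perm (Fin n)) : Equiv.Perm (Fin (n + 1)) :=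
  x.1.cycleRange.symm * Equiv.Perm.decomposeFin.symm (0, x.2)

theorem permOfImageZero_apply_zero (x : Fin (n + 1) × Equiv.Perm (Fin n)) :
    permOfImageZero x 0 = x.1 := by
  simp [permOfImageZero]

theorem permOfImageZero_apply_succ (x : Fin (n + 1) × Equiv.Perm (Fin n)) (j : Fin n) :
    permOfImageZero x j.succ = x.1.succAbove (x.2 j) := by
  simp [permOfImageZero]

theorem sign_permOfImageZero (x : Fin (n + 1) × Equiv.Perm (Fin n)) :
    Equiv.Perm.sign (permOfImageZero x) = (-1) ^ (x.1 : ℕ) * Equiv.Perm.sign x.2 := by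
  rw [permOfImageZero, Equiv.Perm.sign_mul, Equiv.Perm.sign_symm, Fin.sign_cycleRange,
    Equiv.Perm.decomposeFin.symm_sign, if_pos rfl, one_mul]

theorem permOfImageZero_bijective :
    Function.Bijective (permOfImageZero : Fin (n + 1) × Equiv.Perm (Fin n) → _) := by
  rw [Fintype.bijective_iff_injective_and_card]
  refine ⟨fun x y h => ?_, by simp [Fintype.card_perm, Nat.factorial_succ]⟩
  have h_zero : x.1 = y.1 := by
    rw [← permOfImageZero_apply_zero x, h, permOfImageZero_apply_zero]
  refine Prod.ext h_zero (Equiv.ext fun j => Fin.succAbove_right_injective (p := y.1) ?_)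
  rw [← permOfImageZero_apply_succ y, ← h, permOfImageZero_apply_succ, h_zero]

theorem altSum_succ (h : (Fin (n + 1) → L) → N) (a : Fin (n + 1) → L) :
    altSum h a = ∑ i : Fin (n + 1), (-1 : ℤ) ^ (i : ℕ) •
      altSum (fun r => h (Fin.cons (a i) r)) (i.removeNth a) := by
  simp only [altSum, Finset.smul_sum]
  rw [← Fintype.sum_prod_type']
  refine (Fintype.sum_bijective permOfImageZero permOfImageZero_bijective _ _ fun x => ?_).symm
  have h_comp : a ∘ permOfImageZero x = Fin.cons (a x.1) (x.1.removeNth a ∘ x.2) := by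
    funext j
    refine Fin.cases ?_ (fun j => ?_) j
    · simp [permOfImageZero_apply_zero]
    · simp [permOfImageZero_apply_succ, Fin.removeNth]
  rw [sign_permOfImageZero, mul_smul, h_comp]
  simp [Units.smul_def]

end AlternatingSums

section Differential

variable {C L : Type*} [CommRing C] [Algebra ℝ C] [LieRing L] [LieAlgebra ℝ L]
  (ρ : L →ₗ⁅ℝ⁆ Derivation ℝ C C) {n : ℕ}

/-- The Lie derivative along `x` of a function `f` of `n` arguments, with weight `1 / 2` on the
bracket terms. The sum over `i < j` in the differential is half the sum over all ordered pairs, so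
the differential is an alternating sum of these terms. -/
def halfLieDeriv (x : L) (f : (Fin n → L) → C) (v : Fin n → L) : C :=
  ρ x (f v) - (1 / 2 : ℝ) • ∑ j, f (Function.update v j ⁅x, v j⁆)

theorem altSum_halfLieDeriv (x : L) (f : (Fin n → L) → C) (v : Fin n → L) :
    altSum (halfLieDeriv ρ x f) v = halfLieDeriv ρ x (altSum f) v := by
  simp only [halfLieDeriv, sum_altSum_update f (fun y => ⁅x, y⁆), map_altSum]
  simp only [altSum, halfLieDeriv, smul_sub, Finset.sum_sub_distrib, Finset.smul_sum,
    Units.smul_def, smul_comm (_ : ℤ) (1 / 2 : ℝ)]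

theorem sum_bracket_eq_sum_update (η : L [⋀^Fin (n + 1)]→ₗ[ℝ] C) (a : Fin (n + 2) → L) :
    ∑ i : Fin (n + 1), ∑ j ≥ i, (-1 : ℤ) ^ ((i.castSucc : ℕ) + (j.succ : ℕ)) •
        η (Matrix.vecCons ⁅a i.castSucc, a j.succ⁆ (j.removeNth (i.castSucc.removeNth a))) =
      -((1 / 2 : ℝ) • ∑ i : Fin (n + 2), (-1 : ℤ) ^ (i : ℕ) •
        ∑ j, η (Function.update (i.removeNth a) j ⁅a i, i.removeNth a j⁆)) := by
  let B : L →ₗ[ℝ] L →ₗ[ℝ] L [⋀^Fin n]→ₗ[ℝ] C :=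
    LinearMap.mk₂ ℝ (fun x y => η.curryLeft ⁅x, y⁆) (by simp) (by simp) (by simp) (by simp)
  have hB x y v : B x y v = η (Matrix.vecCons ⁅x, y⁆ v) := rfl
  have hB_sub x y v : B x y v - B y x v = (2 : ℝ) • η (Matrix.vecCons ⁅x, y⁆ v) := by
    change η.curryLeft ⁅x, y⁆ v - η.curryLeft ⁅y, x⁆ v = (2 : ℝ) • η.curryLeft ⁅x, y⁆ v
    rw [← lie_skew, map_neg, AlternatingMap.neg_apply]
    module
  have h_update x (r : Fin (n + 1) → L) :
      AlternatingMap.alternatizeUncurryFinLM (B x) r = ∑ j, η (Function.update r j ⁅x, r j⁆) := by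
    rw [AlternatingMap.alternatizeUncurryFinLM_apply, AlternatingMap.alternatizeUncurryFin_apply]
    refine Finset.sum_congr rfl fun j _ => ?_
    have h := η.neg_one_pow_smul_map_insertNth j ⁅x, r j⁆ (j.removeNth r)
    rw [Fin.insertNth_removeNth] at h
    rw [hB, ← h, smul_smul, ← pow_add, Even.neg_one_pow ⟨_, rfl⟩, one_smul]
  have h_pairs := AlternatingMap.alternatizeUncurryFin_alternatizeUncurryFinLM_comp_apply B a
  simp only [AlternatingMap.alternatizeUncurryFin_apply, LinearMap.comp_apply, h_update, hB_sub]
    at h_pairs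
  rw [h_pairs]
  simp only [Finset.smul_sum, ← Finset.sum_neg_distrib]
  refine Finset.sum_congr rfl fun i _ => Finset.sum_congr rfl fun j _ => ?_
  rw [smul_comm (1 / 2 : ℝ), smul_smul]
  norm_num [pow_succ, ← add_assoc]

theorem differential_apply (η : L [⋀^Fin n]→ₗ[ℝ] C) (a : Fin (n + 1) → L) :
    differential ρ η a =
      ∑ i : Fin (n + 1), (-1 : ℤ) ^ (i : ℕ) • halfLieDeriv ρ (a i) η (i.removeNth a) := by
  cases n with
  | zero =>
    have h : differential ρ η a = ρ (a 0) (η ![]) := rfl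
    simp [h, halfLieDeriv, Subsingleton.elim (![] : Fin 0 → L) (Fin.tail a)]
  | succ n =>
    refine (congrArg (_ + ·) (sum_bracket_eq_sum_update η a)).trans ?_
    simp only [halfLieDeriv, smul_sub, Finset.sum_sub_distrib, ← sub_eq_add_neg, Finset.smul_sum,
      smul_comm (_ : ℤ) (_ : ℝ)]

theorem differential_of_eq_altSum (η : L [⋀^Fin n]→ₗ[ℝ] C) (f : (Fin n → L) → C)
    (hf : ∀ a, η a = altSum f a) (a : Fin (n + 1) → L) :
    differential ρ η a = altSum (fun b => halfLieDeriv ρ (b 0) f (Fin.tail b)) a := by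
  rw [differential_apply, altSum_succ, funext hf]
  simp only [← altSum_halfLieDeriv, Fin.cons_zero, Fin.tail_cons]

end Differential

section Cartan

variable {R C C' L L' N : Type*} {k m n : ℕ}

theorem removeNth_natAdd_append (u : Fin k → L) (a : Fin (m + 1) → L) (i : Fin (m + 1)) :
    (Fin.natAdd k i : Fin (k + m + 1)).removeNth (Fin.append (m := k) (n := m + 1) u a) =
      Fin.append u (i.removeNth a) := by
  funext l
  refine Fin.addCases (fun l => ?_) (fun l => ?_) l
  · have h : (Fin.natAdd k i : Fin (k + m + 1)).succAbove (Fin.castAdd m l) =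
        Fin.castAdd (m + 1) l := by
      rw [Fin.succAbove_of_castSucc_lt _ _ (by simp [Fin.lt_def]; omega)]
      rfl
    rw [Fin.removeNth, h, Fin.append_left, Fin.append_left]
  · have h : (Fin.natAdd k i : Fin (k + m + 1)).succAbove (Fin.natAdd k l) =
        Fin.natAdd k (i.succAbove l) := by
      ext
      simp only [Fin.succAbove, Fin.lt_def, Fin.val_castSucc, Fin.val_natAdd]
      grind
    rw [Fin.removeNth, h, Fin.append_right, Fin.append_right]
    rfl

theorem append_update_right [DecidableEq (Fin m)] (u : Fin k → L) (a : Fin m → L) (i : Fin m)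
    (x : L) :
    Fin.append u (Function.update a i x) =
      Function.update (Fin.append u a) (Fin.natAdd k i) x := by
  funext j
  refine Fin.addCases (fun j => ?_) (fun j => ?_) j
  · rw [Fin.append_left, Function.update_of_ne (Fin.ne_of_val_ne (by simp; omega)), Fin.append_left]
  · rw [Fin.append_right]
    rcases eq_or_ne j i with rfl | h
    · simp
    · rw [Function.update_of_ne h, Function.update_of_ne, Fin.append_right]
      exact fun h' => h ((Fin.natAdd_inj k).1 h')

/-- The contraction `η(u_1, ..., u_k, ·)` of an alternating form with a tuple in its first `k`
arguments. -/
def interior [CommRing R] [AddCommGroup L] [Module R L] [AddCommGroup N] [Module R N]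
    (u : Fin k → L) (η : L [⋀^Fin (k + m)]→ₗ[R] N) : L [⋀^Fin m]→ₗ[R] N where
  toFun a := η (Fin.append u a)
  map_update_add' a i x y := by simp only [append_update_right, AlternatingMap.map_update_add]
  map_update_smul' a i c x := by simp only [append_update_right, AlternatingMap.map_update_smul]
  map_eq_zero_of_eq' a i j hij hne :=
    η.map_eq_zero_of_eq _ (i := Fin.natAdd k i) (j := Fin.natAdd k j) (by simpa using hij)
      fun h => hne ((Fin.natAdd_inj k).1 h)

theorem interior_apply [CommRing R] [AddCommGroup L] [Module R L] [AddCommGroup N] [Module R N]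
    (u : Fin k → L) (η : L [⋀^Fin (k + m)]→ₗ[R] N) (a : Fin m → L) :
    interior u η a = η (Fin.append u a) :=
  rfl

variable [CommRing C] [Algebra ℝ C] [LieRing L] [LieAlgebra ℝ L]
  (ρ : L →ₗ⁅ℝ⁆ Derivation ℝ C C)

theorem halfLieDeriv_of_lie_eq_zero (η : L [⋀^Fin n]→ₗ[ℝ] C) {x : L} {v : Fin n → L}
    (hx : ∀ i, ⁅x, v i⁆ = 0) : halfLieDeriv ρ x η v = ρ x (η v) := by
  simp [halfLieDeriv, hx]

theorem halfLieDeriv_append (η : L [⋀^Fin (k + m)]→ₗ[ℝ] C) {x : L} {u : Fin k → L} (v : Fin m → L)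
    (hx : ∀ i, ⁅x, u i⁆ = 0) :
    halfLieDeriv ρ x η (Fin.append u v) = halfLieDeriv ρ x (interior u η) v := by
  simp [halfLieDeriv, Fin.sum_univ_add, hx, interior_apply, append_update_right]

theorem differential_append (u : Fin k → L) (η : L [⋀^Fin (k + m)]→ₗ[ℝ] C) (a : Fin (m + 1) → L)
    (hu : ∀ i j, ⁅u i, u j⁆ = 0) (ha : ∀ i j, ⁅u i, a j⁆ = 0) :
    differential ρ η (Fin.append (m := k) (n := m + 1) u a) =
      (∑ j : Fin k, (-1 : ℤ) ^ (j : ℕ) • ρ (u j)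
        (η ((Fin.castAdd (m + 1) j : Fin (k + m + 1)).removeNth
          (Fin.append (m := k) (n := m + 1) u a)))) +
      (-1 : ℤ) ^ k • differential ρ (interior u η) a := by
  have hw (j : Fin k) (l : Fin (k + (m + 1))) : ⁅u j, Fin.append u a l⁆ = 0 := by
    refine Fin.addCases (fun l => ?_) (fun l => ?_) l
    · simpa using hu j l
    · simpa using ha j l
  rw [differential_apply, differential_apply, Finset.smul_sum]
  refine (Fin.sum_univ_add (a := k) (b := m + 1) _).trans (congrArg₂ (· + ·) ?_ ?_)
  · refine Finset.sum_congr rfl fun j _ => ?_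
    simp only [Fin.val_castAdd, Fin.append_left]
    exact congrArg _ (halfLieDeriv_of_lie_eq_zero ρ η fun l => hw j _)
  · refine Finset.sum_congr rfl fun i _ => ?_
    simp only [Fin.val_natAdd, Fin.append_right, removeNth_natAdd_append, pow_add, mul_smul]
    rw [halfLieDeriv_append ρ η _ fun j => by rw [← lie_skew, ha, neg_zero]]

variable {ρ}

theorem differential_eq_of_intertwining [CommRing C'] [Algebra ℝ C'] [LieRing L'] [LieAlgebra ℝ L']
    {ρ' : L' →ₗ⁅ℝ⁆ Derivation ℝ C' C'} (lam : L' →ₗ⁅ℝ⁆ L) (J : C →ₗ[ℝ] C')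
    (hJ : ∀ a f, J (ρ (lam a) f) = ρ' a (J f)) (η : L [⋀^Fin n]→ₗ[ℝ] C)
    (η' : L' [⋀^Fin n]→ₗ[ℝ] C') (hη : ∀ v, η' v = J (η (lam ∘ v))) (a : Fin (n + 1) → L') :
    differential ρ' η' a = J (differential ρ η (lam ∘ a)) := by
  have h_removeNth (i : Fin (n + 1)) : i.removeNth (lam ∘ a) = lam ∘ i.removeNth a := rfl
  simp only [differential_apply, halfLieDeriv, hη, map_sum, map_zsmul, map_sub, map_smul, hJ,
    h_removeNth, Function.comp_update, LieHom.map_lie, Function.comp_apply]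

theorem differential_domDomCongr (h : m = n) (η : L [⋀^Fin m]→ₗ[ℝ] C) (a : Fin (n + 1) → L) :
    differential ρ (AlternatingMap.domDomCongr (finCongr h) η) a =
      differential ρ η (a ∘ Fin.cast (congrArg (· + 1) h)) := by
  subst h
  rfl

end Cartan

section Bianchi

variable {C L : Type*} [CommRing C] [Algebra ℝ C] [LieRing L] [LieAlgebra ℝ L]
  {ρ : L →ₗ⁅ℝ⁆ Derivation ℝ C C} {G : Type*} [AddCommGroup G] [Module ℝ G] [Module C G]
  {ℓ : Module.End ℝ G} {X : Derivation ℝ C C}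

/-- The covariant differential operator `φ ↦ [ℓ, φ]` which `ℓ` induces on endomorphisms, as an
additive map. -/
def IsCDO.commutator (h : IsCDO ℓ X) : Module.End C G →+ Module.End C G where
  toFun φ :=
    { toFun s := ℓ (φ s) - φ (ℓ s)
      map_add' s t := by simp only [map_add]; abel
      map_smul' f s := by
        simp only [map_smul, h _ _, map_add, RingHom.id_apply, smul_sub]
        abel }
  map_zero' := by ext; simp
  map_add' φ ψ := by
    ext s
    simp only [LinearMap.coe_mk, AddHom.coe_mk, LinearMap.add_apply, map_add]
    abel

theorem IsCDO.commutator_apply (h : IsCDO ℓ X) (φ : Module.End C G) (s : G) :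
    h.commutator φ s = ℓ (φ s) - φ (ℓ s) :=
  rfl

theorem IsCDO.commutator_mul (h : IsCDO ℓ X) (φ ψ : Module.End C G) :
    h.commutator (φ * ψ) = h.commutator φ * ψ + φ * h.commutator ψ := by
  ext s
  simp only [commutator_apply, LinearMap.add_apply, Module.End.mul_apply, map_sub]
  abel

theorem IsCDO.commutator_one (h : IsCDO ℓ X) : h.commutator (1 : Module.End C G) = 0 := by
  ext s
  simp [commutator_apply]

theorem IsCDO.commutator_prod (h : IsCDO ℓ X) {p : ℕ} (g : Fin p → Module.End C G) :
    h.commutator (List.ofFn g).prod =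
      ∑ l, (List.ofFn (Function.update g l (h.commutator (g l)))).prod := by
  induction p with
  | zero => simp [commutator_one]
  | succ p ih =>
    have h_tail (l : Fin p) (φ : Module.End C G) : (fun i => Function.update g l.succ φ i.succ) =
        Function.update (fun i => g i.succ) l φ :=
      Function.update_comp_eq_of_injective g (Fin.succ_injective p) l φ
    simp only [List.ofFn_succ, List.prod_cons, commutator_mul, ih, Fin.sum_univ_succ,
      Finset.mul_sum, h_tail, Function.update_self, ne_eq, Fin.succ_ne_zero,
      (Fin.succ_ne_zero _).symm, not_false_eq_true, Function.update_of_ne]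

theorem RConnection.curvature_swap (D : RConnection ρ G) (a b : L) :
    D.curvature a b = -D.curvature b a := by
  ext s
  have h : D.toFun ⁅a, b⁆ s = -D.toFun ⁅b, a⁆ s := by
    rw [← lie_skew, map_neg, LinearMap.neg_apply]
  simp only [curvature, LinearMap.coe_mk, AddHom.coe_mk, LinearMap.neg_apply, h]
  abel

theorem RConnection.second_bianchi (D : RConnection ρ G) (x y z : L) :
    (D.isCDO x).commutator (D.curvature y z) + (D.isCDO y).commutator (D.curvature z x) +
        (D.isCDO z).commutator (D.curvature x y) =
      D.curvature ⁅x, y⁆ z + D.curvature ⁅y, z⁆ x + D.curvature ⁅z, x⁆ y := by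
  ext s
  have h_jacobi : D.toFun ⁅⁅x, y⁆, z⁆ s + D.toFun ⁅⁅y, z⁆, x⁆ s + D.toFun ⁅⁅z, x⁆, y⁆ s = 0 := by
    have h : -⁅⁅x, y⁆, z⁆ + -⁅⁅y, z⁆, x⁆ + -⁅⁅z, x⁆, y⁆ = 0 := by
      rw [lie_skew, lie_skew, lie_skew, add_rotate, lie_jacobi]
    rw [← neg_add, ← neg_add, neg_eq_zero] at h
    simpa using congrArg (fun w => D.toFun w s) h
  simp only [LinearMap.add_apply, IsCDO.commutator_apply, curvature, LinearMap.coe_mk,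
    AddHom.coe_mk, map_sub]
  rw [← sub_eq_zero, ← h_jacobi]
  abel

variable [SMulCommClass C ℝ G] [SMulCommClass ℝ C G] [IsScalarTower ℝ C G]

theorem RConnection.curvature_neg_left (D : RConnection ρ G) (a b : L) :
    D.curvature (-a) b = -D.curvature a b := by
  simpa using D.curvature_smul_left (-1) a b

/-- The Lie derivative of the curvature along `x`, with weight `1 / 2` on the bracket terms as in
`halfLieDeriv`. -/
def RConnection.halfLieCurvature (D : RConnection ρ G) (x y z : L) : Module.End C G :=
  (D.isCDO x).commutator (D.curvature y z) -
    (1 / 2 : ℝ) • (D.curvature ⁅x, y⁆ z + D.curvature y ⁅x, z⁆)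

theorem RConnection.halfLieCurvature_cyclic (D : RConnection ρ G) (x y z : L) :
    D.halfLieCurvature x y z + D.halfLieCurvature y z x + D.halfLieCurvature z x y = 0 := by
  have h_right (x y z : L) : D.curvature y ⁅x, z⁆ = D.curvature ⁅z, x⁆ y := by
    rw [D.curvature_swap, ← lie_skew x z, D.curvature_neg_left, neg_neg]
  have h_bianchi := eq_sub_of_add_eq (eq_sub_of_add_eq (D.second_bianchi x y z))
  simp only [halfLieCurvature, h_right, h_bianchi]
  module

end Bianchi

section ChernFormClosed

variable {C L : Type*} [CommRing C] [Algebra ℝ C] [LieRing L] [LieAlgebra ℝ L]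
  {ρ : L →ₗ⁅ℝ⁆ Derivation ℝ C C} {G : Type*} [AddCommGroup G] [Module ℝ G] [Module C G] {p : ℕ}

theorem sum_fin_two_mul {N : Type*} [AddCommMonoid N] (g : Fin (2 * p) → N) :
    ∑ q, g q = ∑ l : Fin p, (g ⟨2 * l, by omega⟩ + g ⟨2 * l + 1, by omega⟩) := by
  rw [← (finProdFinEquiv.trans (finCongr (mul_comm p 2))).sum_comp, Fintype.sum_prod_type]
  refine Finset.sum_congr rfl fun l _ => ?_
  rw [Fin.sum_univ_two]
  congr 2 <;> ext <;> simp [add_comm]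

theorem exists_threeCycle {ι : Type*} [Fintype ι] [DecidableEq ι] {i j k : ι} (hij : i ≠ j)
    (hjk : j ≠ k) (hik : i ≠ k) :
    ∃ τ : Equiv.Perm ι, Equiv.Perm.sign τ = 1 ∧ τ i = j ∧ τ j = k ∧ τ k = i ∧
      ∀ l, l ≠ i → l ≠ j → l ≠ k → τ l = l := by
  refine ⟨Equiv.swap i j * Equiv.swap j k, ?_, ?_, ?_, ?_, fun l hi hj hk => ?_⟩
  · rw [Equiv.Perm.sign_mul, Equiv.Perm.sign_swap hij, Equiv.Perm.sign_swap hjk, neg_mul_neg,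
      one_mul]
  · simp [Equiv.swap_apply_of_ne_of_ne hij hik]
  · simp [Equiv.swap_apply_of_ne_of_ne hik.symm hjk.symm]
  · simp
  · simp [Equiv.swap_apply_of_ne_of_ne, hi, hj, hk]

/-- The factors `R(a_0, a_1), R(a_2, a_3), ...` of the product of curvatures. -/
def RConnection.curvatureFactors (D : RConnection ρ G) (p : ℕ) (a : Fin (2 * p) → L) :
    Fin p → Module.End C G :=
  fun i => D.curvature (a ⟨2 * i, by omega⟩) (a ⟨2 * i + 1, by omega⟩)

theorem RConnection.curvatureFactors_update_even (D : RConnection ρ G) (a : Fin (2 * p) → L)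
    (l : Fin p) (x : L) :
    D.curvatureFactors p (Function.update a ⟨2 * l, by omega⟩ x) =
      Function.update (D.curvatureFactors p a) l (D.curvature x (a ⟨2 * l + 1, by omega⟩)) := by
  funext i
  rcases eq_or_ne i l with rfl | hi
  · simp [curvatureFactors]
  · have : (i : ℕ) ≠ l := fun h => hi (Fin.ext h)
    rw [Function.update_of_ne hi]
    simp only [curvatureFactors]
    rw [Function.update_of_ne, Function.update_of_ne] <;> simp only [ne_eq, Fin.mk.injEq] <;> omega

theorem RConnection.curvatureFactors_update_odd (D : RConnection ρ G) (a : Fin (2 * p) → L)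
    (l : Fin p) (x : L) :
    D.curvatureFactors p (Function.update a ⟨2 * l + 1, by omega⟩ x) =
      Function.update (D.curvatureFactors p a) l (D.curvature (a ⟨2 * l, by omega⟩) x) := by
  funext i
  rcases eq_or_ne i l with rfl | hi
  · simp [curvatureFactors]
  · have : (i : ℕ) ≠ l := fun h => hi (Fin.ext h)
    rw [Function.update_of_ne hi]
    simp only [curvatureFactors]
    rw [Function.update_of_ne, Function.update_of_ne] <;> simp only [ne_eq, Fin.mk.injEq] <;> omega

variable [SMulCommClass C ℝ G] [IsScalarTower ℝ C G]

/-- The multilinear map `(φ_1, ..., φ_p) ↦ c Tr(φ_1 ∘ ⋯ ∘ φ_p)`. -/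
def traceProd (Tr : Module.End C G →ₗ[ℝ] C) (c : ℝ) (p : ℕ) :
    MultilinearMap ℝ (fun _ : Fin p => Module.End C G) C :=
  c • Tr.compMultilinearMap (MultilinearMap.mkPiAlgebraFin ℝ p (Module.End C G))

theorem traceProd_apply (Tr : Module.End C G →ₗ[ℝ] C) (c : ℝ) (g : Fin p → Module.End C G) :
    traceProd Tr c p g = c • Tr (List.ofFn g).prod := by
  simp [traceProd]

theorem RConnection.halfLieDeriv_traceProd (Tr : Module.End C G →ₗ[ℝ] C) (c : ℝ)
    (D : RConnection ρ G) (hTr : ∀ a φ, Tr ((D.isCDO a).commutator φ) = ρ a (Tr φ)) (x : L)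
    (v : Fin (2 * p) → L) :
    halfLieDeriv ρ x (fun v => traceProd Tr c p (D.curvatureFactors p v)) v =
      ∑ l : Fin p, traceProd Tr c p (Function.update (D.curvatureFactors p v) l
        (D.halfLieCurvature x (v ⟨2 * l, by omega⟩) (v ⟨2 * l + 1, by omega⟩))) := by
  have h_leibniz (g : Fin p → Module.End C G) : ρ x (traceProd Tr c p g) =
      ∑ l, traceProd Tr c p (Function.update g l ((D.isCDO x).commutator (g l))) := by
    simp only [traceProd_apply, Derivation.map_smul, ← hTr, IsCDO.commutator_prod, map_sum,
      Finset.smul_sum]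
  rw [halfLieDeriv, h_leibniz, sum_fin_two_mul, Finset.smul_sum, ← Finset.sum_sub_distrib]
  refine Finset.sum_congr rfl fun l _ => ?_
  rw [curvatureFactors_update_even, curvatureFactors_update_odd, halfLieCurvature,
    MultilinearMap.map_update_sub, MultilinearMap.map_update_smul, MultilinearMap.map_update_add]
  rfl

variable [SMulCommClass ℝ C G]

theorem RConnection.chernForm_apply (Tr : Module.End C G →ₗ[ℝ] C) (D : RConnection ρ G)
    (a : Fin (2 * p) → L) : D.chernForm Tr p a =
      altSum (fun b => traceProd Tr (1 / 2 ^ p) p (D.curvatureFactors p b)) a := by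
  have h : D.chernForm Tr p a = Tr (D.curvaturePow p a) := rfl
  rw [h, curvaturePow, AlternatingMap.smul_apply, MultilinearMap.alternatization_apply, map_smul,
    map_sum]
  simp only [altSum, traceProd_apply, Finset.smul_sum, Units.smul_def, map_zsmul,
    smul_comm (1 / 2 ^ p : ℝ)]
  rfl

theorem RConnection.altSum_halfLieCurvature {N : Type*} [AddCommGroup N] [Module ℝ N]
    (P : MultilinearMap ℝ (fun _ : Fin p => Module.End C G) N) (D : RConnection ρ G) (l : Fin p)
    (a : Fin (2 * p + 1) → L) :
    altSum (fun b => P (Function.update (D.curvatureFactors p (Fin.tail b)) l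
      (D.halfLieCurvature (b 0) (Fin.tail b ⟨2 * l, by omega⟩)
        (Fin.tail b ⟨2 * l + 1, by omega⟩)))) a = 0 := by
  let y : Fin (2 * p + 1) := Fin.succ ⟨2 * l, by omega⟩
  let z : Fin (2 * p + 1) := Fin.succ ⟨2 * l + 1, by omega⟩
  have hy : y ≠ 0 := Fin.succ_ne_zero _
  have hz : z ≠ 0 := Fin.succ_ne_zero _
  have hyz : y ≠ z := by simp [y, z]
  obtain ⟨τ, hτ, τ_zero, τ_y, τ_z, τ_of_ne⟩ :=
    exists_threeCycle hy.symm hyz hz.symm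
  have h_factors (b : Fin (2 * p + 1) → L) (φ : Module.End C G) :
      Function.update (D.curvatureFactors p (Fin.tail (b ∘ τ))) l φ =
        Function.update (D.curvatureFactors p (Fin.tail b)) l φ := by
    funext i
    rcases eq_or_ne i l with rfl | hi
    · simp
    · have : (i : ℕ) ≠ l := fun h => hi (Fin.ext h)
      rw [Function.update_of_ne hi, Function.update_of_ne hi]
      simp only [curvatureFactors, Fin.tail, Function.comp_apply]
      rw [τ_of_ne, τ_of_ne] <;>
        simp only [ne_eq, Fin.ext_iff, Fin.val_succ, Fin.val_zero, y, z] <;> omega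
  have : IsAddTorsionFree N := .of_isTorsionFree ℝ N
  refine altSum_eq_zero_of_cyclic hτ (fun b => ?_) a
  simp only [← Function.comp_assoc, h_factors]
  change P (Function.update _ l (D.halfLieCurvature (b 0) (b y) (b z))) +
    P (Function.update _ l (D.halfLieCurvature (b (τ 0)) (b (τ y)) (b (τ z)))) +
    P (Function.update _ l (D.halfLieCurvature (b (τ (τ 0))) (b (τ (τ y))) (b (τ (τ z))))) = 0
  rw [τ_zero, τ_y, τ_z, τ_zero, ← MultilinearMap.map_update_add,
    ← MultilinearMap.map_update_add, D.halfLieCurvature_cyclic, MultilinearMap.map_update_zero]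

theorem RConnection.differential_chernForm (Tr : Module.End C G →ₗ[ℝ] C) (D : RConnection ρ G)
    (hTr : ∀ a φ, Tr ((D.isCDO a).commutator φ) = ρ a (Tr φ)) (p : ℕ) :
    differential ρ (D.chernForm Tr p) = 0 := by
  ext a
  rw [differential_of_eq_altSum ρ _ _ (D.chernForm_apply Tr)]
  simp only [D.halfLieDeriv_traceProd Tr _ hTr, altSum_sum, altSum_halfLieCurvature,
    Finset.sum_const_zero, AlternatingMap.zero_apply]

end ChernFormClosed

section Trace

variable {C G : Type*} [CommRing C] [AddCommGroup G] [Module C G]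

theorem smul_eq_sum_smulRight {n : ℕ} {ψ : C} {e : Fin n → G} {c : Fin n → G →ₗ[C] C}
    (h : ∀ s, ψ • s = ∑ i, c i s • e i) (φ : Module.End C G) :
    ψ • φ = ∑ i, (c i).smulRight (φ (e i)) := by
  ext s
  rw [LinearMap.smul_apply, ← map_smul, h, map_sum, LinearMap.sum_apply]
  simp only [map_smul, LinearMap.smulRight_apply]

variable [Algebra ℝ C] [Module ℝ G] {ℓ : Module.End ℝ G} {X : Derivation ℝ C C}

/-- The covariant differential operator `α ↦ X ∘ α - α ∘ ℓ` which `ℓ` induces on `C`-linear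
functionals. -/
def IsCDO.dual (h : IsCDO ℓ X) (α : G →ₗ[C] C) : G →ₗ[C] C where
  toFun s := X (α s) - α (ℓ s)
  map_add' s t := by simp only [map_add]; abel
  map_smul' f s := by
    simp only [map_smul, h _ _, map_add, RingHom.id_apply, smul_eq_mul, Derivation.leibniz]
    ring

theorem IsCDO.commutator_smulRight (h : IsCDO ℓ X) (α : G →ₗ[C] C) (s : G) :
    h.commutator (α.smulRight s) = (h.dual α).smulRight s + α.smulRight (ℓ s) := by
  ext r
  simp only [commutator_apply, LinearMap.smulRight_apply, LinearMap.add_apply, h _ _, dual,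
    LinearMap.coe_mk, AddHom.coe_mk, sub_smul]
  abel

theorem IsCDO.commutator_smul (h : IsCDO ℓ X) (f : C) (φ : Module.End C G) :
    h.commutator (f • φ) = f • h.commutator φ + X f • φ := by
  ext r
  simp only [commutator_apply, LinearMap.add_apply, LinearMap.smul_apply, h _ _, smul_sub]
  abel

variable {V H M : Type*} [NormedAddCommGroup V] [NormedSpace ℝ V] [TopologicalSpace H]
  {I : ModelWithCorners ℝ V H} [TopologicalSpace M] [ChartedSpace H M]

/-- Evaluation of smooth functions at a point, as a linear functional. -/
def evalAt (x : M) : C^∞⟮I, M; ℝ⟯ →ₗ[ℝ] ℝ :=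
  LinearMap.proj x ∘ₗ ContMDiffMap.coeFnLinearMap

theorem evalAt_apply (f : C^∞⟮I, M; ℝ⟯) (x : M) : evalAt x f = f x :=
  rfl

theorem sum_contMDiffMap_apply {ι : Type*} (t : Finset ι) (f : ι → C^∞⟮I, M; ℝ⟯) (x : M) :
    (∑ i ∈ t, f i) x = ∑ i ∈ t, f i x :=
  map_sum (evalAt x) f t

variable [FiniteDimensional ℝ V] [IsManifold I ∞ M] [T2Space M]
  {F : Type*} [NormedAddCommGroup F] [NormedSpace ℝ F] [FiniteDimensional ℝ F] {E : M → Type*}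
  [TopologicalSpace (TotalSpace F E)] [∀ x, AddCommGroup (E x)] [∀ x, Module ℝ (E x)]
  [∀ x, TopologicalSpace (E x)] [FiberBundle F E] [VectorBundle ℝ F E]
  [ContMDiffVectorBundle ∞ F E I]

theorem fiberTrace_apply (φ : Module.End C^∞⟮I, M; ℝ⟯ Cₛ^∞⟮I; F, E⟯) (x : M) :
    fiberTrace φ x = LinearMap.trace ℝ (E x) (fiberMap φ x) :=
  rfl

theorem fiberTrace_smul (f : C^∞⟮I, M; ℝ⟯) (φ : Module.End C^∞⟮I, M; ℝ⟯ Cₛ^∞⟮I; F, E⟯) :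
    fiberTrace (f • φ) = f * fiberTrace φ := by
  ext x
  have h : fiberMap (f • φ) x = f x • fiberMap φ x :=
    fiberMap_unique fun s => by simp [fiberMap_apply]
  rw [fiberTrace_apply, h, map_smul]
  rfl

theorem exists_localized_dual_frame (x₀ : M) :
    ∃ (n : ℕ) (ψ : C^∞⟮I, M; ℝ⟯) (e : Fin n → Cₛ^∞⟮I; F, E⟯)
      (c : Fin n → Cₛ^∞⟮I; F, E⟯ →ₗ[C^∞⟮I, M; ℝ⟯] C^∞⟮I, M; ℝ⟯)
      (c₀ : Fin n → Module.Dual ℝ (E x₀)), (∀ s, ψ • s = ∑ i, c i s • e i) ∧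
      (∀ᶠ x in 𝓝 x₀, ψ x = 1) ∧ ∀ i (s : Cₛ^∞⟮I; F, E⟯), c i s x₀ = c₀ i (s x₀) := by
  obtain ⟨n, ψ, e, c, hc, h_frame, hψ⟩ := exists_local_frame I F E x₀
  let c' (i : Fin n) : Cₛ^∞⟮I; F, E⟯ →ₗ[C^∞⟮I, M; ℝ⟯] C^∞⟮I, M; ℝ⟯ :=
    { toFun s := ⟨fun y => c i y (s y), (hc i).comp s.contMDiff⟩
      map_add' s t := by ext y; exact map_add (c i y) (s y) (t y)
      map_smul' f s := by ext y; exact map_smul (c i y) (f y) (s y) }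
  refine ⟨n, ψ, e, c', fun i => c i x₀, fun s => ?_, hψ, fun i s => rfl⟩
  ext y
  rw [sum_section_apply]
  exact h_frame y (s y)

theorem exists_fiber_functional (α : Cₛ^∞⟮I; F, E⟯ →ₗ[C^∞⟮I, M; ℝ⟯] C^∞⟮I, M; ℝ⟯) (x : M) :
    ∃ f : Module.Dual ℝ (E x), ∀ s : Cₛ^∞⟮I; F, E⟯, f (s x) = α s x := by
  obtain ⟨n, ψ, e, c, c₀, h_frame, hψ, hc₀⟩ :=
    exists_localized_dual_frame (I := I) (F := F) (E := E) x
  refine ⟨∑ i, α (e i) x • c₀ i, fun s => ?_⟩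
  have h := congrArg (fun r => α r x) (h_frame s)
  simp only [map_smul, map_sum, sum_contMDiffMap_apply, smul_eq_mul, ContMDiffMap.coe_mul,
    Pi.mul_apply, hψ.self_of_nhds, one_mul, hc₀] at h
  simp [h, mul_comm]

theorem fiberTrace_smulRight (α : Cₛ^∞⟮I; F, E⟯ →ₗ[C^∞⟮I, M; ℝ⟯] C^∞⟮I, M; ℝ⟯)
    (s : Cₛ^∞⟮I; F, E⟯) : fiberTrace (α.smulRight s) = α s := by
  ext x
  have : FiniteDimensional ℝ (E x) := VectorBundle.finiteDimensional ℝ F E x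
  obtain ⟨f, hf⟩ := exists_fiber_functional α x
  have h : fiberMap (α.smulRight s) x = f.smulRight (s x) :=
    fiberMap_unique fun r => by simp [hf]
  rw [fiberTrace_apply, h, LinearMap.trace_smulRight, hf]

theorem fiberTrace_commutator {ℓ : Module.End ℝ Cₛ^∞⟮I; F, E⟯} {X : VectorFields I M}
    (h : IsCDO ℓ (vectorFieldDerivation X)) (φ : Module.End C^∞⟮I, M; ℝ⟯ Cₛ^∞⟮I; F, E⟯) :
    fiberTrace (h.commutator φ) = vectorFieldDerivation X (fiberTrace φ) := by
  ext x
  obtain ⟨n, ψ, e, c, -, h_frame, hψ, -⟩ :=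
    exists_localized_dual_frame (I := I) (F := F) (E := E) x
  have h_localized :
      fiberTrace (h.commutator (ψ • φ)) = vectorFieldDerivation X (fiberTrace (ψ • φ)) := by
    simp only [smul_eq_sum_smulRight h_frame, map_sum, h.commutator_smulRight, map_add,
      fiberTrace_smulRight]
    exact Finset.sum_congr rfl fun i _ => sub_add_cancel _ _
  have hψ_deriv : vectorFieldDerivation X ψ x = 0 := by
    have hψ' : (ψ : M → ℝ) =ᶠ[𝓝 x] fun _ => 1 := hψ
    rw [vectorFieldDerivation_apply, hψ'.mfderiv_eq, mfderiv_const]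
    rfl
  rw [h.commutator_smul, map_add, fiberTrace_smul, fiberTrace_smul, fiberTrace_smul,
    Derivation.leibniz] at h_localized
  have h_apply := congrArg (fun f : C^∞⟮I, M; ℝ⟯ => f x) h_localized
  simp only [ContMDiffMap.coe_add, ContMDiffMap.coe_mul, Pi.add_apply, Pi.mul_apply, hψ_deriv,
    smul_eq_mul, hψ.self_of_nhds] at h_apply
  linarith

end Trace

section Shear

variable {R L N : Type*} [CommRing R] [AddCommGroup L] [Module R L] [AddCommGroup N] [Module R N]
  {n : ℕ}

theorem map_cons_add_smul (g : L [⋀^Fin (n + 1)]→ₗ[R] N) (x : L) (w : Fin n → L) (c : Fin n → R) :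
    g (Matrix.vecCons x (w + fun i => c i • x)) = g (Matrix.vecCons x w) := by
  classical
  refine ((g.curryLeft x).toMultilinearMap.map_add_univ w (fun i => c i • x)).trans ?_
  rw [Finset.sum_eq_single Finset.univ _ (by simp), Finset.piecewise_univ]
  · rfl
  · intro s _ hs
    obtain ⟨i, hi⟩ : ∃ i, i ∉ s := by
      by_contra! h
      exact hs (Finset.eq_univ_iff_forall.2 h)
    have h_update : s.piecewise w (fun i => c i • x) =
        Function.update (s.piecewise w (fun i => c i • x)) i (c i • x) := by
      rw [Function.eq_update_iff]
      simp [hi]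
    change g.curryLeft x _ = 0
    rw [h_update, AlternatingMap.map_update_smul, AlternatingMap.curryLeft_apply_apply,
      g.map_eq_zero_of_eq _ (i := 0) (j := i.succ) (by simp) (Fin.succ_ne_zero i).symm, smul_zero]

theorem map_succ_sub_zero (g : L [⋀^Fin n]→ₗ[R] N) (e : Fin (n + 1) → L) :
    g (fun i => e i.succ - e 0) = ∑ j : Fin (n + 1), (-1 : ℤ) ^ (j : ℕ) • g (j.removeNth e) := by
  -- `Θ` is constant along the shear of `L × R` by multiples of the first vertex `(e 0, 1)`.
  let Θ : (L × R) [⋀^Fin (n + 1)]→ₗ[R] N := AlternatingMap.alternatizeUncurryFin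
    ((LinearMap.snd R L R).smulRight (g.compLinearMap (LinearMap.fst R L R)))
  have hΘ (w : Fin (n + 1) → L × R) : Θ w =
      ∑ j : Fin (n + 1), (-1 : ℤ) ^ (j : ℕ) • (w j).2 • g (fun i => (j.removeNth w i).1) :=
    AlternatingMap.alternatizeUncurryFin_apply _ _
  have h_vertices : Θ (fun i => (e i, 1)) =
      ∑ j : Fin (n + 1), (-1 : ℤ) ^ (j : ℕ) • g (j.removeNth e) := by
    simp only [hΘ, one_smul]
    rfl
  have h_edges : Θ (Matrix.vecCons (e 0, 1) fun i => (e i.succ - e 0, 0)) =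
      g (fun i => e i.succ - e 0) := by
    simp [hΘ, Fin.sum_univ_succ, Matrix.vecCons, Fin.removeNth]
  rw [← h_edges, ← h_vertices]
  refine Eq.trans ?_ (congrArg Θ (Matrix.cons_head_tail fun i => (e i, (1 : R))))
  rw [← map_cons_add_smul Θ _ (Matrix.vecTail _) fun _ => -1]
  congr 2
  funext i
  simp [Matrix.vecHead, Matrix.vecTail, sub_eq_add_neg]

end Shear

section DerivativeUnderIntegral

open MeasureTheory

theorem hasFDerivAt_setIntegral_of_isCompact {T V G : Type*} [NormedAddCommGroup T]
    [NormedSpace ℝ T] [MeasurableSpace T] [BorelSpace T] {μ : Measure T}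
    [IsFiniteMeasureOnCompacts μ] [NormedAddCommGroup V] [NormedSpace ℝ V] [ProperSpace V]
    [NormedAddCommGroup G] [NormedSpace ℝ G] {K : Set T} (hK : IsCompact K) {U : Set V}
    (hU : IsOpen U) {g : T × V → G} (hg : ∀ t ∈ K, ∀ y ∈ U, ContDiffAt ℝ 1 g (t, y)) {y₀ : V}
    (hy₀ : y₀ ∈ U) :
    IntegrableOn (fun t => fderiv ℝ (fun y => g (t, y)) y₀) K μ ∧
      HasFDerivAt (fun y => ∫ t in K, g (t, y) ∂μ)
        (∫ t in K, fderiv ℝ (fun y => g (t, y)) y₀ ∂μ) y₀ := by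
  let g' (y : V) (t : T) : V →L[ℝ] G := (fderiv ℝ g (t, y)).comp (.inr ℝ T V)
  have hg_deriv : ∀ t ∈ K, ∀ y ∈ U, HasFDerivAt (fun y => g (t, y)) (g' y t) y := fun t ht y hy =>
    ((hg t ht y hy).differentiableAt one_ne_zero).hasFDerivAt.comp y (hasFDerivAt_prodMk_right t y)
  have hg'_cont : ∀ t ∈ K, ∀ y ∈ U, ContinuousAt (fun q : T × V => g' q.2 q.1) (t, y) :=
    fun t ht y hy =>
      ((hg t ht y hy).fderiv_right (m := 0) (by simp)).continuousAt.clm_comp continuousAt_const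
  have hg_cont (y : V) (hy : y ∈ U) : ContinuousOn (fun t => g (t, y)) K := fun t ht =>
    ((hg t ht y hy).continuousAt.comp (f := fun t => (t, y)) (by fun_prop)).continuousWithinAt
  have hg'_contOn : ContinuousOn (g' y₀) K := fun t ht =>
    ((hg'_cont t ht y₀ hy₀).comp (f := fun t => (t, y₀)) (by fun_prop)).continuousWithinAt
  have h_fderiv : Set.EqOn (fun t => fderiv ℝ (fun y => g (t, y)) y₀) (g' y₀) K :=
    fun t ht => (hg_deriv t ht y₀ hy₀).fderiv
  obtain ⟨r, hr, hrU⟩ := Metric.nhds_basis_closedBall.mem_iff.1 (hU.mem_nhds hy₀)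
  obtain ⟨B, hB⟩ := (hK.prod (isCompact_closedBall y₀ r)).exists_bound_of_continuousOn
    fun q hq => (hg'_cont q.1 hq.1 q.2 (hrU hq.2)).continuousWithinAt
  rw [setIntegral_congr_fun hK.measurableSet h_fderiv,
    integrableOn_congr_fun h_fderiv hK.measurableSet]
  refine ⟨hg'_contOn.integrableOn_compact hK,
    hasFDerivAt_integral_of_dominated_of_fderiv_le (bound := fun _ => B) (F' := g')
      (Metric.closedBall_mem_nhds y₀ hr) ?_ ((hg_cont y₀ hy₀).integrableOn_compact hK)
      (hg'_contOn.aestronglyMeasurable_of_isCompact hK hK.measurableSet) ?_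
      (integrableOn_const hK.measure_lt_top.ne) ?_⟩
  · filter_upwards [hU.mem_nhds hy₀] with y hy
    exact (hg_cont y hy).aestronglyMeasurable_of_isCompact hK hK.measurableSet
  · filter_upwards [ae_restrict_mem hK.measurableSet] with t ht y hy using hB (t, y) ⟨ht, hy⟩
  · filter_upwards [ae_restrict_mem hK.measurableSet] with t ht y hy
    exact hg_deriv t ht y (hrU hy)

variable {k : ℕ} {V : Type*} [NormedAddCommGroup V] [NormedSpace ℝ V] [FiniteDimensional ℝ V]
  {M : Type*} [TopologicalSpace M] [ChartedSpace V M] [IsManifold 𝓘(ℝ, V) ∞ M]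
  [T2Space M]

theorem vectorFieldDerivation_integrateSimplex (X : VectorFields 𝓘(ℝ, V) M)
    (f : C^∞⟮𝓘(ℝ, Fin k → ℝ).prod 𝓘(ℝ, V), (Fin k → ℝ) × M; ℝ⟯) :
    vectorFieldDerivation X (integrateSimplex f) =
      integrateSimplex (vectorFieldDerivation (prodVectorField 0 X) f) := by
  have : ProperSpace V := FiniteDimensional.proper ℝ V
  ext x
  let g (q : (Fin k → ℝ) × V) : ℝ := f (q.1, (extChartAt 𝓘(ℝ, V) x).symm q.2)
  obtain ⟨h_int, h_deriv⟩ := hasFDerivAt_setIntegral_of_isCompact (μ := volume) (g := g)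
    (isCompact_simplex k) (isOpen_extChartAt_target (I := 𝓘(ℝ, V)) x)
    (fun t _ y hy => (contDiffAt_chart f t x hy).of_le (by simp)) (mem_extChartAt_target x)
  calc vectorFieldDerivation X (integrateSimplex f) x
      = fderiv ℝ (fun y => ∫ t in simplex k, g (t, y)) (extChartAt 𝓘(ℝ, V) x x) (X x) :=
        mfderiv_eq_fderiv_chart (integrateSimplex f).mdifferentiableAt (X x)
    _ = ∫ t in simplex k, fderiv ℝ (fun y => g (t, y)) (extChartAt 𝓘(ℝ, V) x x) (X x) := by
        rw [h_deriv.fderiv]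
        exact ContinuousLinearMap.integral_apply h_int (X x : V)
    _ = ∫ t in simplex k, vectorFieldDerivation (prodVectorField 0 X) f (t, x) := by
        congr 1
        funext t
        rw [prodVectorField_zero_left]
        exact (mfderiv_eq_fderiv_chart (slice f t).mdifferentiableAt (X x)).symm

end DerivativeUnderIntegral

section Stokes

open MeasureTheory

variable {k : ℕ} {G : Type*} [NormedAddCommGroup G]

theorem insertNth_mem_simplex_iff (i : Fin (k + 1)) (x : ℝ) (r : Fin k → ℝ) :
    (i.insertNth x r : Fin (k + 1) → ℝ) ∈ simplex (k + 1) ↔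
      r ∈ simplex k ∧ x ∈ Set.Icc 0 (1 - ∑ j, r j) := by
  simp only [simplex, Set.mem_ofPred_eq, Set.mem_Icc, Fin.forall_iff_succAbove i,
    Fin.sum_univ_succAbove _ i, Fin.insertNth_apply_same, Fin.insertNth_apply_succAbove]
  constructor
  · rintro ⟨⟨hx, hr⟩, h_sum⟩
    exact ⟨⟨hr, by linarith⟩, hx, by linarith⟩
  · rintro ⟨⟨hr, -⟩, hx, h_sum⟩
    exact ⟨⟨hx, hr⟩, by linarith⟩

theorem indicator_simplex_insertNth (i : Fin (k + 1)) (f : (Fin (k + 1) → ℝ) → G) (x : ℝ)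
    (r : Fin k → ℝ) :
    (simplex (k + 1)).indicator f (i.insertNth x r) = (simplex k).indicator
      (fun r => (Set.Icc 0 (1 - ∑ j, r j)).indicator (fun x => f (i.insertNth x r)) x) r := by
  classical
  simp only [Set.indicator_apply, insertNth_mem_simplex_iff, ite_and]

variable [NormedSpace ℝ G]

theorem integral_simplex_succ (i : Fin (k + 1)) {f : (Fin (k + 1) → ℝ) → G} (hf : Continuous f) :
    ∫ t in simplex (k + 1), f t =
      ∫ r in simplex k, ∫ x in (0 : ℝ)..(1 - ∑ j, r j), f (i.insertNth x r) := by
  have h_meas := (isCompact_simplex (k + 1)).measurableSet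
  have h_meas' := (isCompact_simplex k).measurableSet
  let e : ℝ × (Fin k → ℝ) ≃ᵐ (Fin (k + 1) → ℝ) :=
    (MeasurableEquiv.piFinSuccAbove (fun _ => ℝ) i).symm
  have he : MeasurePreserving e :=
    (volume_preserving_piFinSuccAbove (fun _ : Fin (k + 1) => ℝ) i).symm _
  have h_int : Integrable ((simplex (k + 1)).indicator f) :=
    (integrable_indicator_iff h_meas).2
      (hf.continuousOn.integrableOn_compact (isCompact_simplex _))
  calc ∫ t in simplex (k + 1), f t
      = ∫ q : ℝ × (Fin k → ℝ), (simplex (k + 1)).indicator f (i.insertNth q.1 q.2) := by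
        rw [← integral_indicator h_meas, ← he.integral_comp e.measurableEmbedding]
        rfl
    _ = ∫ r : Fin k → ℝ, ∫ x : ℝ, (simplex (k + 1)).indicator f (i.insertNth x r) :=
        integral_prod_symm _ ((he.integrable_comp_emb e.measurableEmbedding).2 h_int)
    _ = ∫ r in simplex k, ∫ x in (0 : ℝ)..(1 - ∑ j, r j), f (i.insertNth x r) := by
        rw [← integral_indicator h_meas']
        congr 1
        funext r
        simp only [indicator_simplex_insertNth]
        by_cases hr : r ∈ simplex k
        · simp only [Set.indicator_of_mem hr]
          rw [integral_indicator measurableSet_Icc, integral_Icc_eq_integral_Ioc,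
            intervalIntegral.integral_of_le (sub_nonneg.2 hr.2)]
        · simp only [Set.indicator_of_notMem hr, integral_zero]

theorem integral_slanted_face (i : Fin (k + 1)) {f : (Fin (k + 1) → ℝ) → G} (hf : Continuous f) :
    ∫ s in simplex k, f (i.insertNth (1 - ∑ j, s j) s) =
      ∫ s in simplex k, f (Fin.cons (1 - ∑ j, s j) s) := by
  refine Fin.cases (by simp only [Fin.insertNth_zero']) (fun i => ?_) i
  cases k with
  | zero => exact i.elim0
  | succ k =>
    have h_cont (l : Fin (k + 2)) :
        Continuous fun s : Fin (k + 1) → ℝ => f (l.insertNth (1 - ∑ j, s j) s) :=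
      hf.comp (by fun_prop)
    have h_sum (l : Fin (k + 1)) (y : ℝ) (r : Fin k → ℝ) :
        ∑ j, (l.insertNth y r : Fin (k + 1) → ℝ) j = y + ∑ j, r j := by
      simp [Fin.sum_univ_succAbove _ l]
    -- Fixing all coordinates but `0` and `i`, the two parametrizations differ by a reflection.
    have h_reflect (r : Fin k → ℝ) (x : ℝ) :
        (i.succ.insertNth (1 - ∑ j, (Fin.insertNth 0 x r : Fin (k + 1) → ℝ) j)
          (Fin.insertNth 0 x r) : Fin (k + 2) → ℝ) =
        Fin.insertNth 0 (1 - ∑ j, (i.insertNth ((1 - ∑ j, r j) - x) r : Fin (k + 1) → ℝ) j)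
          (i.insertNth ((1 - ∑ j, r j) - x) r) := by
      rw [h_sum, h_sum, Fin.insertNth_zero', Fin.insertNth_zero', Fin.insertNth_succ_cons]
      congr 2 <;> ring
    simp only [← Fin.insertNth_zero']
    rw [integral_simplex_succ 0 (h_cont i.succ), integral_simplex_succ i (h_cont 0)]
    congr 1
    funext r
    simp only [h_reflect]
    rw [intervalIntegral.integral_comp_sub_left (fun y => f (Fin.insertNth 0 (1 - ∑ j,
      (i.insertNth y r : Fin (k + 1) → ℝ) j) (i.insertNth y r))), sub_self, sub_zero]

theorem hasDerivAt_insertNth (j : Fin (k + 1)) (r : Fin k → ℝ) (x : ℝ) :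
    HasDerivAt (fun x : ℝ => (j.insertNth x r : Fin (k + 1) → ℝ)) (Pi.single j 1) x := by
  rw [hasDerivAt_pi]
  refine fun i => Fin.succAboveCases j ?_ (fun i => ?_) i
  · simpa using hasDerivAt_id' x
  · simpa using hasDerivAt_const x (r i)

theorem integral_simplex_fderiv_single [CompleteSpace G] (j : Fin (k + 1))
    {f : (Fin (k + 1) → ℝ) → G} (hf : ContDiff ℝ 1 f) :
    ∫ t in simplex (k + 1), fderiv ℝ f t (Pi.single j 1) =
      (∫ s in simplex k, f (Fin.cons (1 - ∑ i, s i) s)) -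
        ∫ s in simplex k, f (j.insertNth 0 s) := by
  have h_cont : Continuous fun t => fderiv ℝ f t (Pi.single j 1) :=
    (hf.continuous_fderiv one_ne_zero).clm_apply continuous_const
  have h_slanted : Continuous fun s : Fin k → ℝ => f (j.insertNth (1 - ∑ i, s i) s) :=
    hf.continuous.comp (by fun_prop)
  have h_coord : Continuous fun s : Fin k → ℝ => f (j.insertNth 0 s) :=
    hf.continuous.comp (by fun_prop)
  rw [integral_simplex_succ j h_cont, ← integral_slanted_face j hf.continuous, ← integral_sub
    (h_slanted.continuousOn.integrableOn_compact (isCompact_simplex k))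
    (h_coord.continuousOn.integrableOn_compact (isCompact_simplex k))]
  congr 1
  funext r
  refine intervalIntegral.integral_eq_sub_of_hasDerivAt (fun x _ =>
    (hf.differentiable one_ne_zero _).hasFDerivAt.comp_hasDerivAt x (hasDerivAt_insertNth j r x)) ?_
  exact (h_cont.comp (by fun_prop : Continuous fun x : ℝ =>
    (j.insertNth x r : Fin (k + 1) → ℝ))).intervalIntegrable _ _

end Stokes

section Faces

open MeasureTheory

theorem neg_one_pow_zsmul (R : Type*) {N : Type*} [Ring R] [AddCommGroup N] [Module R N] (k : ℕ)
    (y : N) : (-1 : ℤ) ^ k • y = (-1 : R) ^ k • y := by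
  simp [← Int.cast_smul_eq_zsmul R]

variable {k : ℕ}

/-- The barycentric coordinates of a point of `ℝ^k` with respect to the vertices of the standard
simplex. -/
def barycentric (s : Fin k → ℝ) : Fin (k + 1) → ℝ := Fin.cons (1 - ∑ i, s i) s

/-- The affine map `ℝ^k → ℝ^(k+1)` inserting a zero as the `j`-th barycentric coordinate. It
parametrizes the `j`-th face of the standard simplex by the standard simplex of dimension `k`. -/
def faceMap (j : Fin (k + 2)) (s : Fin k → ℝ) : Fin (k + 1) → ℝ :=
  fun i => (j.insertNth 0 (barycentric s) : Fin (k + 2) → ℝ) i.succ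

/-- The linear part of `faceMap j`: it inserts a zero as the `j`-th entry of the derivative
`(-∑ v_i, v_1, …, v_k)` of the barycentric coordinates in the direction `v`. -/
def faceLin (j : Fin (k + 2)) : (Fin k → ℝ) →L[ℝ] (Fin (k + 1) → ℝ) :=
  ContinuousLinearMap.pi fun i => (j.insertNth 0
    (Fin.cons (-∑ i, ContinuousLinearMap.proj i) ContinuousLinearMap.proj) :
      Fin (k + 2) → ((Fin k → ℝ) →L[ℝ] ℝ)) i.succ

theorem barycentric_faceMap (j : Fin (k + 2)) (s : Fin k → ℝ) :
    barycentric (faceMap j s) = j.insertNth 0 (barycentric s) := by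
  have hsum : ∑ i, (j.insertNth 0 (barycentric s) : Fin (k + 2) → ℝ) i = 1 := by
    simp [Fin.sum_univ_succAbove _ j, barycentric, Fin.sum_univ_succ]
  rw [Fin.sum_univ_succ] at hsum
  funext i
  refine Fin.cases ?_ (fun i => rfl) i
  simp only [barycentric, Fin.cons_zero, faceMap] at hsum ⊢
  linarith

theorem faceMap_zero (s : Fin k → ℝ) : faceMap 0 s = barycentric s := by
  funext i
  simp [faceMap]

theorem faceMap_succ (j : Fin (k + 1)) (s : Fin k → ℝ) : faceMap j.succ s = j.insertNth 0 s := by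
  funext i
  simp [faceMap, barycentric, Fin.insertNth_succ_cons]

theorem faceMap_eq_add_faceLin (j : Fin (k + 2)) :
    faceMap j = fun s : Fin k → ℝ => faceMap j 0 + faceLin j s := by
  funext s i
  simp only [Pi.add_apply, faceMap, faceLin, ContinuousLinearMap.coe_pi']
  generalize i.succ = l
  refine Fin.succAboveCases j ?_ (fun l => ?_) l
  · simp
  · refine Fin.cases ?_ (fun l => ?_) l <;> simp [barycentric, sub_eq_add_neg]

theorem hasFDerivAt_faceMap (j : Fin (k + 2)) (s : Fin k → ℝ) :
    HasFDerivAt (faceMap j) (faceLin j) s := by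
  rw [faceMap_eq_add_faceLin]
  exact (faceLin j).hasFDerivAt.const_add _

theorem contDiff_faceMap (j : Fin (k + 2)) : ContDiff ℝ ∞ (faceMap (k := k) j) := by
  rw [faceMap_eq_add_faceLin]
  exact contDiff_const.add (faceLin j).contDiff

theorem faceLin_zero_single (i : Fin k) :
    faceLin 0 (Pi.single i 1) = Pi.single i.succ 1 - Pi.single 0 1 := by
  funext l
  refine Fin.cases ?_ (fun l => ?_) l <;> simp [faceLin, Pi.single_apply]

theorem faceLin_succ_single (j : Fin (k + 1)) (i : Fin k) :
    faceLin j.succ (Pi.single i 1) = Pi.single (j.succAbove i) 1 := by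
  funext l
  refine Fin.succAboveCases j ?_ (fun l => ?_) l <;>
    simp [faceLin, Fin.insertNth_succ_cons, Pi.single_apply]

theorem sum_integral_simplex_fderiv_eq_sum_faces {G : Type*} [NormedAddCommGroup G]
    [NormedSpace ℝ G] [CompleteSpace G]
    (α : (Fin (k + 1) → ℝ) → (Fin (k + 1) → ℝ) [⋀^Fin k]→ₗ[ℝ] G)
    (hα : ∀ v, ContDiff ℝ 1 fun t => α t v) :
    ∑ j : Fin (k + 1), (-1 : ℝ) ^ (j : ℕ) • ∫ t in simplex (k + 1),
        fderiv ℝ (fun t => α t (fun i => Pi.single (j.succAbove i) 1)) t (Pi.single j 1) =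
      ∑ j : Fin (k + 2), (-1 : ℝ) ^ (j : ℕ) • ∫ s in simplex k,
        α (faceMap j s) (fun i => faceLin j (Pi.single i 1)) := by
  let c (j : Fin (k + 1)) (t : Fin (k + 1) → ℝ) : G := α t fun i => Pi.single (j.succAbove i) 1
  have integral_fderiv (j : Fin (k + 1)) :
      ∫ t in simplex (k + 1), fderiv ℝ (c j) t (Pi.single j 1) =
        (∫ s in simplex k, c j (faceMap 0 s)) - ∫ s in simplex k, c j (faceMap j.succ s) := by
    simp only [faceMap_zero, faceMap_succ]
    exact integral_simplex_fderiv_single j (hα _)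
  have face_zero : ∫ s in simplex k, α (faceMap 0 s) (fun i => faceLin 0 (Pi.single i 1)) =
      ∑ j : Fin (k + 1), (-1 : ℝ) ^ (j : ℕ) • ∫ s in simplex k, c j (faceMap 0 s) := by
    have integrableOn_c (j : Fin (k + 1)) :
        IntegrableOn (fun s => (-1 : ℝ) ^ (j : ℕ) • c j (faceMap 0 s)) (simplex k) :=
      (((hα _).continuous.comp (contDiff_faceMap 0).continuous).const_smul
        _).continuousOn.integrableOn_compact (isCompact_simplex k)
    simp only [← integral_smul]
    rw [← integral_finsetSum _ fun j _ => integrableOn_c j]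
    congr 1 with s
    simp only [faceLin_zero_single]
    refine (map_succ_sub_zero (α (faceMap 0 s)) fun i => Pi.single i 1).trans ?_
    exact Finset.sum_congr rfl fun j _ => neg_one_pow_zsmul ℝ _ _
  have face_succ (j : Fin (k + 1)) :
      ∫ s in simplex k, α (faceMap j.succ s) (fun i => faceLin j.succ (Pi.single i 1)) =
        ∫ s in simplex k, c j (faceMap j.succ s) := by
    simp only [faceLin_succ_single, c]
  rw [Fin.sum_univ_succ (n := k + 1), face_zero]
  simp only [face_succ, Fin.val_zero, pow_zero, one_smul, Fin.val_succ, pow_succ, mul_neg_one,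
    neg_smul]
  rw [Finset.sum_neg_distrib, ← sub_eq_add_neg, ← Finset.sum_sub_distrib]
  exact Finset.sum_congr rfl fun j _ => by rw [integral_fderiv, smul_sub]

end Faces

section Naturality

theorem map_prod_ofFn_apply {S S' G G' : Type*} [Semiring S] [Semiring S'] [AddCommMonoid G]
    [Module S G] [AddCommMonoid G'] [Module S' G'] {r : G → G'} :
    ∀ {n : ℕ} {g : Fin n → Module.End S G} {g' : Fin n → Module.End S' G'}
      (_ : ∀ i s, r (g i s) = g' i (r s)) (s : G),
      r ((List.ofFn g).prod s) = (List.ofFn g').prod (r s)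
  | 0, _, _, _, _ => by simp
  | n + 1, g, g', h, s => by
    simp only [List.ofFn_succ, List.prod_cons, Module.End.mul_apply, h,
      map_prod_ofFn_apply fun i => h i.succ]

section Curvature

variable {C G L C' G' L' : Type*} [CommRing C] [Algebra ℝ C] [AddCommGroup G] [Module ℝ G]
  [Module C G] [LieRing L] [LieAlgebra ℝ L] {ρ : L →ₗ⁅ℝ⁆ Derivation ℝ C C}
  [CommRing C'] [Algebra ℝ C'] [AddCommGroup G'] [Module ℝ G'] [Module C' G'] [LieRing L']
  [LieAlgebra ℝ L'] {ρ' : L' →ₗ⁅ℝ⁆ Derivation ℝ C' C'} {D : RConnection ρ G}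
  {D' : RConnection ρ' G'} {lam : L' →ₗ⁅ℝ⁆ L} {r : G →+ G'}

theorem RConnection.map_curvature_apply (hr : ∀ a s, r (D.toFun (lam a) s) = D'.toFun a (r s))
    (a b : L') (s : G) : r (D.curvature (lam a) (lam b) s) = D'.curvature a b (r s) := by
  simp only [RConnection.curvature, LinearMap.coe_mk, AddHom.coe_mk, map_sub, hr,
    ← LieHom.map_lie]

end Curvature

variable {V : Type*} [NormedAddCommGroup V] [NormedSpace ℝ V] [FiniteDimensional ℝ V]
  {H : Type*} [TopologicalSpace H]
  {I : ModelWithCorners ℝ V H} {M : Type*} [TopologicalSpace M] [ChartedSpace H M]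
  [IsManifold I ∞ M] [T2Space M]
  {F : Type*} [NormedAddCommGroup F] [NormedSpace ℝ F] [FiniteDimensional ℝ F] {E : M → Type*}
  [TopologicalSpace (TotalSpace F E)] [∀ x, AddCommGroup (E x)] [∀ x, Module ℝ (E x)]
  [∀ x, TopologicalSpace (E x)] [FiberBundle F E] [VectorBundle ℝ F E]
  [ContMDiffVectorBundle ∞ F E I]
  {V' : Type*} [NormedAddCommGroup V'] [NormedSpace ℝ V'] [FiniteDimensional ℝ V']
  {H' : Type*} [TopologicalSpace H']
  {I' : ModelWithCorners ℝ V' H'} {M' : Type*} [TopologicalSpace M'] [ChartedSpace H' M']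
  [IsManifold I' ∞ M'] [T2Space M']
  {F' : Type*} [NormedAddCommGroup F'] [NormedSpace ℝ F'] [FiniteDimensional ℝ F']
  {E' : M' → Type*}
  [TopologicalSpace (TotalSpace F' E')] [∀ x, AddCommGroup (E' x)] [∀ x, Module ℝ (E' x)]
  [∀ x, TopologicalSpace (E' x)] [FiberBundle F' E'] [VectorBundle ℝ F' E']
  [ContMDiffVectorBundle ∞ F' E' I'] {x : M} {x' : M'}

theorem fiberTrace_eq_of_intertwining {r : Cₛ^∞⟮I; F, E⟯ → Cₛ^∞⟮I'; F', E'⟯}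
    (e : E x ≃ₗ[ℝ] E' x') (he : ∀ s, r s x' = e (s x))
    {φ : Module.End C^∞⟮I, M; ℝ⟯ Cₛ^∞⟮I; F, E⟯} {φ' : Module.End C^∞⟮I', M'; ℝ⟯ Cₛ^∞⟮I'; F', E'⟯}
    (hφ : ∀ s, r (φ s) = φ' (r s)) : fiberTrace φ x = fiberTrace φ' x' := by
  have h : fiberMap φ' x' = e.conj (fiberMap φ x) := by
    ext v'
    obtain ⟨v, rfl⟩ := e.surjective v'
    obtain ⟨s, rfl⟩ := exists_section_eq (I := I) (F := F) x v
    rw [LinearEquiv.conj_apply_apply, LinearEquiv.symm_apply_apply, fiberMap_apply, ← he, ← he,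
      fiberMap_apply, hφ]
  rw [fiberTrace_apply, fiberTrace_apply, h, LinearMap.trace_conj']

variable {L L' : Type*} [LieRing L] [LieAlgebra ℝ L] [LieRing L'] [LieAlgebra ℝ L']
  {ρ : L →ₗ⁅ℝ⁆ Derivation ℝ C^∞⟮I, M; ℝ⟯ C^∞⟮I, M; ℝ⟯}
  {ρ' : L' →ₗ⁅ℝ⁆ Derivation ℝ C^∞⟮I', M'; ℝ⟯ C^∞⟮I', M'; ℝ⟯}

theorem RConnection.chernForm_fiberTrace_apply (D : RConnection ρ Cₛ^∞⟮I; F, E⟯) (p : ℕ)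
    (a : Fin (2 * p) → L) : D.chernForm fiberTrace p a x =
      altSum (fun b => (1 / 2 ^ p : ℝ) • fiberTrace (List.ofFn (D.curvatureFactors p b)).prod x)
        a := by
  rw [D.chernForm_apply, ← evalAt_apply, map_altSum]
  simp only [traceProd_apply, map_smul, evalAt_apply]

theorem RConnection.chernForm_eq_of_intertwining {D : RConnection ρ Cₛ^∞⟮I; F, E⟯}
    {D' : RConnection ρ' Cₛ^∞⟮I'; F', E'⟯} {lam : L' →ₗ⁅ℝ⁆ L}
    {r : Cₛ^∞⟮I; F, E⟯ →+ Cₛ^∞⟮I'; F', E'⟯}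
    (hr : ∀ a s, r (D.toFun (lam a) s) = D'.toFun a (r s))
    (e : E x ≃ₗ[ℝ] E' x') (he : ∀ s, r s x' = e (s x)) (p : ℕ) (a : Fin (2 * p) → L') :
    D.chernForm fiberTrace p (lam ∘ a) x = D'.chernForm fiberTrace p a x' := by
  rw [D.chernForm_fiberTrace_apply, D'.chernForm_fiberTrace_apply]
  refine Finset.sum_congr rfl fun σ _ => ?_
  exact congrArg (fun c : ℝ => σ.sign • (1 / 2 ^ p : ℝ) • c) (fiberTrace_eq_of_intertwining e he
    (map_prod_ofFn_apply fun i s => map_curvature_apply hr _ _ s))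

end Naturality

section AffineFaces

theorem weight_faceMap {k : ℕ} {V M : Type*} [NormedAddCommGroup V] [NormedSpace ℝ V]
    [TopologicalSpace M] [ChartedSpace V M] (j i : Fin (k + 2)) (s : Fin k → ℝ) (x : M) :
    weight V M i (faceMap j s, x) =
      (j.insertNth 0 fun l => weight V M l (s, x) : Fin (k + 2) → ℝ) i :=
  congrFun (barycentric_faceMap j s) i

variable {k : ℕ} {V : Type*} [NormedAddCommGroup V] [NormedSpace ℝ V] [FiniteDimensional ℝ V]
  {M : Type*} [TopologicalSpace M] [ChartedSpace V M] [IsManifold 𝓘(ℝ, V) ∞ M] [T2Space M]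
  {FA : Type*} [NormedAddCommGroup FA] [NormedSpace ℝ FA] [FiniteDimensional ℝ FA] {A : M → Type*}
  [TopologicalSpace (TotalSpace FA A)] [∀ x, AddCommGroup (A x)] [∀ x, Module ℝ (A x)]
  [∀ x, TopologicalSpace (A x)] [FiberBundle FA A] [VectorBundle ℝ FA A]
  [ContMDiffVectorBundle ∞ FA A 𝓘(ℝ, V)] [LieAlgebroid 𝓘(ℝ, V) FA A]
  {FE : Type*} [NormedAddCommGroup FE] [NormedSpace ℝ FE] [FiniteDimensional ℝ FE] {E : M → Type*}
  [TopologicalSpace (TotalSpace FE E)] [∀ x, AddCommGroup (E x)] [∀ x, Module ℝ (E x)]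
  [∀ x, TopologicalSpace (E x)] [FiberBundle FE E] [VectorBundle ℝ FE E]
  [ContMDiffVectorBundle ∞ FE E 𝓘(ℝ, V)]

/-- The restriction of sections of the pullback bundle along a face map. -/
def restrictFace (j : Fin (k + 2)) :
    PullbackSections (k + 1) V FE E →+ PullbackSections k V FE E where
  toFun S := ⟨fun p => S (faceMap j p.1, p.2),
    (contMDiff_pullback_iff (E := E) fun p => S (faceMap j p.1, p.2)).2
      (((contMDiff_pullback_iff (E := E) S).1 S.contMDiff).comp
        (((contDiff_faceMap j).contMDiff.comp contMDiff_fst).prodMk contMDiff_snd))⟩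
  map_zero' := rfl
  map_add' _ _ := rfl

theorem fiberDeriv_comp_faceMap (j : Fin (k + 2)) (S : PullbackSections (k + 1) V FE E)
    (s u : Fin k → ℝ) (x : M) :
    fiberDeriv FE (E := E) (fun τ => S (faceMap j τ, x)) s u =
      fiberDeriv FE (E := E) (fun τ => S (τ, x)) (faceMap j s) (faceLin j u) := by
  have h := (differentiable_time S x (faceMap j s)).hasFDerivAt.comp s (hasFDerivAt_faceMap j s)
  exact congrArg (fun T : (Fin k → ℝ) →L[ℝ] FE =>
    (VectorBundle.continuousLinearEquivAt ℝ FE E x).symm (T u)) h.fderiv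

theorem restrictFace_affineOp (j : Fin (k + 2))
    (D : Fin (k + 2) → RConnection (anchorHom 𝓘(ℝ, V) FA A) Cₛ^∞⟮𝓘(ℝ, V); FE, E⟯)
    (u : Fin k → ℝ) (a : Cₛ^∞⟮𝓘(ℝ, V); FA, A⟯) (S : PullbackSections (k + 1) V FE E) :
    restrictFace j (affineOp D (faceLin j u) a S) =
      affineOp (fun i => D (j.succAbove i)) u a (restrictFace j S) := by
  ext ⟨s, x⟩
  refine (affineOp_apply D (faceLin j u) a S (faceMap j s) x).trans ((?_ : _ = _).trans
    (affineOp_apply (fun i => D (j.succAbove i)) u a (restrictFace j S) s x).symm)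
  refine congrArg₂ (fun v w : E x => v + w) (fiberDeriv_comp_faceMap j S s u x).symm ?_
  rw [Fin.sum_univ_succAbove _ j]
  simp only [weight_faceMap, Fin.insertNth_apply_same, Fin.insertNth_apply_succAbove, zero_smul,
    zero_add]
  rfl

/-- The Lie algebra homomorphism `(u, a) ↦ (faceLin j u, a)` between sections of `Tℝ^k × A` and of
`Tℝ^(k+1) × A`. -/
def faceLieHom (j : Fin (k + 2)) (L : Type*) [LieRing L] [LieAlgebra ℝ L] :
    (Fin k → ℝ) × L →ₗ⁅ℝ⁆ (Fin (k + 1) → ℝ) × L where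
  toLinearMap := (faceLin j).toLinearMap.prodMap LinearMap.id
  map_lie' := Prod.ext (map_zero (faceLin j)) rfl

theorem chernForm_affineConnection_face (j : Fin (k + 2))
    (D : Fin (k + 2) → RConnection (anchorHom 𝓘(ℝ, V) FA A) Cₛ^∞⟮𝓘(ℝ, V); FE, E⟯) (p : ℕ)
    (a : Fin (2 * p) → (Fin k → ℝ) × Cₛ^∞⟮𝓘(ℝ, V); FA, A⟯) (s : Fin k → ℝ) (x : M) :
    (affineConnection D).chernForm fiberTrace p (faceLieHom j _ ∘ a) (faceMap j s, x) =
      (affineConnection fun i => D (j.succAbove i)).chernForm fiberTrace p a (s, x) :=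
  RConnection.chernForm_eq_of_intertwining (r := restrictFace j) (x := (faceMap j s, x))
    (x' := (s, x)) (fun b S => restrictFace_affineOp j D b.1 b.2 S) (LinearEquiv.refl ℝ (E x))
    (fun _ => rfl) p a

theorem affineOp_zero_zero
    (D : Fin 1 → RConnection (anchorHom 𝓘(ℝ, V) FA A) Cₛ^∞⟮𝓘(ℝ, V); FE, E⟯)
    (a : Cₛ^∞⟮𝓘(ℝ, V); FA, A⟯) (S : PullbackSections 0 V FE E) :
    sliceSection (affineOp (k := 0) D 0 a S) 0 = (D 0).toFun a (sliceSection S 0) := by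
  ext x
  have timeDeriv_zero : (sliceSection (timeDeriv 0 S) 0 x : E x) = 0 := by
    change fiberDeriv FE (E := E) (fun τ => S (τ, x)) 0 0 = 0
    simp only [fiberDeriv]
    exact (congrArg _ (map_zero _)).trans (map_zero _)
  have weight_eq_one : weight V M (0 : Fin 1) ((0 : Fin 0 → ℝ), x) = 1 :=
    (Fin.sum_univ_one _).symm.trans (sum_weight (V := V) (k := 0) 0 x)
  refine (affineOp_apply D 0 a S 0 x).trans ?_
  rw [timeDeriv_zero, zero_add, Fin.sum_univ_one, weight_eq_one, one_smul]

/-- The inclusion `a ↦ (0, a)` of the sections of `A` into the sections of `Tℝ^k × A`. -/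
def inrLieHom (k : ℕ) (L : Type*) [LieRing L] [LieAlgebra ℝ L] : L →ₗ⁅ℝ⁆ (Fin k → ℝ) × L where
  toLinearMap := LinearMap.inr ℝ (Fin k → ℝ) L
  map_lie' := rfl

theorem chernForm_affineConnection_zero
    (D : Fin 1 → RConnection (anchorHom 𝓘(ℝ, V) FA A) Cₛ^∞⟮𝓘(ℝ, V); FE, E⟯) (p : ℕ)
    (a : Fin (2 * p) → Cₛ^∞⟮𝓘(ℝ, V); FA, A⟯) (x : M) :
    (affineConnection (k := 0) D).chernForm fiberTrace p (inrLieHom 0 _ ∘ a) (0, x) =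
      (D 0).chernForm fiberTrace p a x :=
  let restrict : PullbackSections 0 V FE E →+ Cₛ^∞⟮𝓘(ℝ, V); FE, E⟯ :=
    { toFun := fun S => sliceSection S 0, map_zero' := rfl, map_add' := fun _ _ => rfl }
  RConnection.chernForm_eq_of_intertwining (r := restrict) (x := ((0 : Fin 0 → ℝ), x))
    (x' := x) (affineOp_zero_zero D) (LinearEquiv.refl ℝ (E x)) (fun _ => rfl) p a

theorem differential_chernForm_fiberTrace
    (D : RConnection (anchorHom 𝓘(ℝ, V) FA A) Cₛ^∞⟮𝓘(ℝ, V); FE, E⟯) (p : ℕ) :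
    differential (anchorHom 𝓘(ℝ, V) FA A) (D.chernForm fiberTrace p) = 0 :=
  D.differential_chernForm fiberTrace (fun a φ =>
    fiberTrace_commutator (X := LieAlgebroid.anchor.onSections a) (D.isCDO a) φ) p

theorem differential_chernForm_affineConnection
    (D : Fin (k + 1) → RConnection (anchorHom 𝓘(ℝ, V) FA A) Cₛ^∞⟮𝓘(ℝ, V); FE, E⟯) (p : ℕ) :
    differential (prodAnchorHom (V := V) k FA A)
      ((affineConnection D).chernForm fiberTrace p) = 0 :=
  (affineConnection D).differential_chernForm fiberTrace (fun a φ =>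
    fiberTrace_commutator (X := prodVectorField a.1 (LieAlgebroid.anchor.onSections a.2))
      ((affineConnection D).isCDO a) φ) p

end AffineFaces

section FiberIntegration

open MeasureTheory

variable {k m n : ℕ}

theorem removeNth_castAdd_append {L : Type*} (u : Fin (k + 1) → L) (a : Fin (m + 1) → L)
    (j : Fin (k + 1)) :
    (Fin.castAdd (m + 1) j : Fin (k + 1 + m + 1)).removeNth
        (Fin.append (m := k + 1) (n := m + 1) u a) =
      Fin.append (j.removeNth u) a ∘ Fin.cast (Nat.succ_add_eq_add_succ k m) := by
  funext i
  obtain ⟨i, rfl⟩ := (finCongr (Nat.succ_add_eq_add_succ k m)).symm.surjective i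
  refine Fin.addCases (fun i => ?_) (fun i => ?_) i
  · have h : (Fin.castAdd (m + 1) j : Fin (k + 1 + m + 1)).succAbove
        (Fin.cast (Nat.succ_add_eq_add_succ k m).symm (Fin.castAdd (m + 1) i)) =
          Fin.castAdd (m + 1) (j.succAbove i) := by
      ext
      simp only [Fin.succAbove, Fin.lt_def, Fin.val_castSucc, Fin.val_cast, Fin.val_castAdd]
      split <;> rfl
    simp [Fin.removeNth, h]
  · have h : (Fin.castAdd (m + 1) j : Fin (k + 1 + m + 1)).succAbove
        (Fin.cast (Nat.succ_add_eq_add_succ k m).symm (Fin.natAdd k i)) =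
          Fin.natAdd (k + 1) i := by
      ext
      simp only [Fin.succAbove, Fin.lt_def, Fin.val_castSucc, Fin.val_cast, Fin.val_castAdd,
        Fin.val_natAdd]
      grind
    simp [Fin.removeNth, h]

theorem append_comp_finAddFlip {L : Type*} (u : Fin k → L) (a : Fin m → L) :
    Fin.append a u ∘ finAddFlip = Fin.append u a := by
  funext i
  refine Fin.addCases (fun i => ?_) (fun i => ?_) i <;> simp

theorem integral_simplex_zero {G : Type*} [NormedAddCommGroup G] [NormedSpace ℝ G]
    [CompleteSpace G] (f : (Fin 0 → ℝ) → G) : ∫ t in simplex 0, f t = f 0 := by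
  have simplex_eq_univ : simplex 0 = Set.univ := by
    ext t
    simp [simplex]
  have volume_univ : (volume : Measure (Fin 0 → ℝ)).real Set.univ = 1 := by
    simp [Measure.real, volume_pi]
  have f_eq_const : f = fun _ => f 0 := funext fun _ => congrArg f (Subsingleton.elim _ _)
  rw [simplex_eq_univ, setIntegral_univ, f_eq_const, integral_const, volume_univ, one_smul]

theorem sum_alternatingMap_apply {R L N ι κ : Type*} [Semiring R] [AddCommMonoid L] [Module R L]
    [AddCommMonoid N] [Module R N] (s : Finset κ) (η : κ → L [⋀^ι]→ₗ[R] N) (a : ι → L) :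
    (∑ j ∈ s, η j) a = ∑ j ∈ s, η j a :=
  map_sum (⟨⟨fun η => η a, rfl⟩, fun _ _ => rfl⟩ : L [⋀^ι]→ₗ[R] N →+ N) η s

/-- The `k`-form `w ↦ η((w_1, 0), ..., (w_k, 0), (0, a_1), ..., (0, a_m))` on `ℝ^n`, the component
of `η` along the directions of the parameters. -/
def timeForm {L N : Type*} [AddCommGroup L] [Module ℝ L] [AddCommGroup N] [Module ℝ N]
    (η : ((Fin n → ℝ) × L) [⋀^Fin (k + m)]→ₗ[ℝ] N) (a : Fin m → L) :
    (Fin n → ℝ) [⋀^Fin k]→ₗ[ℝ] N :=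
  (interior (fun i => (0, a i)) (η.domDomCongr finAddFlip)).compLinearMap
    (LinearMap.inl ℝ (Fin n → ℝ) L)

theorem timeForm_apply {L N : Type*} [AddCommGroup L] [Module ℝ L] [AddCommGroup N] [Module ℝ N]
    (η : ((Fin n → ℝ) × L) [⋀^Fin (k + m)]→ₗ[ℝ] N) (a : Fin m → L) (w : Fin k → Fin n → ℝ) :
    timeForm η a w = η (Fin.append (fun i => (w i, 0)) (fun i => (0, a i))) :=
  congrArg η (append_comp_finAddFlip (fun i => (w i, 0)) (fun i => (0, a i)))

theorem faceLieHom_comp_append {L : Type*} [LieRing L] [LieAlgebra ℝ L] (j : Fin (n + 2))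
    (w : Fin k → Fin n → ℝ) (a : Fin m → L) :
    faceLieHom j L ∘ Fin.append (fun i => (w i, 0)) (fun i => (0, a i)) =
      Fin.append (fun i => (faceLin j (w i), 0)) (fun i => (0, a i)) := by
  funext i
  refine Fin.addCases (fun i => ?_) (fun i => ?_) i
  · rw [Function.comp_apply, Fin.append_left, Fin.append_left]
    rfl
  · rw [Function.comp_apply, Fin.append_right, Fin.append_right]
    exact Prod.ext (map_zero (faceLin j)) rfl

variable {V : Type*} [NormedAddCommGroup V] [NormedSpace ℝ V] [FiniteDimensional ℝ V]
  {M : Type*} [TopologicalSpace M] [ChartedSpace V M] [IsManifold 𝓘(ℝ, V) ∞ M] [T2Space M]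
  {FA : Type*} [NormedAddCommGroup FA] [NormedSpace ℝ FA] [FiniteDimensional ℝ FA] {A : M → Type*}
  [TopologicalSpace (TotalSpace FA A)] [∀ x, AddCommGroup (A x)] [∀ x, Module ℝ (A x)]
  [∀ x, TopologicalSpace (A x)] [FiberBundle FA A] [VectorBundle ℝ FA A]
  [ContMDiffVectorBundle ∞ FA A 𝓘(ℝ, V)] [LieAlgebroid 𝓘(ℝ, V) FA A]

theorem prodAnchorHom_single_zero_apply (j : Fin k)
    (f : C^∞⟮𝓘(ℝ, Fin k → ℝ).prod 𝓘(ℝ, V), (Fin k → ℝ) × M; ℝ⟯) (t : Fin k → ℝ) (x : M) :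
    prodAnchorHom (V := V) k FA A (Pi.single j 1, 0) f (t, x) =
      fderiv ℝ (fun t => f (t, x)) t (Pi.single j 1) := by
  change vectorFieldDerivation (prodVectorField (Pi.single j 1)
    ((LieAlgebroid.anchor (I := 𝓘(ℝ, V)) (F := FA) (A := A)).onSections 0)) f (t, x) = _
  rw [map_zero, prodVectorField_zero_right]

theorem differential_fiberIntegral
    (η : ((Fin k → ℝ) × Cₛ^∞⟮𝓘(ℝ, V); FA, A⟯) [⋀^Fin (k + m)]→ₗ[ℝ]
      C^∞⟮𝓘(ℝ, Fin k → ℝ).prod 𝓘(ℝ, V), (Fin k → ℝ) × M; ℝ⟯)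
    (a : Fin (m + 1) → Cₛ^∞⟮𝓘(ℝ, V); FA, A⟯) :
    differential (anchorHom 𝓘(ℝ, V) FA A) (fiberIntegral η) a =
      integrateSimplex (differential (prodAnchorHom (V := V) k FA A)
        (interior (fun j => (Pi.single j 1, 0)) η) fun i => (0, a i)) :=
  differential_eq_of_intertwining (inrLieHom k _) integrateSimplex
    (fun _ f => (vectorFieldDerivation_integrateSimplex _ f).symm) _ _ (fun _ => rfl) a

theorem differential_interior_single_of_closed
    {η : ((Fin (k + 1) → ℝ) × Cₛ^∞⟮𝓘(ℝ, V); FA, A⟯) [⋀^Fin (k + 1 + m)]→ₗ[ℝ]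
      C^∞⟮𝓘(ℝ, Fin (k + 1) → ℝ).prod 𝓘(ℝ, V), (Fin (k + 1) → ℝ) × M; ℝ⟯}
    (hη : differential (prodAnchorHom (V := V) (k + 1) FA A) η = 0)
    (a : Fin (m + 1) → Cₛ^∞⟮𝓘(ℝ, V); FA, A⟯) :
    (-1 : ℝ) ^ (k + 1 + 1) • differential (prodAnchorHom (V := V) (k + 1) FA A)
        (interior (fun j => (Pi.single j 1, 0)) η) (fun i => (0, a i)) =
      ∑ j : Fin (k + 1), (-1 : ℝ) ^ (j : ℕ) •
        prodAnchorHom (V := V) (k + 1) FA A (Pi.single j 1, 0)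
          (timeForm (η.domDomCongr (finCongr (Nat.succ_add_eq_add_succ k m))) a
            fun i => Pi.single (j.succAbove i) 1) := by
  have cartan := differential_append (prodAnchorHom (V := V) (k + 1) FA A)
    (fun j => (Pi.single j 1, 0)) η (fun i => (0, a i))
    (fun i j => Prod.ext rfl (lie_self _)) (fun i j => Prod.ext rfl (zero_lie _))
  rw [hη, AlternatingMap.zero_apply] at cartan
  simp only [neg_one_pow_zsmul ℝ, removeNth_castAdd_append] at cartan
  rw [pow_succ, mul_neg_one, neg_smul, ← eq_neg_of_add_eq_zero_left cartan.symm]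
  simp only [timeForm_apply]
  rfl

theorem differential_fiberIntegral_of_closed
    {η : ((Fin (k + 1) → ℝ) × Cₛ^∞⟮𝓘(ℝ, V); FA, A⟯) [⋀^Fin (k + 1 + m)]→ₗ[ℝ]
      C^∞⟮𝓘(ℝ, Fin (k + 1) → ℝ).prod 𝓘(ℝ, V), (Fin (k + 1) → ℝ) × M; ℝ⟯}
    (hη : differential (prodAnchorHom (V := V) (k + 1) FA A) η = 0)
    (a : Fin (m + 1) → Cₛ^∞⟮𝓘(ℝ, V); FA, A⟯) (x : M) :
    (-1 : ℝ) ^ (k + 1 + 1) • differential (anchorHom 𝓘(ℝ, V) FA A) (fiberIntegral η) a x =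
      ∑ j : Fin (k + 2), (-1 : ℝ) ^ (j : ℕ) • ∫ s in simplex k,
        timeForm (η.domDomCongr (finCongr (Nat.succ_add_eq_add_succ k m))) a
          (fun i => faceLin j (Pi.single i 1)) (faceMap j s, x) := by
  set α := timeForm (η.domDomCongr (finCongr (Nat.succ_add_eq_add_succ k m))) a
  calc
    _ = integrateSimplex ((-1 : ℝ) ^ (k + 1 + 1) •
        differential (prodAnchorHom (V := V) (k + 1) FA A)
          (interior (fun j => (Pi.single j 1, 0)) η) fun i => (0, a i)) x := by
      rw [map_smul, ← differential_fiberIntegral]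
      rfl
    _ = ∑ j : Fin (k + 1), (-1 : ℝ) ^ (j : ℕ) • ∫ t in simplex (k + 1),
        fderiv ℝ (fun t => α (fun i => Pi.single (j.succAbove i) 1) (t, x)) t
          (Pi.single j 1) := by
      rw [differential_interior_single_of_closed hη, map_sum, sum_contMDiffMap_apply]
      refine Finset.sum_congr rfl fun j _ => ?_
      simp only [← prodAnchorHom_single_zero_apply (FA := FA) (A := A), map_smul]
      rfl
    _ = _ := sum_integral_simplex_fderiv_eq_sum_faces
      (fun t => (evalAt (t, x)).compAlternatingMap α)
      fun v => (smooth_time (α v) x).of_le (by norm_cast)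

end FiberIntegration

section ChernSimonsFormula

variable {V : Type*} [NormedAddCommGroup V] [NormedSpace ℝ V] [FiniteDimensional ℝ V]
  {M : Type*} [TopologicalSpace M] [ChartedSpace V M] [IsManifold 𝓘(ℝ, V) ∞ M] [T2Space M]
  {FA : Type*} [NormedAddCommGroup FA] [NormedSpace ℝ FA] [FiniteDimensional ℝ FA] {A : M → Type*}
  [TopologicalSpace (TotalSpace FA A)] [∀ x, AddCommGroup (A x)] [∀ x, Module ℝ (A x)]
  [∀ x, TopologicalSpace (A x)] [FiberBundle FA A] [VectorBundle ℝ FA A]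
  [ContMDiffVectorBundle ∞ FA A 𝓘(ℝ, V)] [LieAlgebroid 𝓘(ℝ, V) FA A]
  {FE : Type*} [NormedAddCommGroup FE] [NormedSpace ℝ FE] [FiniteDimensional ℝ FE] {E : M → Type*}
  [TopologicalSpace (TotalSpace FE E)] [∀ x, AddCommGroup (E x)] [∀ x, Module ℝ (E x)]
  [∀ x, TopologicalSpace (E x)] [FiberBundle FE E] [VectorBundle ℝ FE E]
  [ContMDiffVectorBundle ∞ FE E 𝓘(ℝ, V)] {p k m : ℕ}

theorem chernSimons_apply (h : k + m = 2 * p)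
    (D : Fin (k + 1) → RConnection (anchorHom 𝓘(ℝ, V) FA A) Cₛ^∞⟮𝓘(ℝ, V); FE, E⟯)
    (a : Fin m → Cₛ^∞⟮𝓘(ℝ, V); FA, A⟯) (x : M) :
    chernSimons p k m h D a x = ∫ t in simplex k,
      timeForm (((affineConnection D).chernForm fiberTrace p).domDomCongr (finCongr h.symm)) a
        (fun i => Pi.single i 1) (t, x) := by
  cases k with
  | zero =>
    have append_eq : (Fin.append (fun i : Fin 0 => (Pi.single i 1, 0)) (fun i => (0, a i)) :
        Fin (0 + m) → (Fin 0 → ℝ) × Cₛ^∞⟮𝓘(ℝ, V); FA, A⟯) ∘ Fin.cast h.symm =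
          inrLieHom 0 _ ∘ a ∘ Fin.cast (h.symm.trans (zero_add m)) :=
      congrArg (· ∘ Fin.cast h.symm) (Fin.append_left_nil _ _ rfl)
    rw [integral_simplex_zero, timeForm_apply]
    refine ((congrArg (fun b => (affineConnection (k := 0) D).chernForm fiberTrace p b (0, x))
      append_eq).trans (chernForm_affineConnection_zero D p _ x)).symm
  | succ k => simp only [timeForm_apply]; rfl

theorem chernSimons_face_apply (h : k + m = 2 * p)
    (D : Fin (k + 2) → RConnection (anchorHom 𝓘(ℝ, V) FA A) Cₛ^∞⟮𝓘(ℝ, V); FE, E⟯) (j : Fin (k + 2))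
    (a : Fin m → Cₛ^∞⟮𝓘(ℝ, V); FA, A⟯) (x : M) :
    chernSimons p k m h (fun i => D (j.succAbove i)) a x = ∫ s in simplex k,
      timeForm (((affineConnection D).chernForm fiberTrace p).domDomCongr (finCongr h.symm)) a
        (fun i => faceLin j (Pi.single i 1)) (faceMap j s, x) := by
  rw [chernSimons_apply]
  congr 1 with s
  rw [timeForm_apply, timeForm_apply, ← faceLieHom_comp_append]
  exact (chernForm_affineConnection_face j D p _ s x).symm

theorem differential_chernSimons (h : (k + 1) + m = 2 * p) (h' : k + (m + 1) = 2 * p)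
    (D : Fin (k + 2) → RConnection (anchorHom 𝓘(ℝ, V) FA A) Cₛ^∞⟮𝓘(ℝ, V); FE, E⟯) :
    (-1 : ℝ) ^ ((k + 1) + 1) •
        differential (anchorHom 𝓘(ℝ, V) FA A) (chernSimons p (k + 1) m h D) =
      ∑ j : Fin (k + 2), (-1 : ℝ) ^ (j : ℕ) •
        chernSimons p k (m + 1) h' (fun i => D (j.succAbove i)) := by
  have closed : differential (prodAnchorHom (V := V) (k + 1) FA A)
      (((affineConnection D).chernForm fiberTrace p).domDomCongr (finCongr h.symm)) = 0 := by
    ext1 v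
    rw [differential_domDomCongr, differential_chernForm_affineConnection]
    rfl
  ext a x
  rw [sum_alternatingMap_apply, sum_contMDiffMap_apply]
  refine (differential_fiberIntegral_of_closed closed a x).trans ?_
  refine Finset.sum_congr rfl fun j _ => congrArg (((-1 : ℝ) ^ (j : ℕ)) • ·) ?_
  exact (chernSimons_face_apply h' D j a x).symm

end ChernSimonsFormula

end LieAlgebroidCS

end

theorem mainTheorem1
    {V : Type*} [NormedAddCommGroup V] [NormedSpace ℝ V] [FiniteDimensional ℝ V]
    {M : Type*} [TopologicalSpace M] [ChartedSpace V M] [IsManifold 𝓘(ℝ, V) ∞ M] [T2Space M]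
    {FA : Type*} [NormedAddCommGroup FA] [NormedSpace ℝ FA] [FiniteDimensional ℝ FA]
    {A : M → Type*} [TopologicalSpace (TotalSpace FA A)] [∀ x, AddCommGroup (A x)]
    [∀ x, Module ℝ (A x)] [∀ x, TopologicalSpace (A x)] [FiberBundle FA A] [VectorBundle ℝ FA A]
    [ContMDiffVectorBundle ∞ FA A 𝓘(ℝ, V)] [LieAlgebroid 𝓘(ℝ, V) FA A]
    {FE : Type*} [NormedAddCommGroup FE] [NormedSpace ℝ FE] [FiniteDimensional ℝ FE]
    {E : M → Type*} [TopologicalSpace (TotalSpace FE E)] [∀ x, AddCommGroup (E x)]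
    [∀ x, Module ℝ (E x)] [∀ x, TopologicalSpace (E x)] [FiberBundle FE E] [VectorBundle ℝ FE E]
    [ContMDiffVectorBundle ∞ FE E 𝓘(ℝ, V)] :
    -- the formula for `0 < k + 1 ≤ 2 p`, with `m = 2 p - (k + 1)` the degree of the form
    (∀ (p k m : ℕ) (h : (k + 1) + m = 2 * p)
      (D : Fin (k + 2) → RConnection (anchorHom 𝓘(ℝ, V) FA A) Cₛ^∞⟮𝓘(ℝ, V); FE, E⟯),
      (-1 : ℝ) ^ ((k + 1) + 1) •
          differential (anchorHom 𝓘(ℝ, V) FA A) (chernSimons p (k + 1) m h D) =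
        ∑ j : Fin (k + 2), (-1 : ℝ) ^ (j : ℕ) •
          chernSimons p k (m + 1) (by omega) (fun i => D (j.succAbove i))) ∧
    (∀ (p : ℕ), 1 ≤ p →
      ∀ D : RConnection (anchorHom 𝓘(ℝ, V) FA A) Cₛ^∞⟮𝓘(ℝ, V); FE, E⟯,
        differential (anchorHom 𝓘(ℝ, V) FA A) (D.chernForm fiberTrace p) = 0) :=
  ⟨fun _ _ _ h D => differential_chernSimons h _ D,
    fun p _ D => differential_chernForm_fiberTrace D p⟩
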